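/- **Notation.** All derivatives are weak derivatives. For a (measurable) field $u$ on $\mathbb{R}^3\times(0,\infty)$ and $m\ge 1$ let $\|u\|_{\infty,m}:=\operatorname{ess\,sup}_{(x,t)\in\mathbb{R}^3\times(0,\infty)}(1+|x|^m)\,|u(x,t)|$. $D_0^{1,2}(\mathbb{R}^3)$ is the completion of $C_0^\infty(\mathbb{R}^3)$ in the norm $\|\nabla(\cdot)\|_2$, realized as a subspace of $L^6(\mathbb{R}^3)$. For a second-order tensor field $\mathbf G=(G_{jh})$, $(\operatorname{div}\mathbf G)_h=\sum_{j}\partial_jG_{jh}$, and $D^k$ denotes spatial derivatives. **Lemma 2.3.** There is a numerical constant $C>0$ such that the following holds. Let $\mathbf G$ be a second-order tensor field in $\mathbb{R}^3\times(0,\infty)$ such that $$\|\mathbf G\|_{\infty,2}+\sum_{|k|=0}^1\|D^k(\operatorname{div}\mathbf G)\|_{\infty,|k|+3}<\infty.$$ Then the Cauchy problem $$\partial_t\mathbf v=\Delta\mathbf v-\nabla\phi+\operatorname{div}\mathbf G,\qquad \operatorname{div}\mathbf v=0\quad\text{in }\mathbb{R}^3\times(0,\infty),\qquad \mathbf v(x,0)=\mathbf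 0,\ x\in\mathbb{R}^3,$$ has one and only one solution (equations understood almost everywhere, the initial value in $L^2(\mathbb{R}^3)$) such that for all $\tau>0$ $$(\mathbf v,\phi)\in\big[W^{1,2}(0,\tau;L^2(\mathbb{R}^3))\cap L^2(0,\tau;W^{2,2}(\mathbb{R}^3))\big]\times L^2(0,\tau;D_0^{1,2}(\mathbb{R}^3)).$$ Moreover, $\sum_{|k|=0}^2\|D^k\mathbf v\|_{\infty,|k|+1}+\sum_{|k|=0}^1\|D^k\phi\|_{\infty,|k|+2}<\infty$, and $$\sum_{|k|=0}^2\|D^k\mathbf v\|_{\infty,|k|+1}+\sum_{|k|=0}^1\|D^k\phi\|_{\infty,|k|+2}\le C\Big(\|\mathbf G\|_{\infty,2}+\sum_{|k|=0}^1\|D^k(\operatorname{div}\mathbf G)\|_{\infty,|k|+3}\Big).$$ -/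

import Mathlib

open MeasureTheory Set Filter Topology
open scoped ENNReal NNReal ContDiff

/-- Points and vectors of three-dimensional Euclidean space. -/
abbrev E3 : Type := EuclideanSpace ℝ (Fin 3)

/-- Second-order tensors `M = (M_{jh})`, with the Euclidean (Frobenius) norm. -/
abbrev T3 : Type := EuclideanSpace ℝ (Fin 3 × Fin 3)

/-- Lebesgue measure on the space-time region `I × ℝ³`; a point is written `(t, x)`. -/
noncomputable def stMeasure (I : Set ℝ) : Measure (ℝ × E3) :=
  ((volume : Measure ℝ).restrict I).prod (volume : Measure E3)

/-- `η ∈ C₀^∞(ℝ³)`. -/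
def IsTestFun (η : E3 → ℝ) : Prop := ContDiff ℝ ∞ η ∧ HasCompactSupport η

/-- The classical partial derivative `∂ᵢ η`. -/
noncomputable def partialD (i : Fin 3) (η : E3 → ℝ) (x : E3) : ℝ :=
  fderiv ℝ η x (EuclideanSpace.single i 1)

/-- The weighted norm `‖u‖_{∞,m} = ess sup_{(x,t) ∈ ℝ³ × (0,∞)} (1 + |x|^m) |u(x,t)|`. -/
noncomputable def wNorm {F : Type*} [NormedAddCommGroup F] (m : ℕ) (u : ℝ → E3 → F) : ℝ≥0∞ :=
  essSup (fun p : ℝ × E3 => ENNReal.ofReal ((1 + ‖p.2‖ ^ m) * ‖u p.1 p.2‖)) (stMeasure (Ioi 0))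

section Weak

variable {F : Type*} [NormedAddCommGroup F] [NormedSpace ℝ F]

/-- `g` is the weak partial derivative `∂ᵢ u` on `ℝ³`. -/
def HasWeakPartial (i : Fin 3) (u g : E3 → F) : Prop :=
  LocallyIntegrable u volume ∧ LocallyIntegrable g volume ∧
    ∀ η : E3 → ℝ, IsTestFun η → ∫ x, partialD i η x • u x = -∫ x, η x • g x

/-- `f` is the weak divergence of the tensor field `M` on `ℝ³`: `f_h = ∑ⱼ ∂ⱼ M_{jh}`. -/
def HasWeakDiv (M : E3 → T3) (f : E3 → E3) : Prop :=
  LocallyIntegrable M volume ∧ LocallyIntegrable f volume ∧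
    ∀ η : E3 → ℝ, IsTestFun η → ∀ h : Fin 3,
      ∑ j : Fin 3, ∫ x, partialD j η x * M x (j, h) = -∫ x, η x * f x h

/-- `Du = (∂₁u, ∂₂u, ∂₃u)` is the (measurable) weak spatial gradient of `u` on `I × ℝ³`. -/
def HasWeakGrad (I : Set ℝ) (u : ℝ → E3 → F) (Du : Fin 3 → ℝ → E3 → F) : Prop :=
  (∀ i, AEStronglyMeasurable (Function.uncurry (Du i)) (stMeasure I)) ∧
    ∀ᵐ t ∂(volume.restrict I), ∀ i, HasWeakPartial i (u t) (Du i t)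

/-- `u'` is the weak time derivative of `u` on the open time interval `I`:
`∫ ψ' u dt = -∫ ψ u' dt` for all `ψ ∈ C₀^∞(I)`, as an identity between functions of `x`
that are identified when equal almost everywhere. -/
def HasWeakTimeDeriv (I : Set ℝ) (u u' : ℝ → E3 → F) : Prop :=
  (∀ᵐ x ∂(volume : Measure E3),
    LocallyIntegrableOn (fun t => u t x) I volume ∧
    LocallyIntegrableOn (fun t => u' t x) I volume) ∧
  ∀ ψ : ℝ → ℝ, ContDiff ℝ ∞ ψ → HasCompactSupport ψ → tsupport ψ ⊆ I →
    ∀ᵐ x ∂(volume : Measure E3), ∫ t, deriv ψ t • u t x = -∫ t, ψ t • u' t x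

/-- `u ∈ L²(0,τ; L²(ℝ³))`, identified as usual with `L²((0,τ) × ℝ³)`. -/
def MemL2L2 (τ : ℝ) (u : ℝ → E3 → F) : Prop :=
  MemLp (Function.uncurry u) 2 (stMeasure (Ioo 0 τ))

/-- `u ∈ W^{1,2}(0,τ; L²(ℝ³))`. -/
def MemW12L2 (τ : ℝ) (u : ℝ → E3 → F) : Prop :=
  MemL2L2 τ u ∧ ∃ u' : ℝ → E3 → F, MemL2L2 τ u' ∧ HasWeakTimeDeriv (Ioo 0 τ) u u'

/-- `u ∈ L²(0,τ; W^{2,2}(ℝ³))`. -/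
def MemL2W22 (τ : ℝ) (u : ℝ → E3 → F) : Prop :=
  MemL2L2 τ u ∧
    ∃ (Du : Fin 3 → ℝ → E3 → F) (D2u : Fin 3 → Fin 3 → ℝ → E3 → F),
      (∀ i, MemL2L2 τ (Du i)) ∧ (∀ i j, MemL2L2 τ (D2u i j)) ∧
      HasWeakGrad (Ioo 0 τ) u Du ∧ ∀ i, HasWeakGrad (Ioo 0 τ) (Du i) (D2u i)

end Weak

/-- `q ∈ D₀^{1,2}(ℝ³)` with gradient `g`. The completion of `C₀^∞(ℝ³)` in the norm `‖∇·‖₂` is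
realized, through the Sobolev inequality `‖z‖₆ ≤ γ ‖∇z‖₂`, as a space of functions in `L⁶(ℝ³)`:
`q` is the `L⁶`-limit of test functions whose gradients converge to `g` in `L²`. -/
def IsD012 (q : E3 → ℝ) (g : Fin 3 → E3 → ℝ) : Prop :=
  MemLp q 6 volume ∧ (∀ i, MemLp (g i) 2 volume) ∧
    ∃ η : ℕ → E3 → ℝ, (∀ n, IsTestFun (η n)) ∧
      Tendsto (fun n => eLpNorm (fun x => η n x - q x) 6 volume) atTop (𝓝 0) ∧
      ∀ i, Tendsto (fun n => eLpNorm (fun x => partialD i (η n) x - g i x) 2 volume) atTop (𝓝 0)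

/-- `φ ∈ L²(0,τ; D₀^{1,2}(ℝ³))`, the norm of `D₀^{1,2}(ℝ³)` being `‖∇·‖₂`. -/
def MemL2D012 (τ : ℝ) (φ : ℝ → E3 → ℝ) : Prop :=
  AEStronglyMeasurable (Function.uncurry φ) (stMeasure (Ioo 0 τ)) ∧
    ∃ Dφ : Fin 3 → ℝ → E3 → ℝ, (∀ i, MemL2L2 τ (Dφ i)) ∧
      ∀ᵐ t ∂(volume.restrict (Ioo 0 τ)), IsD012 (φ t) (fun i => Dφ i t)

/-- `(v, φ)` is a solution of the Cauchy problem
`∂ₜ v = Δ v - ∇φ + f`, `div v = 0` in `ℝ³ × (0,∞)`, `v(·,0) = 0`, with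
`v ∈ W^{1,2}(0,τ; L²) ∩ L²(0,τ; W^{2,2})` and `φ ∈ L²(0,τ; D₀^{1,2})` for all `τ > 0`. -/
structure SolvesStokes (f : ℝ → E3 → E3) (v : ℝ → E3 → E3) (φ : ℝ → E3 → ℝ) : Prop where
  mem_time : ∀ τ : ℝ, 0 < τ → MemW12L2 τ v
  mem_space : ∀ τ : ℝ, 0 < τ → MemL2W22 τ v
  mem_pressure : ∀ τ : ℝ, 0 < τ → MemL2D012 τ φ
  /-- Both equations hold almost everywhere, with weak derivatives. -/
  equations : ∃ (vt : ℝ → E3 → E3) (Dv : Fin 3 → ℝ → E3 → E3)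
      (D2v : Fin 3 → Fin 3 → ℝ → E3 → E3) (Dφ : Fin 3 → ℝ → E3 → ℝ),
    HasWeakTimeDeriv (Ioi 0) v vt ∧ HasWeakGrad (Ioi 0) v Dv ∧
    (∀ i, HasWeakGrad (Ioi 0) (Dv i) (D2v i)) ∧ HasWeakGrad (Ioi 0) φ Dφ ∧
    (∀ᵐ p ∂(stMeasure (Ioi 0)), ∀ h : Fin 3,
      vt p.1 p.2 h = (∑ i, D2v i i p.1 p.2 h) - Dφ h p.1 p.2 + f p.1 p.2 h) ∧
    (∀ᵐ p ∂(stMeasure (Ioi 0)), ∑ i, Dv i p.1 p.2 i = 0)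
  /-- The initial value, in `L²(ℝ³)`, is zero. Since `v` is only given for almost every `t`, the
  limit `t → 0+` disregards null sets of times; equivalently, the representative of `v` that is
  continuous from `[0,∞)` to `L²(ℝ³)` vanishes at `t = 0`. -/
  initial : Tendsto (fun t => eLpNorm (v t) 2 volume)
    (𝓝 (0 : ℝ) ⊓ ae ((volume : Measure ℝ).restrict (Ioi 0))) (𝓝 0)

/-!
Write `f = div G`. The solution is explicit: with the projection `f - ∇Δ⁻¹ div f` of `f`,
`v(t) = ∫₀^∞ e^{σΔ} (f - ∇Δ⁻¹ div f)(t - σ) dσ` and `φ = Δ⁻¹ div f`, where `f` vanishes at negative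
times. Since `-e^{σΔ} Δ⁻¹ = ∫_σ^∞ e^{rΔ} dr`, these functions and their derivatives are finite sums
of *heat potentials* `pot μ α g`, integrals of `∂^α e^{rΔ} g(t - σ)` over `(σ, r)` against one of the
three measures `muA` (`r = σ`), `muB` (`σ < r`) and `muP` (`σ = 0`). No fundamental solution of the
Stokes system has to be computed: the bound `|∂^α K_r(z)| ≤ C (√r + |z|)^{-3-|α|}` for the heat kernel
and the scaling of the measures (`HasOrder`) give all the estimates.

*Decay* (`exists_abs_pot_le`). Integrating the kernel over `(σ, r)` leaves a kernel of size
`|x - y|^{-(3-β+|α|)}`, where `β` is the order of `μ`. Absolute values alone do not suffice for the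
decay of `v`: the decay `|y|^{-3}` of `f` would lose a logarithm. Split the integral at the distance
`R = 1 + |x|` from `0` by a cutoff. Where `|y|` is comparable to `R` the size of the datum decides.
Where `|y|` is much smaller, `f` (or `∂_l f`) is moved onto the smooth kernel as the first (or
second) distributional derivative of `G`, and `|G| ≤ C |y|^{-2}` is integrable enough. Hence the
predicate `IsData n`, which records a datum that is an `n`-th derivative of such a field. For the
second derivatives of `v` and the first of `φ`, one derivative is put on `f`, so that the singularity
of the kernel stays integrable.

*Existence* (`StokesData.solvesStokes`). The weak derivatives of the potentials are found by
pairing with test functions; the equation follows in the same way from `∂_r e^{rΔ} η = e^{rΔ} Δη`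
and the fundamental theorem of calculus. On bounded time intervals the velocity is also bounded by
`C √t (1 + |x|)^{-2}`, which gives the square integrability and the initial value.

*Uniqueness* (`SolvesStokes.ae_unique`). The difference of two solutions is mollified in space. For
almost every `x` it is then absolutely continuous in time, and the energy identity, in which the
pressure drops out because the velocity is solenoidal, shows that it vanishes. The gradient of the
pressure then vanishes too, and the Sobolev inequality makes the pressure itself zero.

The data of the theorem are only measurable and are bounded only almost everywhere; changing them on
a null set (`exists_stokesData`) makes all the bounds hold at every time and point. By uniqueness
every solution inherits the bounds of the explicit one (`SolvesStokes.wNorm_le`).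
-/


/-! ### Calculus of partial derivatives and test functions -/

/-- The standard basis vector `eᵢ` of `ℝ³`. -/
noncomputable abbrev stdVec (i : Fin 3) : E3 := EuclideanSpace.single i 1

lemma norm_stdVec (i : Fin 3) : ‖stdVec i‖ = 1 := by simp [stdVec]

lemma ContDiff.partialD {η : E3 → ℝ} (h : ContDiff ℝ ∞ η) (i : Fin 3) :
    ContDiff ℝ ∞ (partialD i η) := by
  have : ContDiff ℝ ∞ (fderiv ℝ η) := h.fderiv_right (by simp)
  exact this.clm_apply contDiff_const

lemma HasCompactSupport.partialD {η : E3 → ℝ} (h : HasCompactSupport η) (i : Fin 3) :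
    HasCompactSupport (partialD i η) :=
  h.fderiv_apply (𝕜 := ℝ) (stdVec i)

namespace IsTestFun

variable {η θ : E3 → ℝ}

lemma partialD (h : IsTestFun η) (i : Fin 3) : IsTestFun (partialD i η) :=
  ⟨h.1.partialD i, h.2.partialD i⟩

lemma continuous (h : IsTestFun η) : Continuous η := h.1.continuous

lemma differentiable (h : IsTestFun η) : Differentiable ℝ η := h.1.differentiable (by simp)

lemma integrable (h : IsTestFun η) : Integrable η := h.continuous.integrable_of_hasCompactSupport h.2

lemma mul_left {κ : E3 → ℝ} (hκ : ContDiff ℝ ∞ κ) (h : IsTestFun η) :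
    IsTestFun (fun y => κ y * η y) :=
  ⟨hκ.mul h.1, h.2.mul_left⟩

lemma exists_bound (h : IsTestFun η) : ∃ M, 0 ≤ M ∧ ∀ x, ‖η x‖ ≤ M := by
  obtain ⟨M, hM⟩ := h.2.exists_bound_of_continuous h.continuous
  exact ⟨M, (norm_nonneg _).trans (hM 0), hM⟩

lemma comp_sub_left (h : IsTestFun η) (x : E3) : IsTestFun (fun y => η (x - y)) :=
  ⟨h.1.comp (contDiff_const.sub contDiff_id),
    h.2.comp_homeomorph (Homeomorph.subLeft x)⟩

lemma comp_add_right (h : IsTestFun η) (z : E3) : IsTestFun (fun y => η (y + z)) :=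
  ⟨h.1.comp (contDiff_id.add contDiff_const),
    h.2.comp_homeomorph (Homeomorph.addRight z)⟩

lemma sub (h : IsTestFun η) (h' : IsTestFun θ) : IsTestFun (fun y => η y - θ y) :=
  ⟨h.1.sub h'.1, h.2.sub h'.2⟩

lemma zero : IsTestFun (fun _ => 0) := ⟨contDiff_const, HasCompactSupport.zero⟩

end IsTestFun

lemma partialD_comp_sub_left (i : Fin 3) (η : E3 → ℝ) (x y : E3) :
    partialD i (fun y => η (x - y)) y = -partialD i η (x - y) := by
  have h1 : (fun y => η (x - y)) = (fun u => η (x + u)) ∘ (ContinuousLinearEquiv.neg ℝ (M := E3)) := by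
    funext y; simp [sub_eq_add_neg]
  unfold partialD
  rw [h1, ContinuousLinearEquiv.comp_right_fderiv]
  have h2 := fderiv_comp_add_left (𝕜 := ℝ) (f := η) (x := -y) x
  simp only [ContinuousLinearEquiv.neg_apply, h2]
  simp [sub_eq_add_neg]

lemma partialD_comp_add_right (i : Fin 3) (η : E3 → ℝ) (z y : E3) :
    partialD i (fun y => η (y + z)) y = partialD i η (y + z) := by
  unfold partialD
  rw [fderiv_comp_add_right]

lemma partialD_mul (i : Fin 3) {η θ : E3 → ℝ} (hη : ContDiff ℝ ∞ η) (hθ : ContDiff ℝ ∞ θ) (y : E3) :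
    partialD i (fun y => η y * θ y) y = partialD i η y * θ y + η y * partialD i θ y := by
  unfold partialD
  rw [fderiv_fun_mul (hη.differentiable (by simp) y) (hθ.differentiable (by simp) y)]
  simp; ring

lemma partialD_sub (i : Fin 3) {η θ : E3 → ℝ} (hη : ContDiff ℝ ∞ η) (hθ : ContDiff ℝ ∞ θ) (y : E3) :
    partialD i (fun y => η y - θ y) y = partialD i η y - partialD i θ y := by
  unfold partialD
  rw [fderiv_fun_sub (hη.differentiable (by simp) y) (hθ.differentiable (by simp) y)]
  simp

lemma partialD_comm (i j : Fin 3) {η : E3 → ℝ} (hη : ContDiff ℝ ∞ η) :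
    partialD i (partialD j η) = partialD j (partialD i η) := by
  funext x
  have hd : DifferentiableAt ℝ (fderiv ℝ η) x :=
    (hη.fderiv_right (m := ∞) (by simp)).differentiable (by simp) x
  have key : ∀ a b : Fin 3, partialD a (partialD b η) x
      = fderiv ℝ (fderiv ℝ η) x (stdVec a) (stdVec b) := by
    intro a b
    have : partialD b η = fun y => fderiv ℝ η y (stdVec b) := rfl
    rw [this]
    unfold partialD
    rw [fderiv_clm_apply hd (by fun_prop)]
    simp
  rw [key, key]
  have := (hη.contDiffAt (x := x)).isSymmSndFDerivAt (n := ∞) (by simp; exact WithTop.coe_le_coe.2 le_top)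
  exact this _ _

/-- Integration by parts against a test function. -/
lemma integral_partialD_mul (i : Fin 3) {η κ : E3 → ℝ} (hη : IsTestFun η) (hκ : ContDiff ℝ ∞ κ) :
    ∫ x, partialD i η x * κ x = -∫ x, η x * partialD i κ x := by
  have h1 : IsTestFun (fun y => partialD i η y * κ y) := by
    simpa [mul_comm] using (hη.partialD i).mul_left hκ
  have h2 : IsTestFun (fun y => η y * partialD i κ y) := by
    simpa [mul_comm] using hη.mul_left (hκ.partialD i)
  have h3 : IsTestFun (fun y => η y * κ y) := by
    simpa [mul_comm] using hη.mul_left hκ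
  have := integral_mul_fderiv_eq_neg_fderiv_mul_of_integrable (𝕜 := ℝ) (μ := (volume : Measure E3))
    (f := η) (g := κ) (v := stdVec i) h1.integrable h2.integrable h3.integrable
    (fun x _ => hη.differentiable x) (fun x _ => hκ.differentiable (by simp) x)
  unfold partialD
  rw [this, neg_neg]

/-- The iterated partial derivative `∂_{α₁} ⋯ ∂_{αₙ} η` along a list of directions. -/
noncomputable def dpart (α : List (Fin 3)) (η : E3 → ℝ) : E3 → ℝ := α.foldr partialD η

@[simp] lemma dpart_nil (η : E3 → ℝ) : dpart [] η = η := rfl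
@[simp] lemma dpart_cons (i : Fin 3) (α : List (Fin 3)) (η : E3 → ℝ) :
    dpart (i :: α) η = partialD i (dpart α η) := rfl

lemma ContDiff.dpart {η : E3 → ℝ} (h : ContDiff ℝ ∞ η) (α : List (Fin 3)) :
    ContDiff ℝ ∞ (dpart α η) := by
  induction α with
  | nil => exact h
  | cons i α ih => exact ih.partialD i

lemma IsTestFun.dpart {η : E3 → ℝ} (h : IsTestFun η) (α : List (Fin 3)) :
    IsTestFun (dpart α η) := by
  induction α with
  | nil => exact h
  | cons i α ih => exact ih.partialD i

lemma dpart_zero (α : List (Fin 3)) : dpart α (fun _ => 0) = fun _ => 0 := by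
  induction α with
  | nil => rfl
  | cons i α ih => rw [dpart_cons, ih]; funext x; simp [partialD]

lemma dpart_partialD {η : E3 → ℝ} (h : ContDiff ℝ ∞ η) (α : List (Fin 3)) (i : Fin 3) :
    dpart α (partialD i η) = partialD i (dpart α η) := by
  induction α with
  | nil => rfl
  | cons j α ih => rw [dpart_cons, ih, dpart_cons, partialD_comm j i (h.dpart α)]

lemma norm_iteratedFDeriv_partialD_le {η : E3 → ℝ} (h : ContDiff ℝ ∞ η) (i : Fin 3) (m : ℕ) (x : E3) :
    ‖iteratedFDeriv ℝ m (partialD i η) x‖ ≤ ‖iteratedFDeriv ℝ (m + 1) η x‖ := by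
  have hd : ContDiff ℝ ∞ (fderiv ℝ η) := h.fderiv_right (by simp)
  let L : (E3 →L[ℝ] ℝ) →L[ℝ] ℝ := ContinuousLinearMap.apply ℝ ℝ (stdVec i)
  have h1 : partialD i η = L ∘ fderiv ℝ η := rfl
  rw [h1]
  refine (L.norm_iteratedFDeriv_comp_left hd.contDiffAt (n := m) (by exact_mod_cast le_top)).trans ?_
  rw [norm_iteratedFDeriv_fderiv]
  have hL : ‖L‖ ≤ 1 := by
    refine L.opNorm_le_bound zero_le_one fun f => ?_
    have := f.le_opNorm (stdVec i)
    rw [norm_stdVec] at this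
    simpa [L, mul_comm] using this
  exact (mul_le_mul_of_nonneg_right hL (norm_nonneg _)).trans (by simp)

lemma norm_iteratedFDeriv_dpart_le {η : E3 → ℝ} (h : ContDiff ℝ ∞ η) (α : List (Fin 3)) (m : ℕ)
    (x : E3) :
    ‖iteratedFDeriv ℝ m (dpart α η) x‖ ≤ ‖iteratedFDeriv ℝ (m + α.length) η x‖ := by
  induction α generalizing m with
  | nil => simp
  | cons i α ih =>
    refine (norm_iteratedFDeriv_partialD_le (h.dpart α) i m x).trans ((ih (m + 1)).trans (le_of_eq ?_))
    rw [List.length_cons, add_assoc, add_comm 1]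

lemma norm_dpart_le {η : E3 → ℝ} (h : ContDiff ℝ ∞ η) (α : List (Fin 3)) (x : E3) :
    ‖dpart α η x‖ ≤ ‖iteratedFDeriv ℝ α.length η x‖ := by
  have := norm_iteratedFDeriv_dpart_le h α 0 x
  rwa [norm_iteratedFDeriv_zero, zero_add] at this

lemma integral_dpart_mul (α : List (Fin 3)) {η κ : E3 → ℝ} (hη : IsTestFun η) (hκ : ContDiff ℝ ∞ κ) :
    ∫ x, dpart α η x * κ x = (-1) ^ α.length * ∫ x, η x * dpart α κ x := by
  induction α generalizing κ with
  | nil => simp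
  | cons i α ih =>
    rw [dpart_cons, integral_partialD_mul i (hη.dpart α) hκ, ih (hκ.partialD i),
      dpart_partialD hκ, List.length_cons]
    simp [pow_succ]

/-! ### The heat kernel and its derivatives -/

/-- The heat kernel `(4πr)^{-3/2} exp(-|z|²/4r)` of `ℝ³` at time `r > 0`, extended by zero to
`r ≤ 0`. -/
noncomputable def heatK (r : ℝ) (z : E3) : ℝ :=
  if 0 < r then (√(4 * Real.pi * r) ^ 3)⁻¹ * Real.exp (-(4 * r)⁻¹ * ‖z‖ ^ 2) else 0

lemma heatK_of_pos {r : ℝ} (hr : 0 < r) :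
    heatK r = fun z => (√(4 * Real.pi * r) ^ 3)⁻¹ * Real.exp (-(4 * r)⁻¹ * ‖z‖ ^ 2) := by
  funext z; simp [heatK, hr]

lemma heatK_of_nonpos {r : ℝ} (hr : r ≤ 0) : heatK r = fun _ => 0 := by
  funext z; simp [heatK, hr.not_gt]

lemma heatK_nonneg (r : ℝ) (z : E3) : 0 ≤ heatK r z := by
  unfold heatK; split_ifs <;> positivity

lemma contDiff_heatK (r : ℝ) : ContDiff ℝ ∞ (heatK r) := by
  rcases lt_or_ge 0 r with hr | hr
  · rw [heatK_of_pos hr]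
    exact contDiff_const.mul ((contDiff_const.mul (contDiff_norm_sq ℝ)).exp)
  · rw [heatK_of_nonpos hr]; exact contDiff_const

lemma one_add_pow_mul_exp_le (k : ℕ) {u : ℝ} (hu : 0 ≤ u) :
    (1 + u) ^ k * Real.exp (-(u ^ 2 / 4)) ≤ k.factorial * Real.exp 2 := by
  have h1 : (1 + u) ^ k ≤ k.factorial * Real.exp (1 + u) := by
    have := Real.pow_div_factorial_le_exp (1 + u) (by positivity) k
    rwa [div_le_iff₀' (by positivity)] at this
  calc (1 + u) ^ k * Real.exp (-(u ^ 2 / 4))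
      ≤ (k.factorial * Real.exp (1 + u)) * Real.exp (-(u ^ 2 / 4)) := by gcongr
    _ = k.factorial * Real.exp (1 + u + -(u ^ 2 / 4)) := by rw [mul_assoc, ← Real.exp_add]
    _ ≤ k.factorial * Real.exp 2 := by
      gcongr
      nlinarith [sq_nonneg (u / 2 - 1)]

lemma norm_iteratedFDeriv_clm_le (L : E3 →L[ℝ] (E3 →L[ℝ] ℝ)) (i : ℕ) (z : E3) :
    ‖iteratedFDeriv ℝ i L z‖ ≤ if i = 0 then ‖L z‖ else if i = 1 then ‖L‖ else 0 := by
  match i with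
  | 0 => simp
  | 1 => simp [norm_iteratedFDeriv_one]
  | (k + 2) =>
    rw [← norm_iteratedFDeriv_fderiv]
    have : fderiv ℝ L = fun _ => L := by funext x; exact L.fderiv
    rw [this, iteratedFDeriv_const_of_ne (by simp)]
    simp

lemma norm_iteratedFDeriv_quadratic_le (c : ℝ) (i : ℕ) (hi : 1 ≤ i) (z : E3) :
    ‖iteratedFDeriv ℝ i (fun z : E3 => c * ‖z‖ ^ 2) z‖
      ≤ if i = 1 then 2 * |c| * ‖z‖ else if i = 2 then 2 * |c| else 0 := by
  obtain ⟨k, rfl⟩ : ∃ k, i = k + 1 := ⟨i - 1, by omega⟩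
  rw [← norm_iteratedFDeriv_fderiv]
  let L : E3 →L[ℝ] (E3 →L[ℝ] ℝ) := (2 * c) • innerSL ℝ
  have hL : fderiv ℝ (fun z : E3 => c * ‖z‖ ^ 2) = L := by
    funext x
    have := ((hasStrictFDerivAt_norm_sq (F := E3) x).hasFDerivAt.const_mul c).fderiv
    rw [this]; ext v
    change c * (2 • inner ℝ x v) = (2 * c) * inner ℝ x v
    simp; ring
  rw [hL]
  refine (norm_iteratedFDeriv_clm_le L k z).trans ?_
  have h1 : ‖L‖ ≤ 2 * |c| := by
    refine L.opNorm_le_bound (by positivity) fun x =>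
      (L x).opNorm_le_bound (by positivity) fun v => ?_
    change ‖(2 * c) * inner ℝ x v‖ ≤ _
    rw [norm_mul, mul_assoc _ ‖x‖]
    gcongr
    · simp
    · exact norm_inner_le_norm x v
  have h2 : ‖L z‖ ≤ 2 * |c| * ‖z‖ := (L.le_opNorm z).trans (by gcongr)
  match k with
  | 0 => simpa using h2
  | 1 => simpa using h1
  | (k + 2) => simp

/-- Parabolic scaling and Gaussian decay: `|Dⁿ K_r(z)| ≤ C (√r + |z|)^{-3-n}`. -/
lemma exists_norm_iteratedFDeriv_heatK_le (n : ℕ) :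
    ∃ C : ℝ, 0 < C ∧ ∀ r : ℝ, 0 < r → ∀ z : E3,
      ‖iteratedFDeriv ℝ n (heatK r) z‖ ≤ C * ((√r + ‖z‖) ^ (3 + n))⁻¹ := by
  refine ⟨n.factorial * ((2 * n + 3).factorial * Real.exp 2), by positivity, fun r hr z => ?_⟩
  have hs : 0 < √r := Real.sqrt_pos.2 hr
  have hss : √r * √r = r := Real.mul_self_sqrt hr.le
  set s := √r with hsdef
  -- in the scaled variable `u = |z| / √r` the exponent is `-u² / 4`, and each of its derivatives of
  -- order `i` is at most `((1 + u) / √r)^i`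
  set u := ‖z‖ / s with hu
  have hu0 : 0 ≤ u := by positivity
  have hz : ‖z‖ = u * s := by rw [hu]; field_simp
  set D := (1 + u) / s with hD
  have hD0 : 0 ≤ D := by positivity
  have hexp : -(4 * r)⁻¹ * ‖z‖ ^ 2 = -(u ^ 2 / 4) := by
    rw [hz, ← hss]; field_simp
  have hc : |-(4 * r)⁻¹| = (4 * (s * s))⁻¹ := by
    rw [abs_neg, abs_of_pos (by positivity), hss]
  have main : ‖iteratedFDeriv ℝ n (Real.exp ∘ fun z : E3 => -(4 * r)⁻¹ * ‖z‖ ^ 2) z‖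
      ≤ n.factorial * Real.exp (-(u ^ 2 / 4)) * D ^ n := by
    refine norm_iteratedFDeriv_comp_le (N := ∞) Real.contDiff_exp
      (contDiff_const.mul (contDiff_norm_sq ℝ)) (by exact_mod_cast le_top) z ?_ ?_
    · intro i _
      rw [norm_iteratedFDeriv_eq_norm_iteratedDeriv, iteratedDeriv_eq_iterate, Real.iter_deriv_exp,
        hexp, Real.norm_of_nonneg (by positivity)]
    · intro i hi _
      refine (norm_iteratedFDeriv_quadratic_le _ i hi z).trans ?_
      rw [hc, hz]
      split_ifs with h1 h2
      · subst h1
        rw [pow_one, hD, show 2 * (4 * (s * s))⁻¹ * (u * s) = (u / 2) / s by field_simp; norm_num]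
        gcongr; linarith
      · subst h2
        rw [hD, div_pow, show 2 * (4 * (s * s))⁻¹ = (1 / 2) / s ^ 2 by field_simp; norm_num]
        gcongr; nlinarith
      · positivity
  have hsq : s ≤ √(4 * Real.pi * r) := by
    apply Real.sqrt_le_sqrt
    nlinarith [Real.pi_gt_three]
  have heq : heatK r = (√(4 * Real.pi * r) ^ 3)⁻¹ •
      (Real.exp ∘ fun z : E3 => -(4 * r)⁻¹ * ‖z‖ ^ 2) := by
    rw [heatK_of_pos hr]; rfl
  have hsm : ContDiff ℝ n (Real.exp ∘ fun z : E3 => -(4 * r)⁻¹ * ‖z‖ ^ 2) :=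
    Real.contDiff_exp.comp (contDiff_const.mul (contDiff_norm_sq ℝ))
  rw [heq, iteratedFDeriv_const_smul_apply hsm.contDiffAt, norm_smul,
    Real.norm_of_nonneg (by positivity)]
  have hkey := one_add_pow_mul_exp_le (2 * n + 3) hu0
  calc (√(4 * Real.pi * r) ^ 3)⁻¹ *
        ‖iteratedFDeriv ℝ n (Real.exp ∘ fun z : E3 => -(4 * r)⁻¹ * ‖z‖ ^ 2) z‖
      ≤ (s ^ 3)⁻¹ * (n.factorial * Real.exp (-(u ^ 2 / 4)) * D ^ n) := by gcongr
    _ = n.factorial * ((1 + u) ^ (2 * n + 3) * Real.exp (-(u ^ 2 / 4))) *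
          ((s + u * s) ^ (3 + n))⁻¹ := by
      have hDn : D ^ n * s ^ n = (1 + u) ^ n := by rw [← mul_pow, hD, div_mul_cancel₀ _ hs.ne']
      rw [show s + u * s = s * (1 + u) by ring, mul_pow, show 2 * n + 3 = n + (3 + n) by ring,
        pow_add (1 + u) n, pow_add s 3 n, ← hDn]
      clear_value D
      field_simp
    _ ≤ n.factorial * ((2 * n + 3).factorial * Real.exp 2) * ((s + ‖z‖) ^ (3 + n))⁻¹ := by
      rw [hz]; gcongr

/-- The spatial derivative `∂^α K_r` of the heat kernel. -/
noncomputable def kern (α : List (Fin 3)) (r : ℝ) : E3 → ℝ := dpart α (heatK r)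

lemma contDiff_kern (α : List (Fin 3)) (r : ℝ) : ContDiff ℝ ∞ (kern α r) :=
  (contDiff_heatK r).dpart α

lemma kern_cons (i : Fin 3) (α : List (Fin 3)) (r : ℝ) : kern (i :: α) r = partialD i (kern α r) :=
  rfl

lemma exists_norm_iteratedFDeriv_kern_le (n N : ℕ) :
    ∃ C : ℝ, 0 < C ∧ ∀ α : List (Fin 3), α.length = N → ∀ r : ℝ, 0 < r → ∀ z : E3,
      ‖iteratedFDeriv ℝ n (kern α r) z‖ ≤ C * ((√r + ‖z‖) ^ (3 + (n + N)))⁻¹ := by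
  obtain ⟨C, hC, h⟩ := exists_norm_iteratedFDeriv_heatK_le (n + N)
  refine ⟨C, hC, fun α hα r hr z => ?_⟩
  refine (norm_iteratedFDeriv_dpart_le (contDiff_heatK r) α n z).trans ?_
  rw [hα]; exact h r hr z

lemma contDiffOn_kern (α : List (Fin 3)) :
    ContDiffOn ℝ ∞ (fun p : ℝ × E3 => kern α p.1 p.2) (Ioi 0 ×ˢ univ) := by
  have hopen : IsOpen ((Ioi (0 : ℝ)) ×ˢ (univ : Set E3)) := isOpen_Ioi.prod isOpen_univ
  induction α with
  | nil =>
    have : ContDiffOn ℝ ∞ (fun p : ℝ × E3 => (√(4 * Real.pi * p.1) ^ 3)⁻¹ *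
        Real.exp (-(4 * p.1)⁻¹ * ‖p.2‖ ^ 2)) (Ioi 0 ×ˢ univ) := by
      have h0 : ∀ p ∈ (Ioi (0 : ℝ)) ×ˢ (univ : Set E3), 4 * Real.pi * p.1 ≠ 0 := by
        rintro p ⟨hp, -⟩; have := Real.pi_pos; have : 0 < p.1 := hp; positivity
      have h1 : ∀ p ∈ (Ioi (0 : ℝ)) ×ˢ (univ : Set E3), 4 * p.1 ≠ 0 := by
        rintro p ⟨hp, -⟩; have : 0 < p.1 := hp; positivity
      refine ContDiffOn.mul (ContDiffOn.inv ?_ ?_) (ContDiffOn.exp (ContDiffOn.mul ?_ ?_))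
      · exact (ContDiffOn.sqrt (by fun_prop) h0).pow 3
      · rintro p ⟨hp, -⟩
        have := Real.pi_pos; have : 0 < p.1 := hp
        exact pow_ne_zero _ (Real.sqrt_ne_zero'.2 (by positivity))
      · exact (ContDiffOn.inv (by fun_prop) h1).neg
      · exact ((contDiff_norm_sq ℝ).comp contDiff_snd).contDiffOn
    refine this.congr ?_
    rintro p ⟨hp, -⟩
    simp [kern, heatK_of_pos (show 0 < p.1 from hp)]
  | cons i α ih =>
    have h1 := (ih.fderiv_of_isOpen (m := ∞) hopen (by simp)).clm_apply
      (contDiffOn_const (c := ((0 : ℝ), stdVec i)))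
    refine h1.congr ?_
    rintro p hp
    have hd : DifferentiableAt ℝ (fun p : ℝ × E3 => kern α p.1 p.2) p :=
      (ih.differentiableOn (by simp)).differentiableAt (hopen.mem_nhds hp)
    have hg : HasFDerivAt (fun z : E3 => (p.1, z)) (ContinuousLinearMap.inr ℝ ℝ E3) p.2 :=
      hasFDerivAt_prodMk_right _ _
    have := (hd.hasFDerivAt.comp (x := p.2) (f := fun z : E3 => (p.1, z)) hg).fderiv
    rw [kern_cons]; unfold partialD
    change fderiv ℝ ((fun p : ℝ × E3 => kern α p.1 p.2) ∘ fun z : E3 => (p.1, z)) p.2 _ = _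
    rw [this]; simp

lemma kern_of_nonpos (α : List (Fin 3)) {r : ℝ} (hr : r ≤ 0) : kern α r = fun _ => 0 := by
  rw [kern, heatK_of_nonpos hr, dpart_zero]

lemma measurable_kern (α : List (Fin 3)) : Measurable (fun p : ℝ × E3 => kern α p.1 p.2) := by
  have h := (contDiffOn_kern α).continuousOn.measurable_piecewise
    (g := fun _ => (0 : ℝ)) continuousOn_const (measurableSet_Ioi.prod MeasurableSet.univ)
  classical
  convert h using 1
  funext p
  by_cases hp : 0 < p.1
  · rw [piecewise_eq_of_mem _ _ _ (by exact ⟨hp, mem_univ _⟩)]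
  · rw [piecewise_eq_of_notMem _ _ _ (by simpa using hp), kern_of_nonpos α (not_lt.1 hp)]

lemma partialD_heatK {r : ℝ} (hr : 0 < r) (i : Fin 3) :
    partialD i (heatK r) = fun z => -(2 * r)⁻¹ * (z i * heatK r z) := by
  funext z
  have h := ((((hasStrictFDerivAt_norm_sq (F := E3) z).hasFDerivAt.const_mul
    (-(4 * r)⁻¹)).exp).const_mul ((√(4 * Real.pi * r) ^ 3)⁻¹)).fderiv
  unfold partialD
  rw [heatK_of_pos hr, h]
  simp [PiLp.inner_apply]
  field_simp; norm_num

lemma partialD_partialD_heatK {r : ℝ} (hr : 0 < r) (i : Fin 3) (z : E3) :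
    partialD i (partialD i (heatK r)) z =
      (-(2 * r)⁻¹ + (4 * r ^ 2)⁻¹ * (z i) ^ 2) * heatK r z := by
  have h1 : HasFDerivAt (fun z : E3 => z i) (EuclideanSpace.proj (𝕜 := ℝ) i) z :=
    (EuclideanSpace.proj (𝕜 := ℝ) i).hasFDerivAt
  have h2 : HasFDerivAt (heatK r) (fderiv ℝ (heatK r) z) z :=
    ((contDiff_heatK r).differentiable (by simp) z).hasFDerivAt
  have h : HasFDerivAt (fun z : E3 => -(2 * r)⁻¹ * (z i * heatK r z)) _ z :=
    (h1.mul h2).const_mul (-(2 * r)⁻¹)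
  have h3 := congrFun (partialD_heatK hr i) z
  rw [partialD_heatK hr i]
  unfold partialD at h3 ⊢
  rw [h.fderiv]
  simp only [FunLike.coe_smul, FunLike.coe_add, Pi.smul_apply, Pi.add_apply, h3, smul_eq_mul]
  simp
  field_simp; ring

lemma hasDerivAt_heatK {r : ℝ} (hr : 0 < r) (z : E3) :
    HasDerivAt (fun r => heatK r z) (∑ i, kern [i, i] r z) r := by
  have hpi := Real.pi_pos
  have hs : √(4 * Real.pi * r) ≠ 0 := Real.sqrt_ne_zero'.2 (by positivity)
  have hsq : √(4 * Real.pi * r) ^ 2 = 4 * Real.pi * r := Real.sq_sqrt (by positivity)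
  have h1 : HasDerivAt (fun r => √(4 * Real.pi * r)) (4 * Real.pi / (2 * √(4 * Real.pi * r))) r := by
    have := ((hasDerivAt_id r).const_mul (4 * Real.pi)).sqrt (by simpa using (by positivity))
    simpa using this
  have h2 : HasDerivAt (fun r => -(4 * r)⁻¹ * ‖z‖ ^ 2) (4 / (4 * r) ^ 2 * ‖z‖ ^ 2) r := by
    have := (((hasDerivAt_id r).const_mul 4).inv (by simpa using hr.ne')).neg.mul_const (‖z‖ ^ 2)
    simpa [neg_div] using this
  have h3 := (((h1.pow 3).inv (pow_ne_zero 3 hs)).mul h2.exp)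
  have hval : ∑ i, kern [i, i] r z = (-(3 / (2 * r)) + (4 * r ^ 2)⁻¹ * ‖z‖ ^ 2) * heatK r z := by
    have : ∀ i : Fin 3, kern [i, i] r z = (-(2 * r)⁻¹ + (4 * r ^ 2)⁻¹ * (z i) ^ 2) * heatK r z :=
      fun i => partialD_partialD_heatK hr i z
    simp_rw [this, EuclideanSpace.norm_sq_eq, Fin.sum_univ_three, Real.norm_eq_abs, sq_abs]
    ring
  rw [hval]
  have hev : (fun r => heatK r z) =ᶠ[𝓝 r] fun r => (√(4 * Real.pi * r) ^ 3)⁻¹ *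
      Real.exp (-(4 * r)⁻¹ * ‖z‖ ^ 2) := by
    filter_upwards [lt_mem_nhds hr] with r' hr'
    rw [heatK_of_pos hr']
  refine (h3.congr_deriv ?_).congr_of_eventuallyEq hev
  rw [heatK_of_pos hr]
  simp only [Pi.inv_apply, Pi.pow_apply]
  generalize Real.exp (-(4 * r)⁻¹ * ‖z‖ ^ 2) = e
  generalize √(4 * Real.pi * r) = s at *
  field_simp
  push_cast
  linear_combination (12 * e * r * s ^ 2) * hsq

lemma integrable_heatK (r : ℝ) : Integrable (heatK r) := by
  rcases lt_or_ge 0 r with hr | hr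
  · rw [heatK_of_pos hr]
    have := (GaussianFourier.integrable_cexp_neg_mul_sq_norm_add (V := E3) (b := ((4 * r)⁻¹ : ℝ))
      (by simpa using hr) 0 0).re
    refine Integrable.const_mul ?_ _
    refine this.congr (Eventually.of_forall fun z => ?_)
    simp only [zero_mul, add_zero]
    norm_cast
  · rw [heatK_of_nonpos hr]; exact integrable_zero _ _ _

lemma integral_heatK {r : ℝ} (hr : 0 < r) : ∫ z, heatK r z = 1 := by
  rw [heatK_of_pos hr, integral_const_mul]
  have := GaussianFourier.integral_rexp_neg_mul_sq_norm (V := E3) (b := (4 * r)⁻¹) (by positivity)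
  rw [this]
  have hpi := Real.pi_pos
  have h0 : 0 < 4 * Real.pi * r := by positivity
  simp only [finrank_euclideanSpace, Fintype.card_fin]
  rw [show Real.pi / (4 * r)⁻¹ = 4 * Real.pi * r by field_simp, Real.sqrt_eq_rpow,
    ← Real.rpow_natCast, ← Real.rpow_mul h0.le, ← Real.rpow_neg h0.le, ← Real.rpow_add h0]
  norm_num

/-! ### The heat semigroup on test functions -/

/-- The Laplacian `Δθ`. -/
noncomputable def lap (θ : E3 → ℝ) (x : E3) : ℝ := ∑ i, dpart [i, i] θ x

lemma IsTestFun.sum {ι : Type*} (s : Finset ι) {θ : ι → E3 → ℝ} (h : ∀ i ∈ s, IsTestFun (θ i)) :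
    IsTestFun (fun x => ∑ i ∈ s, θ i x) := by
  classical
  induction s using Finset.induction_on with
  | empty => simpa using IsTestFun.zero
  | insert a s ha ih =>
    simp_rw [Finset.sum_insert ha]
    have h1 := h a (Finset.mem_insert_self a s)
    have h2 := ih fun i hi => h i (Finset.mem_insert_of_mem hi)
    exact ⟨h1.1.add h2.1, h1.2.add h2.2⟩

lemma IsTestFun.lap {θ : E3 → ℝ} (h : IsTestFun θ) : IsTestFun (lap θ) :=
  IsTestFun.sum Finset.univ fun i _ => h.dpart [i, i]

lemma partialD_lap {θ : E3 → ℝ} (h : IsTestFun θ) (j : Fin 3) :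
    partialD j (lap θ) = lap (partialD j θ) := by
  funext x
  have h1 : partialD j (lap θ) x = ∑ i, partialD j (dpart [i, i] θ) x := by
    unfold lap partialD
    rw [fderiv_fun_sum fun i _ => (h.dpart [i, i]).differentiable x]
    simp
  rw [h1]
  unfold lap
  refine Finset.sum_congr rfl fun i _ => ?_
  rw [dpart_partialD h.1]

lemma dpart_lap {θ : E3 → ℝ} (h : IsTestFun θ) (α : List (Fin 3)) :
    dpart α (lap θ) = lap (dpart α θ) := by
  induction α with
  | nil => rfl
  | cons i α ih => rw [dpart_cons, ih, partialD_lap (h.dpart α), dpart_cons]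

/-- The heat semigroup `U_r θ = K_r * θ`. -/
noncomputable def heatU (r : ℝ) (θ : E3 → ℝ) (y : E3) : ℝ := ∫ x, heatK r (x - y) * θ x

lemma abs_kern_le (α : List (Fin 3)) : ∃ C : ℝ, 0 < C ∧ ∀ r : ℝ, 0 < r → ∀ z : E3,
    |kern α r z| ≤ C * ((√r + ‖z‖) ^ (3 + α.length))⁻¹ := by
  obtain ⟨C, hC, h⟩ := exists_norm_iteratedFDeriv_kern_le 0 α.length
  refine ⟨C, hC, fun r hr z => ?_⟩
  have := h α rfl r hr z
  rwa [norm_iteratedFDeriv_zero, zero_add, Real.norm_eq_abs] at this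

lemma abs_kern_le' (α : List (Fin 3)) : ∃ C : ℝ, 0 < C ∧ ∀ r : ℝ, 0 < r → ∀ z : E3,
    |kern α r z| ≤ C * (√r ^ (3 + α.length))⁻¹ := by
  obtain ⟨C, hC, h⟩ := abs_kern_le α
  refine ⟨C, hC, fun r hr z => (h r hr z).trans ?_⟩
  have := Real.sqrt_pos.2 hr
  gcongr
  linarith [norm_nonneg z]

lemma integrable_kern_sub_mul (α : List (Fin 3)) (r : ℝ) {θ : E3 → ℝ} (hθ : IsTestFun θ) (y : E3) :
    Integrable (fun x => kern α r (x - y) * θ x) := by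
  have := hθ.mul_left (κ := fun x => kern α r (x - y))
    ((contDiff_kern α r).comp (contDiff_id.sub contDiff_const))
  exact this.integrable

lemma integral_kern_sub_mul (α : List (Fin 3)) (r : ℝ) {θ : E3 → ℝ} (hθ : IsTestFun θ) (y : E3) :
    ∫ x, kern α r (x - y) * θ x = (-1) ^ α.length * heatU r (dpart α θ) y := by
  have key : ∀ β : List (Fin 3), dpart β (fun x => heatK r (x - y)) = fun x => kern β r (x - y) := by
    intro β
    induction β with
    | nil => rfl
    | cons i β ih =>
      rw [dpart_cons, ih, kern_cons]; funext x
      simpa [sub_eq_add_neg] using partialD_comp_add_right i (kern β r) (-y) x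
  have h := integral_dpart_mul α hθ (κ := fun x => heatK r (x - y))
    ((contDiff_heatK r).comp (contDiff_id.sub contDiff_const))
  rw [key] at h
  simp_rw [heatU, mul_comm (heatK r _), mul_comm (kern α r _)]
  rw [h, ← mul_assoc, ← pow_add, ← two_mul]
  simp

lemma heatU_add_right (r : ℝ) (θ : E3 → ℝ) (y : E3) : heatU r θ y = ∫ z, heatK r z * θ (z + y) := by
  unfold heatU
  rw [← integral_add_right_eq_self _ y]
  simp

lemma abs_heatU_le_of_bound {r M : ℝ} (hr : 0 < r) {θ : E3 → ℝ}
    (hM : ∀ x, ‖θ x‖ ≤ M) (y : E3) : |heatU r θ y| ≤ M := by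
  rw [heatU_add_right]
  have h1 : ‖∫ z, heatK r z * θ (z + y)‖ ≤ ∫ z, heatK r z * M := by
    refine norm_integral_le_of_norm_le ((integrable_heatK r).mul_const M)
      (Eventually.of_forall fun z => ?_)
    rw [norm_mul, Real.norm_of_nonneg (heatK_nonneg r z)]
    exact mul_le_mul_of_nonneg_left (hM _) (heatK_nonneg r z)
  rwa [integral_mul_const, integral_heatK hr, one_mul] at h1

/-- The heat semigroup is bounded and decays like `r^{-3/2}`. -/
lemma IsTestFun.exists_abs_heatU_le {θ : E3 → ℝ} (hθ : IsTestFun θ) :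
    ∃ M, 0 ≤ M ∧ ∀ r, 0 < r → ∀ y, |heatU r θ y| ≤ M ∧ |heatU r θ y| ≤ M * (√r ^ 3)⁻¹ := by
  obtain ⟨M, hM0, hM⟩ := hθ.exists_bound
  obtain ⟨C, hC, hK⟩ := abs_kern_le' []
  refine ⟨max M (C * ∫ x, ‖θ x‖), le_max_of_le_left hM0, fun r hr y => ⟨?_, ?_⟩⟩
  · exact (abs_heatU_le_of_bound hr hM y).trans (le_max_left _ _)
  · have h1 : ‖∫ x, heatK r (x - y) * θ x‖ ≤ ∫ x, (C * (√r ^ 3)⁻¹) * ‖θ x‖ := by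
      refine norm_integral_le_of_norm_le (hθ.integrable.norm.const_mul _)
        (Eventually.of_forall fun z => ?_)
      rw [norm_mul]
      exact mul_le_mul_of_nonneg_right (hK r hr _) (norm_nonneg _)
    rw [integral_const_mul] at h1
    refine h1.trans ?_
    rw [mul_right_comm]
    exact mul_le_mul_of_nonneg_right (le_max_right _ _) (by positivity)

lemma measurable_heatU {θ : E3 → ℝ} (hθ : IsTestFun θ) :
    Measurable (fun p : ℝ × E3 => heatU p.1 θ p.2) := by
  have h : Measurable (fun q : (ℝ × E3) × E3 => heatK q.1.1 (q.2 - q.1.2) * θ q.2) := by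
    have h1 : Measurable (fun q : (ℝ × E3) × E3 => (q.1.1, q.2 - q.1.2)) := by fun_prop
    exact ((measurable_kern []).comp h1).mul (hθ.continuous.measurable.comp measurable_snd)
  exact (h.stronglyMeasurable.integral_prod_right (ν := (volume : Measure E3))).measurable

lemma hasDerivAt_heatU {r : ℝ} (hr : 0 < r) {θ : E3 → ℝ} (hθ : IsTestFun θ) (y : E3) :
    HasDerivAt (fun r => heatU r θ y) (heatU r (lap θ) y) r := by
  choose C hC hK using fun i : Fin 3 => abs_kern_le' [i, i]
  have hval : heatU r (lap θ) y = ∫ x, (∑ i, kern [i, i] r (x - y)) * θ x := by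
    simp_rw [Finset.sum_mul]
    rw [integral_finsetSum _ fun i _ => integrable_kern_sub_mul [i, i] r hθ y]
    simp_rw [integral_kern_sub_mul _ r hθ y]
    unfold heatU lap
    simp_rw [Finset.mul_sum]
    have h0 := fun i : Fin 3 => integrable_kern_sub_mul [] r (hθ.dpart [i, i]) y
    simp only [kern, dpart_nil] at h0
    rw [integral_finsetSum _ fun i _ => h0 i]
    simp
  rw [hval]
  refine (hasDerivAt_integral_of_dominated_loc_of_deriv_le (μ := (volume : Measure E3))
    (s := Ioi (r / 2)) (F := fun r x => heatK r (x - y) * θ x)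
    (F' := fun r x => (∑ i, kern [i, i] r (x - y)) * θ x)
    (bound := fun x => (∑ i, C i * (√(r / 2) ^ (3 + 2))⁻¹) * ‖θ x‖)
    (Ioi_mem_nhds (by linarith)) ?_ ?_ ?_ ?_ ?_ ?_).2
  · exact Eventually.of_forall fun r => (integrable_kern_sub_mul [] r hθ y).aestronglyMeasurable
  · exact integrable_kern_sub_mul [] r hθ y
  · simp_rw [Finset.sum_mul]
    exact (integrable_finsetSum _ fun i _ =>
      integrable_kern_sub_mul [i, i] r hθ y).aestronglyMeasurable
  · refine Eventually.of_forall fun x r' hr' => ?_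
    have h0 : 0 < r' := lt_trans (by linarith) hr'
    have h2 : 0 < √(r / 2) := Real.sqrt_pos.2 (by linarith)
    rw [norm_mul]
    refine mul_le_mul_of_nonneg_right ((norm_sum_le _ _).trans (Finset.sum_le_sum fun i _ => ?_))
      (norm_nonneg _)
    refine (hK i r' h0 _).trans ?_
    have : √(r / 2) ≤ √r' := Real.sqrt_le_sqrt (le_of_lt hr')
    have := (hC i).le
    simp only [List.length_cons, List.length_nil]
    gcongr
  · exact hθ.integrable.norm.const_mul _
  · refine Eventually.of_forall fun x r' hr' => ?_
    exact (hasDerivAt_heatK (lt_trans (by linarith) hr') (x - y)).mul_const (θ x)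

lemma heatU_eq_scaled {r : ℝ} (hr : 0 < r) (θ : E3 → ℝ) (y : E3) :
    heatU r θ y = ∫ w, heatK 1 w * θ (√r • w + y) := by
  have hs := Real.sqrt_pos.2 hr
  rw [heatU_add_right]
  have h := Measure.integral_comp_smul_of_nonneg (volume : Measure E3)
    (fun z => heatK r z * θ (z + y)) (√r) (hR := hs.le)
  simp only [finrank_euclideanSpace, Fintype.card_fin, smul_eq_mul] at h
  have h2 : ∫ z, heatK r z * θ (z + y) = √r ^ 3 * ∫ w, heatK r (√r • w) * θ (√r • w + y) := by
    rw [h]; field_simp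
  rw [h2, ← integral_const_mul]
  congr 1; funext w
  rw [← mul_assoc]
  congr 1
  rw [heatK_of_pos hr, heatK_of_pos one_pos]
  simp only []
  rw [norm_smul, Real.norm_of_nonneg hs.le, mul_pow,
    Real.sq_sqrt hr.le, Real.sqrt_mul' _ hr.le, mul_pow]
  field_simp

lemma tendsto_heatU_zero {θ : E3 → ℝ} (hθ : IsTestFun θ) (y : E3) :
    Tendsto (fun r => heatU r θ y) (𝓝[>] 0) (𝓝 (θ y)) := by
  obtain ⟨M, hM0, hM⟩ := hθ.exists_bound
  have h1 : Tendsto (fun r : ℝ => ∫ w, heatK 1 w * θ (√r • w + y)) (𝓝[>] 0)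
      (𝓝 (∫ w, heatK 1 w * θ y)) := by
    refine tendsto_integral_filter_of_dominated_convergence (fun w => heatK 1 w * M) ?_ ?_ ?_ ?_
    · refine Eventually.of_forall fun r => Continuous.aestronglyMeasurable ?_
      exact (contDiff_heatK 1).continuous.mul (hθ.continuous.comp (by fun_prop))
    · refine Eventually.of_forall fun r => Eventually.of_forall fun w => ?_
      rw [norm_mul, Real.norm_of_nonneg (heatK_nonneg 1 w)]
      exact mul_le_mul_of_nonneg_left (hM _) (heatK_nonneg 1 w)
    · exact (integrable_heatK 1).mul_const M
    · refine Eventually.of_forall fun w => ?_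
      have hc : Continuous fun r : ℝ => heatK 1 w * θ (√r • w + y) :=
        continuous_const.mul (hθ.continuous.comp (by fun_prop))
      have := (hc.tendsto 0).mono_left (nhdsWithin_le_nhds (s := Ioi (0 : ℝ)))
      simpa using this
  rw [integral_mul_const, integral_heatK one_pos, one_mul] at h1
  refine h1.congr' ?_
  filter_upwards [self_mem_nhdsWithin] with r hr
  exact (heatU_eq_scaled hr θ y).symm

lemma sqrt_pow_three_inv_eq {r : ℝ} (hr : 0 < r) : (√r ^ 3)⁻¹ = r ^ (-(3 / 2) : ℝ) := by
  rw [Real.sqrt_eq_rpow, ← Real.rpow_natCast, ← Real.rpow_mul hr.le, ← Real.rpow_neg hr.le]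
  norm_num

lemma integrableOn_heatU {θ : E3 → ℝ} (hθ : IsTestFun θ) (y : E3) :
    IntegrableOn (fun r => heatU r θ y) (Ioi 0) := by
  obtain ⟨M, hM0, hM⟩ := hθ.exists_abs_heatU_le
  have hm : Measurable (fun r => heatU r θ y) := (measurable_heatU hθ).comp (by fun_prop : Measurable fun r : ℝ => (r, y))
  rw [← Ioc_union_Ioi_eq_Ioi (zero_le_one (α := ℝ))]
  refine IntegrableOn.union ?_ ?_
  · refine Measure.integrableOn_of_bounded (M := M) (by simp) hm.aestronglyMeasurable ?_
    filter_upwards [ae_restrict_mem measurableSet_Ioc] with r hr using (hM r hr.1 y).1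
  · have h1 : IntegrableOn (fun r : ℝ => M * r ^ (-(3 / 2) : ℝ)) (Ioi 1) :=
      (integrableOn_Ioi_rpow_of_lt (by norm_num) one_pos).const_mul M
    refine Integrable.mono' h1 hm.aestronglyMeasurable ?_
    filter_upwards [ae_restrict_mem measurableSet_Ioi] with r hr
    have h0 : (0 : ℝ) < r := lt_trans one_pos hr
    rw [← sqrt_pow_three_inv_eq h0]
    exact (hM r h0 y).2

lemma tendsto_heatU_atTop {θ : E3 → ℝ} (hθ : IsTestFun θ) (y : E3) :
    Tendsto (fun r => heatU r θ y) atTop (𝓝 0) := by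
  obtain ⟨M, hM0, hM⟩ := hθ.exists_abs_heatU_le
  have h1 : Tendsto (fun r : ℝ => M * r ^ (-(3 / 2) : ℝ)) atTop (𝓝 (M * 0)) :=
    (tendsto_rpow_neg_atTop (by norm_num)).const_mul M
  rw [mul_zero] at h1
  refine squeeze_zero_norm' ?_ h1
  filter_upwards [eventually_gt_atTop 0] with r hr
  rw [← sqrt_pow_three_inv_eq hr]
  exact (hM r hr y).2

/-- The tail `∫_σ^∞ U_r θ dr` of the heat semigroup. -/
noncomputable def heatV (σ : ℝ) (θ : E3 → ℝ) (y : E3) : ℝ := ∫ r in Ioi σ, heatU r θ y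

/-- `∫_σ^∞ U_r Δθ dr = -U_σ θ`. -/
lemma heatV_lap {σ : ℝ} (hσ : 0 < σ) {θ : E3 → ℝ} (hθ : IsTestFun θ) (y : E3) :
    heatV σ (lap θ) y = -heatU σ θ y := by
  have := integral_Ioi_of_hasDerivAt_of_tendsto' (a := σ) (m := 0)
    (fun x hx => hasDerivAt_heatU (lt_of_lt_of_le hσ hx) hθ y)
    ((integrableOn_heatU hθ.lap y).mono_set (Ioi_subset_Ioi hσ.le)) (tendsto_heatU_atTop hθ y)
  rw [heatV, this, zero_sub]

lemma heatV_zero_sub {σ : ℝ} (hσ : 0 ≤ σ) {θ : E3 → ℝ} (hθ : IsTestFun θ) (y : E3) :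
    heatV σ θ y = heatV 0 θ y - ∫ r in (0 : ℝ)..σ, heatU r θ y := by
  have := intervalIntegral.integral_Ioi_sub_Ioi (integrableOn_heatU hθ y) hσ
  unfold heatV
  rw [← this]; ring

lemma tendsto_heatV_zero {θ : E3 → ℝ} (hθ : IsTestFun θ) (y : E3) :
    Tendsto (fun σ => heatV σ θ y) (𝓝[>] 0) (𝓝 (heatV 0 θ y)) := by
  obtain ⟨M, hM0, hM⟩ := hθ.exists_abs_heatU_le
  rw [tendsto_iff_norm_sub_tendsto_zero]
  have h1 : Tendsto (fun σ : ℝ => M * |σ - 0|) (𝓝[>] 0) (𝓝 0) := by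
    have : Continuous fun σ : ℝ => M * |σ - 0| := by fun_prop
    simpa using (this.tendsto 0).mono_left (nhdsWithin_le_nhds (s := Ioi (0 : ℝ)))
  refine squeeze_zero' (Eventually.of_forall fun _ => norm_nonneg _) ?_ h1
  filter_upwards [self_mem_nhdsWithin] with σ hσ
  rw [heatV_zero_sub (le_of_lt hσ) hθ, sub_sub_cancel_left, norm_neg]
  refine intervalIntegral.norm_integral_le_of_norm_le_const fun r hr => ?_
  rw [uIoc_of_le (le_of_lt hσ)] at hr
  exact (hM r hr.1 y).1

lemma hasDerivAt_heatV {σ : ℝ} (hσ : 0 < σ) {θ : E3 → ℝ} (hθ : IsTestFun θ) (y : E3) :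
    HasDerivAt (fun σ => heatV σ θ y) (-heatU σ θ y) σ := by
  have hm : StronglyMeasurable (fun r => heatU r θ y) :=
    ((measurable_heatU hθ).comp (by fun_prop : Measurable fun r : ℝ => (r, y))).stronglyMeasurable
  have h1 : HasDerivAt (fun σ => ∫ r in (0 : ℝ)..σ, heatU r θ y) (heatU σ θ y) σ := by
    refine intervalIntegral.integral_hasDerivAt_right ?_
      hm.stronglyMeasurableAtFilter (hasDerivAt_heatU hσ hθ y).continuousAt
    rw [intervalIntegrable_iff_integrableOn_Ioc_of_le hσ.le]
    exact (integrableOn_heatU hθ y).mono_set Ioc_subset_Ioi_self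
  refine (h1.const_sub (heatV 0 θ y)).congr_of_eventuallyEq ?_
  filter_upwards [lt_mem_nhds hσ] with s hs using heatV_zero_sub hs.le hθ y

lemma abs_heatV_le {σ : ℝ} (hσ : 0 ≤ σ) {θ : E3 → ℝ} (hθ : IsTestFun θ) (y : E3) :
    |heatV σ θ y| ≤ ∫ r in Ioi 0, |heatU r θ y| := by
  have h := norm_integral_le_integral_norm (μ := volume.restrict (Ioi σ)) (fun r => heatU r θ y)
  refine h.trans ?_
  refine setIntegral_mono_set (integrableOn_heatU hθ y).norm
    (Eventually.of_forall fun _ => norm_nonneg _) (Ioi_subset_Ioi hσ).eventuallyLE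

/-- Integration by parts on `(0,∞)` against `ψ(s + ·)` with `ψ` smooth and compactly supported. -/
lemma integral_deriv_mul_add_mul_deriv {e e' : ℝ → ℝ} {e0 M s : ℝ} {ψ : ℝ → ℝ}
    (hψ : ContDiff ℝ ∞ ψ) (hψc : HasCompactSupport ψ)
    (he : ∀ σ, 0 < σ → HasDerivAt e (e' σ) σ) (h0 : Tendsto e (𝓝[>] 0) (𝓝 e0))
    (he' : AEStronglyMeasurable e' (volume.restrict (Ioi 0)))
    (hM : ∀ σ, 0 < σ → |e σ| ≤ M ∧ |e' σ| ≤ M) :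
    IntegrableOn (fun σ => deriv ψ (s + σ) * e σ) (Ioi 0) ∧
    IntegrableOn (fun σ => ψ (s + σ) * e' σ) (Ioi 0) ∧
    (∫ σ in Ioi 0, deriv ψ (s + σ) * e σ) + ∫ σ in Ioi 0, ψ (s + σ) * e' σ = -(ψ s * e0) := by
  have hdc : Continuous (deriv ψ) := hψ.continuous_deriv (by simp)
  have hsh : ∀ {χ : ℝ → ℝ}, Continuous χ → HasCompactSupport χ →
      Integrable (fun σ => χ (s + σ)) := fun hc hcs =>
    (hc.integrable_of_hasCompactSupport hcs).comp_add_left s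
  have hem : AEStronglyMeasurable e (volume.restrict (Ioi 0)) :=
    ContinuousOn.aestronglyMeasurable
      (fun σ hσ => (he σ hσ).continuousAt.continuousWithinAt) measurableSet_Ioi
  have i1 : IntegrableOn (fun σ => deriv ψ (s + σ) * e σ) (Ioi 0) := by
    refine (hsh hdc hψc.deriv).integrableOn.mul_bdd (c := M) hem ?_
    filter_upwards [ae_restrict_mem measurableSet_Ioi] with σ hσ using (hM σ hσ).1
  have i2 : IntegrableOn (fun σ => ψ (s + σ) * e' σ) (Ioi 0) := by
    refine (hsh hψ.continuous hψc).integrableOn.mul_bdd (c := M) he' ?_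
    filter_upwards [ae_restrict_mem measurableSet_Ioi] with σ hσ using (hM σ hσ).2
  refine ⟨i1, i2, ?_⟩
  have hd : ∀ σ, HasDerivAt (fun σ => ψ (s + σ)) (deriv ψ (s + σ)) σ := fun σ => by
    have := (hψ.differentiable (by simp) (s + σ)).hasDerivAt
    exact this.comp_const_add s σ
  have hz : Tendsto ((fun σ => ψ (s + σ)) * e) (𝓝[>] 0) (𝓝 (ψ s * e0)) := by
    refine Tendsto.mul ?_ h0
    have hc : Continuous fun σ => ψ (s + σ) := hψ.continuous.comp (by fun_prop)
    simpa using (hc.tendsto 0).mono_left (nhdsWithin_le_nhds (s := Ioi (0 : ℝ)))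
  have hinf : Tendsto ((fun σ => ψ (s + σ)) * e) atTop (𝓝 0) := by
    obtain ⟨R, hR⟩ := hψc.isCompact.bddAbove
    refine tendsto_const_nhds.congr' ?_
    filter_upwards [eventually_gt_atTop (R - s)] with σ hσ
    have : ψ (s + σ) = 0 := by
      by_contra hne
      have := hR (subset_tsupport _ hne)
      linarith
    simp [this]
  have := integral_Ioi_mul_deriv_eq_deriv_mul (a := 0) (fun σ _ => hd σ) he i2 i1 hz hinf
  rw [this]; ring

/-! ### Radial integrals -/

/-- The surface area of the unit sphere of `ℝ³`. -/
noncomputable def sphereArea : ℝ := 3 * (volume : Measure E3).real (Metric.ball 0 1)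

lemma sphereArea_nonneg : 0 ≤ sphereArea := by unfold sphereArea; positivity

/-- Integration in polar coordinates, in the form of an upper bound. -/
lemma lintegral_radial_le {f g : ℝ → ℝ} (hf : Measurable f) (hf0 : ∀ y, 0 < y → 0 ≤ f y)
    (hfg : ∀ y, 0 < y → y ^ 2 * f y ≤ g y) (hg : IntegrableOn g (Ioi 0)) :
    ∫⁻ x : E3, ENNReal.ofReal (f ‖x‖) ≤ ENNReal.ofReal (sphereArea * ∫ y in Ioi 0, g y) := by
  have hd : Module.finrank ℝ E3 = 3 := by simp
  have h1 : IntegrableOn (fun y : ℝ => y ^ (Module.finrank ℝ E3 - 1) • f y) (Ioi 0) := by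
    refine Integrable.mono' hg (by fun_prop) ?_
    filter_upwards [ae_restrict_mem measurableSet_Ioi] with y hy
    have hy' : (0 : ℝ) < y := hy
    have h2 := hf0 y hy
    rw [hd, smul_eq_mul, Real.norm_of_nonneg (by positivity)]
    exact hfg y hy
  have h2 : Integrable (fun x : E3 => f ‖x‖) := (integrable_fun_norm_addHaar volume).2 h1
  have h3 := integral_fun_norm_addHaar (volume : Measure E3) f
  have h0 : 0 ≤ᵐ[volume] fun x : E3 => f ‖x‖ := by
    have : ∀ᵐ x : E3, x ≠ 0 := by simp [ae_iff]
    filter_upwards [this] with x hx using hf0 _ (norm_pos_iff.2 hx)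
  rw [← ofReal_integral_eq_lintegral_ofReal h2 h0, h3, hd]
  refine ENNReal.ofReal_le_ofReal ?_
  rw [sphereArea, nsmul_eq_mul, smul_eq_mul, ← mul_assoc]
  refine mul_le_mul_of_nonneg_left ?_ sphereArea_nonneg
  rw [hd] at h1
  exact setIntegral_mono_on h1 hg measurableSet_Ioi fun y hy => hfg y hy

lemma integrableOn_inv_add_sq {R : ℝ} (hR : 0 < R) :
    IntegrableOn (fun y : ℝ => ((R + y) ^ 2)⁻¹) (Ioi 0) ∧
      ∫ y in Ioi 0, ((R + y) ^ 2)⁻¹ = R⁻¹ := by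
  have hd : ∀ y ∈ Ici (0 : ℝ), HasDerivAt (fun y => -(R + y)⁻¹) (((R + y) ^ 2)⁻¹) y := by
    intro y hy
    have hy' : (0 : ℝ) ≤ y := hy
    have h1 : HasDerivAt (fun y => R + y) 1 y := (hasDerivAt_id y).const_add R
    have := (h1.fun_inv (by positivity)).neg
    exact this.congr_deriv (by field_simp)
  have ht : Tendsto (fun y : ℝ => -(R + y)⁻¹) atTop (𝓝 0) := by
    have : Tendsto (fun y : ℝ => (R + y)⁻¹) atTop (𝓝 0) :=
      tendsto_inv_atTop_zero.comp (tendsto_atTop_add_const_left _ _ tendsto_id)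
    simpa using this.neg
  have hp : ∀ y ∈ Ioi (0 : ℝ), 0 ≤ ((R + y) ^ 2)⁻¹ := fun y _ => by positivity
  refine ⟨integrableOn_Ioi_deriv_of_nonneg' hd hp ht, ?_⟩
  rw [integral_Ioi_of_hasDerivAt_of_nonneg' hd hp ht]; simp

lemma lintegral_norm_pow_mul_add_pow_le {a k : ℕ} (ha : 1 ≤ a) (ha2 : a ≤ 2) {R : ℝ} (hR : 0 < R) :
    ∫⁻ z : E3, ENNReal.ofReal ((‖z‖ ^ a)⁻¹ * ((R + ‖z‖) ^ (3 + k))⁻¹)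
      ≤ ENNReal.ofReal (sphereArea * (R ^ (a + k))⁻¹) := by
  obtain ⟨hi, hv⟩ := integrableOn_inv_add_sq hR
  have := lintegral_radial_le (f := fun y => (y ^ a)⁻¹ * ((R + y) ^ (3 + k))⁻¹)
    (g := fun y => (R ^ (a + k - 1))⁻¹ * ((R + y) ^ 2)⁻¹) (by fun_prop)
    (fun y hy => by positivity) (fun y hy => ?_) (hi.const_mul _)
  · rw [integral_const_mul, hv] at this
    refine this.trans (le_of_eq ?_)
    have h2 : R ^ (a + k) = R ^ (a + k - 1) * R := by
      rw [← pow_succ]; congr 1; omega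
    rw [h2, mul_inv]
  · have e1 : y ^ 2 = y ^ (2 - a) * y ^ a := by rw [← pow_add]; congr 1; omega
    have e2 : (R + y) ^ (3 + k) = (R + y) ^ (2 - a) * ((R + y) ^ (a + k - 1) * (R + y) ^ 2) := by
      rw [← pow_add, ← pow_add]; congr 1; omega
    calc y ^ 2 * ((y ^ a)⁻¹ * ((R + y) ^ (3 + k))⁻¹)
        = y ^ (2 - a) * ((R + y) ^ (2 - a))⁻¹ * (((R + y) ^ (a + k - 1))⁻¹ * ((R + y) ^ 2)⁻¹) := by
          rw [e1, e2]; field_simp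
      _ ≤ 1 * ((R ^ (a + k - 1))⁻¹ * ((R + y) ^ 2)⁻¹) := by
          gcongr
          · rw [← div_eq_mul_inv]
            exact div_le_one_of_le₀ (by gcongr; linarith) (by positivity)
          · linarith
      _ = _ := one_mul _

lemma setLIntegral_one_add_norm_le {R : ℝ} (hR : 0 < R) :
    ∫⁻ y in {y : E3 | ‖y‖ ≤ R}, ENNReal.ofReal (((1 + ‖y‖) ^ 2)⁻¹)
      ≤ ENNReal.ofReal (sphereArea * R) := by
  have hm : MeasurableSet {y : E3 | ‖y‖ ≤ R} := measurableSet_le measurable_norm measurable_const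
  rw [← lintegral_indicator hm]
  have := lintegral_radial_le (f := fun y => (Iic R).indicator (fun y => ((1 + y) ^ 2)⁻¹) y)
    (g := fun y => (Ioc 0 R).indicator (fun _ => 1) y)
    ((by fun_prop : Measurable fun y : ℝ => ((1 + y) ^ 2)⁻¹).indicator measurableSet_Iic)
    (fun y hy => indicator_nonneg (fun z _ => by positivity) y) (fun y hy => ?_) ?_
  · refine le_trans (le_of_eq ?_) (this.trans (le_of_eq ?_))
    · refine lintegral_congr fun x => ?_
      by_cases hx : ‖x‖ ≤ R <;> simp [indicator, hx]
    · rw [setIntegral_indicator measurableSet_Ioc, inter_eq_right.2 Ioc_subset_Ioi_self]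
      simp [hR.le]
  · by_cases h : y ≤ R
    · rw [indicator_of_mem (show y ∈ Iic R from h), indicator_of_mem (show y ∈ Ioc 0 R from ⟨hy, h⟩),
        ← div_eq_mul_inv]
      exact div_le_one_of_le₀ (by gcongr; linarith) (by positivity)
    · simp [indicator, h]
  · exact ((integrable_indicator_iff measurableSet_Ioc).2 (by simp)).integrableOn

lemma lintegral_one_add_norm_le (k : ℕ) :
    ∫⁻ z : E3, ENNReal.ofReal (((1 + ‖z‖) ^ (4 + k))⁻¹) ≤ ENNReal.ofReal sphereArea := by
  obtain ⟨hi, hv⟩ := integrableOn_inv_add_sq one_pos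
  have := lintegral_radial_le (f := fun y => ((1 + y) ^ (4 + k))⁻¹)
    (g := fun y => ((1 + y) ^ 2)⁻¹) (by fun_prop)
    (fun y hy => by positivity) (fun y hy => ?_) hi
  · rw [hv] at this; simpa using this
  · have h1 : y ^ 2 ≤ (1 + y) ^ 2 := by gcongr; linarith
    have h2 : (1 : ℝ) ≤ (1 + y) ^ k := one_le_pow₀ (by linarith)
    rw [← div_eq_mul_inv, div_le_iff₀ (by positivity), show 4 + k = 2 + 2 + k by ring, pow_add, pow_add]
    field_simp
    nlinarith [sq_nonneg (1 + y)]

/-- A bound, uniform in `x`, for the potentials `∫ |z|^{-a} (1 + |x - z|)^{-3-k} dz`. -/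
lemma lintegral_norm_pow_mul_one_add_norm_sub_le {a k : ℕ} (ha : 1 ≤ a) (ha2 : a ≤ 2) (x : E3) :
    ∫⁻ z : E3, ENNReal.ofReal ((‖z‖ ^ a)⁻¹ * ((1 + ‖x - z‖) ^ (3 + k))⁻¹)
      ≤ ENNReal.ofReal (9 * sphereArea) := by
  -- either `1 + |x - z|` is at least half of `1 + |z|`, or `|z| > 1 + |x - z|`
  have hpt : ∀ z : E3, (‖z‖ ^ a)⁻¹ * ((1 + ‖x - z‖) ^ (3 + k))⁻¹ ≤
      8 * ((‖z‖ ^ a)⁻¹ * ((1 + ‖z‖) ^ (3 + 0))⁻¹) + ((1 + ‖x - z‖) ^ (4 + (a - 1)))⁻¹ := by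
    intro z
    have hz := norm_nonneg z
    have hxz := norm_nonneg (x - z)
    have h0 : ((1 + ‖x - z‖) ^ (3 + k))⁻¹ ≤ ((1 + ‖x - z‖) ^ 3)⁻¹ := by
      gcongr
      · linarith
      · omega
    have h1 : (‖z‖ ^ a)⁻¹ * ((1 + ‖x - z‖) ^ (3 + k))⁻¹ ≤ (‖z‖ ^ a)⁻¹ * ((1 + ‖x - z‖) ^ 3)⁻¹ := by
      gcongr
    refine h1.trans ?_
    rcases le_or_gt ((1 + ‖z‖) / 2) (1 + ‖x - z‖) with h | h
    · have h2 : ((1 + ‖x - z‖) ^ 3)⁻¹ ≤ (((1 + ‖z‖) / 2) ^ 3)⁻¹ := by gcongr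
      have h3 : (((1 + ‖z‖) / 2) ^ 3)⁻¹ = 8 * ((1 + ‖z‖) ^ (3 + 0))⁻¹ := by
        rw [div_pow, inv_div, add_zero]; ring
      calc (‖z‖ ^ a)⁻¹ * ((1 + ‖x - z‖) ^ 3)⁻¹
          ≤ (‖z‖ ^ a)⁻¹ * (8 * ((1 + ‖z‖) ^ (3 + 0))⁻¹) := by rw [← h3]; gcongr
        _ = 8 * ((‖z‖ ^ a)⁻¹ * ((1 + ‖z‖) ^ (3 + 0))⁻¹) := by ring
        _ ≤ _ := le_add_of_nonneg_right (by positivity)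
    · have h2 : (‖z‖ ^ a)⁻¹ ≤ ((1 + ‖x - z‖) ^ a)⁻¹ := by gcongr; linarith
      calc (‖z‖ ^ a)⁻¹ * ((1 + ‖x - z‖) ^ 3)⁻¹
          ≤ ((1 + ‖x - z‖) ^ a)⁻¹ * ((1 + ‖x - z‖) ^ 3)⁻¹ := by gcongr
        _ = ((1 + ‖x - z‖) ^ (4 + (a - 1)))⁻¹ := by
            rw [← mul_inv, ← pow_add]; congr 2; omega
        _ ≤ _ := le_add_of_nonneg_left (by positivity)
  have h1 := lintegral_norm_pow_mul_add_pow_le (k := 0) ha ha2 one_pos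
  have h2 := lintegral_one_add_norm_le (a - 1)
  have hS := sphereArea_nonneg
  calc ∫⁻ z : E3, ENNReal.ofReal ((‖z‖ ^ a)⁻¹ * ((1 + ‖x - z‖) ^ (3 + k))⁻¹)
      ≤ ∫⁻ z : E3, (ENNReal.ofReal 8 * ENNReal.ofReal ((‖z‖ ^ a)⁻¹ * ((1 + ‖z‖) ^ (3 + 0))⁻¹)
          + ENNReal.ofReal (((1 + ‖x - z‖) ^ (4 + (a - 1)))⁻¹)) := by
        refine lintegral_mono fun z => ?_
        rw [← ENNReal.ofReal_mul (by norm_num), ← ENNReal.ofReal_add (by positivity) (by positivity)]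
        exact ENNReal.ofReal_le_ofReal (hpt z)
    _ = ENNReal.ofReal 8 * (∫⁻ z : E3, ENNReal.ofReal ((‖z‖ ^ a)⁻¹ * ((1 + ‖z‖) ^ (3 + 0))⁻¹))
          + ∫⁻ z : E3, ENNReal.ofReal (((1 + ‖x - z‖) ^ (4 + (a - 1)))⁻¹) := by
        rw [lintegral_add_left (by fun_prop), lintegral_const_mul _ (by fun_prop)]
    _ = ENNReal.ofReal 8 * (∫⁻ z : E3, ENNReal.ofReal ((‖z‖ ^ a)⁻¹ * ((1 + ‖z‖) ^ (3 + 0))⁻¹))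
          + ∫⁻ z : E3, ENNReal.ofReal (((1 + ‖z‖) ^ (4 + (a - 1)))⁻¹) := by
        congr 1
        exact lintegral_sub_left_eq_self (fun z : E3 => ENNReal.ofReal (((1 + ‖z‖) ^ (4 + (a - 1)))⁻¹)) x
    _ ≤ ENNReal.ofReal 8 * ENNReal.ofReal (sphereArea * (1 ^ (a + 0))⁻¹) + ENNReal.ofReal sphereArea := by
        gcongr
    _ = ENNReal.ofReal (9 * sphereArea) := by
        rw [← ENNReal.ofReal_mul (by norm_num), ← ENNReal.ofReal_add (by simpa using hS) hS]
        congr 1; simp; ring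

/-! ### Cutoff functions -/

lemma norm_iteratedFDeriv_comp_sub_left (i : ℕ) (f : E3 → ℝ) (x y : E3) :
    ‖iteratedFDeriv ℝ i (fun y => f (x - y)) y‖ = ‖iteratedFDeriv ℝ i f (x - y)‖ := by
  have h1 := LinearIsometryEquiv.norm_iteratedFDeriv_comp_right (𝕜 := ℝ)
    (LinearIsometryEquiv.neg ℝ (E := E3)) (fun u => f (x + u)) y i
  have h2 : (fun u => f (x + u)) ∘ (LinearIsometryEquiv.neg ℝ (E := E3)) = fun y => f (x - y) := by
    funext y; simp [sub_eq_add_neg]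
  rw [h2] at h1
  rw [h1, iteratedFDeriv_comp_add_left]
  simp [sub_eq_add_neg]

/-- A cutoff function living, on the scale `R = 1 + |x|`, away from `x`: it equals one where
`|y|` is small compared with `R`; where it differs from one, `1 + |y|` controls `R + |x - y|`.
For `|x| < 1` it is zero. -/
lemma exists_cutoff (n : ℕ) : ∃ C : ℝ, 0 < C ∧ ∀ x : E3, ∃ χ : E3 → ℝ, IsTestFun χ ∧
    (∀ y, 0 ≤ χ y ∧ χ y ≤ 1) ∧
    (∀ i ≤ n, ∀ y, ‖iteratedFDeriv ℝ i χ y‖ ≤ C * ((1 + ‖x‖) ^ i)⁻¹) ∧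
    (∀ y ∈ tsupport χ, 1 + ‖x‖ ≤ 4 * ‖x - y‖ ∧ ‖y‖ ≤ 1 + ‖x‖) ∧
    ∀ y, χ y ≠ 1 → 1 + ‖x‖ + ‖x - y‖ ≤ 40 * (1 + ‖y‖) := by
  let θ : ContDiffBump (0 : E3) := ⟨1 / 16, 1 / 8, by norm_num, by norm_num⟩
  have hθ : ContDiff ℝ ∞ θ := θ.contDiff
  have hb : ∀ i : ℕ, ∃ M, ∀ y, ‖iteratedFDeriv ℝ i θ y‖ ≤ M := fun i =>
    (θ.hasCompactSupport.iteratedFDeriv i).exists_bound_of_continuous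
      (hθ.continuous_iteratedFDeriv (by exact_mod_cast le_top))
  choose M hM using hb
  have hM0 : ∀ i, 0 ≤ M i := fun i => (norm_nonneg _).trans (hM i 0)
  refine ⟨1 + ∑ i ∈ Finset.range (n + 1), M i,
    add_pos_of_pos_of_nonneg one_pos (Finset.sum_nonneg fun i _ => hM0 i), fun x => ?_⟩
  have hx := norm_nonneg x
  -- for `|x| < 1` the point `x` may be close to the origin, and no cutoff is needed: `R ≤ 2 (1 + |y|)`
  rcases lt_or_ge ‖x‖ 1 with h1 | h1
  · refine ⟨fun _ => 0, IsTestFun.zero, fun y => by simp, fun i _ y => ?_, fun y hy => ?_, fun y _ => ?_⟩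
    · have : iteratedFDeriv ℝ i (fun _ : E3 => (0 : ℝ)) y = 0 := by
        simp
      rw [this, norm_zero]
      have := Finset.sum_nonneg fun i (_ : i ∈ Finset.range (n + 1)) => hM0 i
      positivity
    · simp [tsupport, Function.support] at hy
    · have := norm_sub_le x y
      have := norm_nonneg y
      linarith
  -- for `|x| ≥ 1` the cutoff is one for `|y| ≤ R / 16` and vanishes for `|y| ≥ R / 8`, which keeps its
  -- support away from `x`, because `|x| ≥ R / 2`
  · set R := 1 + ‖x‖ with hR
    have hR0 : 0 < R := by positivity
    have hts : ∀ y ∈ tsupport (fun y => θ (R⁻¹ • y)), ‖y‖ ≤ R / 8 := by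
      intro y hy
      have hcl : IsClosed {y : E3 | ‖y‖ ≤ R / 8} := isClosed_le continuous_norm continuous_const
      refine (closure_minimal (fun z hz => ?_) hcl) hy
      have : R⁻¹ • z ∈ Function.support θ := hz
      rw [θ.support_eq, Metric.mem_ball, dist_zero_right, norm_smul,
        Real.norm_of_nonneg (by positivity)] at this
      have h3 : R⁻¹ * ‖z‖ < 1 / 8 := this
      have : ‖z‖ = R * (R⁻¹ * ‖z‖) := by field_simp
      show ‖z‖ ≤ R / 8
      rw [this]; nlinarith
    refine ⟨fun y => θ (R⁻¹ • y), ⟨?_, ?_⟩, fun y => ⟨θ.nonneg, θ.le_one⟩, fun i hi y => ?_,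
      fun y hy => ?_, fun y hy => ?_⟩
    · exact hθ.comp (contDiff_const_smul R⁻¹)
    · exact θ.hasCompactSupport.comp_homeomorph (Homeomorph.smulOfNeZero R⁻¹ (inv_ne_zero hR0.ne'))
    · have := congrFun (iteratedFDeriv_comp_const_smul (i := i) R⁻¹ (hθ.of_le (by exact_mod_cast le_top))) y
      rw [this, norm_smul, norm_pow, norm_inv, Real.norm_of_nonneg hR0.le, ← inv_pow,
        mul_comm]
      have h2 : M i ≤ ∑ i ∈ Finset.range (n + 1), M i :=
        Finset.single_le_sum (fun i _ => hM0 i) (Finset.mem_range.2 (by omega))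
      have := (hM i (R⁻¹ • y)).trans (h2.trans (le_add_of_nonneg_left zero_le_one))
      gcongr
    · have h2 := hts y hy
      have h3 : ‖x‖ - ‖y‖ ≤ ‖x - y‖ := norm_sub_norm_le x y
      constructor <;> linarith
    · have h2 : R / 16 < ‖y‖ := by
        by_contra hc
        apply hy
        refine θ.one_of_mem_closedBall ?_
        rw [Metric.mem_closedBall, dist_zero_right, norm_smul, Real.norm_of_nonneg (by positivity)]
        show R⁻¹ * ‖y‖ ≤ 1 / 16
        rw [inv_mul_le_iff₀ hR0]; linarith
      have h3 := norm_sub_le x y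
      linarith

/-! ### Heat potentials and their pointwise decay -/

/-- A measure on pairs `q = (σ, r)` (time lag, heat time) has order `β` with constant `A`, if
`∫ (√r + ρ)^{-β-1} dμ ≤ A / ρ` for all `ρ > 0`. It then raises homogeneity by `β`: superposing
with `μ` kernels of size `(√r + |z|)^{-β-a}`, `a ≥ 1`, gives a kernel of size `|z|^{-a}`. -/
structure HasOrder (μ : Measure (ℝ × ℝ)) (β : ℕ) (A : ℝ) : Prop where
  pos : ∀ᵐ q ∂μ, 0 < q.2
  bound : ∀ ρ, 0 < ρ →
    ∫⁻ q, ENNReal.ofReal (((√q.2 + ρ) ^ (β + 1))⁻¹) ∂μ ≤ ENNReal.ofReal (A * ρ⁻¹)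

/-- Data that decay like `|y|^{-2-n}` and are, weakly and uniformly in time, `n`-th derivatives of
a field that decays like `|y|^{-2}`. -/
structure IsData (n : ℕ) (B : ℝ) (g : ℝ → E3 → ℝ) : Prop where
  meas : Measurable (Function.uncurry g)
  bound : ∀ s y, |g s y| ≤ B * ((1 + ‖y‖) ^ (2 + n))⁻¹
  weak : ∀ s η, IsTestFun η → ‖∫ y, η y * g s y‖ₑ ≤
    ENNReal.ofReal B * ∫⁻ y, ‖iteratedFDeriv ℝ n η y‖ₑ * ENNReal.ofReal (((1 + ‖y‖) ^ 2)⁻¹)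
  past : ∀ s ≤ 0, g s = 0

/-- The heat potential `∫∫ ∂^α K_r(x - y) g(t - σ, y) dy dμ(σ, r)` with mixing measure `μ`. -/
noncomputable def pot (μ : Measure (ℝ × ℝ)) (α : List (Fin 3)) (g : ℝ → E3 → ℝ) (t : ℝ) (x : E3) :
    ℝ :=
  ∫ p : (ℝ × ℝ) × E3, kern α p.1.2 (x - p.2) * g (t - p.1.1) p.2 ∂(μ.prod volume)

lemma pow_inv_le_split {s ρ u : ℝ} (hs : 0 ≤ s) (hρ : 0 < ρ) (hu : ρ ≤ u) (β k : ℕ) :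
    ((s + u) ^ (β + 1 + k))⁻¹ ≤ ((s + ρ) ^ (β + 1))⁻¹ * (ρ ^ k)⁻¹ := by
  have hu0 : 0 < u := hρ.trans_le hu
  rw [← mul_inv, pow_add (s + u)]
  gcongr
  linarith

lemma lintegral_kern_le (N : ℕ) : ∃ C : ℝ, 0 < C ∧ ∀ α : List (Fin 3), α.length = N →
    ∀ (μ : Measure (ℝ × ℝ)) (β : ℕ) (A : ℝ) (a : ℕ), HasOrder μ β A → 3 + N = β + a → 1 ≤ a →
    ∀ z : E3, z ≠ 0 →
      ∫⁻ q, ‖kern α q.2 z‖ₑ ∂μ ≤ ENNReal.ofReal (C * A * (‖z‖ ^ a)⁻¹) := by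
  obtain ⟨C, hC, h⟩ := exists_norm_iteratedFDeriv_kern_le 0 N
  refine ⟨C, hC, fun α hα μ β A a hμ hN ha z hz => ?_⟩
  have hz0 : 0 < ‖z‖ := norm_pos_iff.2 hz
  obtain ⟨k, rfl⟩ : ∃ k, a = k + 1 := ⟨a - 1, by omega⟩
  calc ∫⁻ q, ‖kern α q.2 z‖ₑ ∂μ
      ≤ ∫⁻ q, ENNReal.ofReal (C * (‖z‖ ^ k)⁻¹) *
          ENNReal.ofReal (((√q.2 + ‖z‖) ^ (β + 1))⁻¹) ∂μ := by
        refine lintegral_mono_ae ?_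
        filter_upwards [hμ.pos] with q hq
        rw [← ENNReal.ofReal_mul (by positivity), ← ofReal_norm]
        refine ENNReal.ofReal_le_ofReal ?_
        have h1 := h α hα q.2 hq z
        rw [norm_iteratedFDeriv_zero, zero_add, hN,
          show β + (k + 1) = β + 1 + k by ring] at h1
        refine h1.trans ?_
        have := pow_inv_le_split (Real.sqrt_nonneg q.2) hz0 le_rfl β k
        calc C * ((√q.2 + ‖z‖) ^ (β + 1 + k))⁻¹
            ≤ C * (((√q.2 + ‖z‖) ^ (β + 1))⁻¹ * (‖z‖ ^ k)⁻¹) := by gcongr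
          _ = _ := by ring
    _ = ENNReal.ofReal (C * (‖z‖ ^ k)⁻¹) *
          ∫⁻ q, ENNReal.ofReal (((√q.2 + ‖z‖) ^ (β + 1))⁻¹) ∂μ :=
        lintegral_const_mul _ (by fun_prop)
    _ ≤ ENNReal.ofReal (C * (‖z‖ ^ k)⁻¹) * ENNReal.ofReal (A * ‖z‖⁻¹) := by
        gcongr; exact hμ.bound _ hz0
    _ = _ := by
        rw [← ENNReal.ofReal_mul (by positivity)]
        congr 1
        rw [pow_succ, mul_inv]; ring

lemma measurable_kern_comp (α : List (Fin 3)) (x : E3) :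
    Measurable (fun p : (ℝ × ℝ) × E3 => kern α p.1.2 (x - p.2)) :=
  (measurable_kern α).comp (by fun_prop : Measurable fun p : (ℝ × ℝ) × E3 => (p.1.2, x - p.2))

lemma measurable_pot_integrand (α : List (Fin 3)) {g : ℝ → E3 → ℝ}
    (hg : Measurable (Function.uncurry g)) (t : ℝ) (x : E3) :
    Measurable (fun p : (ℝ × ℝ) × E3 => kern α p.1.2 (x - p.2) * g (t - p.1.1) p.2) :=
  (measurable_kern_comp α x).mul
    (hg.comp (by fun_prop : Measurable fun p : (ℝ × ℝ) × E3 => (t - p.1.1, p.2)))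

/-- Tonelli's theorem for the kernel of a heat potential against a weight in `y`. -/
lemma lintegral_kern_mul_le (N : ℕ) : ∃ C : ℝ, 0 < C ∧ ∀ α : List (Fin 3), α.length = N →
    ∀ (μ : Measure (ℝ × ℝ)) [SFinite μ] (β : ℕ) (A : ℝ) (a : ℕ), HasOrder μ β A →
    3 + N = β + a → 1 ≤ a → ∀ (x : E3) (h : E3 → ℝ≥0∞), Measurable h →
      ∫⁻ p : (ℝ × ℝ) × E3, ‖kern α p.1.2 (x - p.2)‖ₑ * h p.2 ∂(μ.prod volume) ≤
        ∫⁻ y, ENNReal.ofReal (C * A * (‖x - y‖ ^ a)⁻¹) * h y := by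
  obtain ⟨C, hC, hK⟩ := lintegral_kern_le N
  refine ⟨C, hC, fun α hα μ _ β A a hμ hN ha x h hh => ?_⟩
  have hm : Measurable (fun p : (ℝ × ℝ) × E3 => ‖kern α p.1.2 (x - p.2)‖ₑ * h p.2) :=
    (measurable_kern_comp α x).enorm.mul (hh.comp measurable_snd)
  rw [lintegral_prod_symm _ hm.aemeasurable]
  have hne : ∀ᵐ y : E3, y ≠ x := by simp [ae_iff]
  refine lintegral_mono_ae ?_
  filter_upwards [hne] with y hy
  have hm' : Measurable (fun q : ℝ × ℝ => ‖kern α q.2 (x - y)‖ₑ) :=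
    ((measurable_kern α).comp (by fun_prop : Measurable fun q : ℝ × ℝ => (q.2, x - y))).enorm
  rw [lintegral_mul_const'' _ hm'.aemeasurable]
  gcongr
  exact hK α hα μ β A a hμ hN ha (x - y) (sub_ne_zero.2 hy.symm)

/-- Absolute convergence of heat potentials, uniformly in `t` and `x`. -/
lemma lintegral_pot_le (N : ℕ) : ∃ C : ℝ, 0 < C ∧ ∀ α : List (Fin 3), α.length = N →
    ∀ (μ : Measure (ℝ × ℝ)) [SFinite μ] (β : ℕ) (A : ℝ) (a : ℕ), HasOrder μ β A → 0 ≤ A →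
    3 + N = β + a → 1 ≤ a → a ≤ 2 → ∀ (k : ℕ) (B : ℝ) (g : ℝ → E3 → ℝ), 0 ≤ B →
    (∀ s y, |g s y| ≤ B * ((1 + ‖y‖) ^ (3 + k))⁻¹) → ∀ (t : ℝ) (x : E3),
      ∫⁻ p : (ℝ × ℝ) × E3, ‖kern α p.1.2 (x - p.2) * g (t - p.1.1) p.2‖ₑ ∂(μ.prod volume) ≤
        ENNReal.ofReal (C * A * B) := by
  obtain ⟨C, hC, hK⟩ := lintegral_kern_mul_le N
  have hS := sphereArea_nonneg
  refine ⟨C * (9 * sphereArea) + 1, by positivity,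
    fun α hα μ _ β A a hμ hA hN ha ha2 k B g hB hg t x => ?_⟩
  calc ∫⁻ p : (ℝ × ℝ) × E3, ‖kern α p.1.2 (x - p.2) * g (t - p.1.1) p.2‖ₑ ∂(μ.prod volume)
      ≤ ∫⁻ p : (ℝ × ℝ) × E3, ‖kern α p.1.2 (x - p.2)‖ₑ *
          ENNReal.ofReal (B * ((1 + ‖p.2‖) ^ (3 + k))⁻¹) ∂(μ.prod volume) := by
        refine lintegral_mono fun p => ?_
        rw [enorm_mul]
        gcongr
        rw [← ofReal_norm]
        exact ENNReal.ofReal_le_ofReal (hg _ _)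
    _ ≤ ∫⁻ y, ENNReal.ofReal (C * A * (‖x - y‖ ^ a)⁻¹) *
          ENNReal.ofReal (B * ((1 + ‖y‖) ^ (3 + k))⁻¹) :=
        hK α hα μ β A a hμ hN ha x (fun y => ENNReal.ofReal (B * ((1 + ‖y‖) ^ (3 + k))⁻¹))
          (by fun_prop)
    _ = ∫⁻ z, ENNReal.ofReal (C * A * (‖z‖ ^ a)⁻¹) *
          ENNReal.ofReal (B * ((1 + ‖x - z‖) ^ (3 + k))⁻¹) := by
        rw [← lintegral_sub_left_eq_self _ x]; simp
    _ = ENNReal.ofReal (C * A * B) * ∫⁻ z : E3, ENNReal.ofReal ((‖z‖ ^ a)⁻¹ *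
          ((1 + ‖x - z‖) ^ (3 + k))⁻¹) := by
        rw [← lintegral_const_mul _ (by fun_prop)]
        refine lintegral_congr fun z => ?_
        rw [← ENNReal.ofReal_mul (by positivity), ← ENNReal.ofReal_mul (by positivity)]
        congr 1; ring
    _ ≤ ENNReal.ofReal (C * A * B) * ENNReal.ofReal (9 * sphereArea) := by
        gcongr; exact lintegral_norm_pow_mul_one_add_norm_sub_le ha ha2 x
    _ ≤ _ := by
        rw [← ENNReal.ofReal_mul (by positivity)]
        refine ENNReal.ofReal_le_ofReal ?_
        have : 0 ≤ A * B := by positivity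
        nlinarith

/-- Derivatives of a kernel times a cutoff that lives on the scale `R` and vanishes near `x`. -/
lemma exists_norm_iteratedFDeriv_kern_mul_le (N n : ℕ) (C₀ : ℝ) (hC₀ : 0 < C₀) : ∃ C : ℝ, 0 < C ∧
    ∀ α : List (Fin 3), α.length = N → ∀ β a : ℕ, 3 + N = β + a → 1 ≤ a → a ≤ 2 →
    ∀ (x : E3) (R : ℝ) (χ : E3 → ℝ), 0 < R → IsTestFun χ →
    (∀ i ≤ n, ∀ y, ‖iteratedFDeriv ℝ i χ y‖ ≤ C₀ * (R ^ i)⁻¹) →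
    (∀ y ∈ tsupport χ, R ≤ 4 * ‖x - y‖ ∧ ‖y‖ ≤ R) → ∀ r, 0 < r → ∀ y,
      ‖iteratedFDeriv ℝ n (fun y => kern α r (x - y) * χ y) y‖ ≤
        {y : E3 | ‖y‖ ≤ R}.indicator
          (fun _ => C * (R ^ (a + n - 1))⁻¹ * ((√r + R / 4) ^ (β + 1))⁻¹) y := by
  choose Ck hCk hk using fun i => exists_norm_iteratedFDeriv_kern_le i N
  set D := ∑ i ∈ Finset.range (n + 1), (n.choose i : ℝ) * (Ck i * 4 ^ (n + 2) * C₀) with hD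
  have hD0 : 0 ≤ D := Finset.sum_nonneg fun i _ => by have := (hCk i).le; positivity
  refine ⟨1 + D, by positivity, fun α hα β a hN ha ha2 x R χ hR hχ hχb hχs r hr y => ?_⟩
  have hs := Real.sqrt_nonneg r
  by_cases hy : y ∈ tsupport χ
  · obtain ⟨h1, h2⟩ := hχs y hy
    rw [indicator_of_mem (show y ∈ {y : E3 | ‖y‖ ≤ R} from h2)]
    have hκ : ContDiff ℝ ∞ (fun y => kern α r (x - y)) :=
      (contDiff_kern α r).comp (contDiff_const.sub contDiff_id)
    refine (norm_iteratedFDeriv_mul_le (n := n) (N := ∞) hκ hχ.1 y (by exact_mod_cast le_top)).trans ?_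
    calc _ ≤ ∑ i ∈ Finset.range (n + 1), ((n.choose i : ℝ) * (Ck i * 4 ^ (n + 2) * C₀)) *
            ((R ^ (a + n - 1))⁻¹ * ((√r + R / 4) ^ (β + 1))⁻¹) := by
          refine Finset.sum_le_sum fun i hi => ?_
          have hi' : i ≤ n := by simpa [Nat.lt_succ_iff] using hi
          rw [norm_iteratedFDeriv_comp_sub_left]
          have h3 := hk i α hα r hr (x - y)
          -- on the support of `χ` the kernel is nonsingular: `β + 1` powers of `√r + R / 4` are kept for the
          -- integration over `μ`, the others give powers of `R`
          have h4 := pow_inv_le_split hs (show 0 < R / 4 by positivity)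
            (show R / 4 ≤ ‖x - y‖ by linarith) β (a + i - 1)
          rw [show β + 1 + (a + i - 1) = 3 + (i + N) by omega] at h4
          have h5 : ((R / 4) ^ (a + i - 1))⁻¹ ≤ 4 ^ (n + 2) * (R ^ (a + i - 1))⁻¹ := by
            rw [div_pow, inv_div, div_eq_mul_inv]
            gcongr
            · norm_num
            · omega
          have h6 := hχb (n - i) (by omega) y
          have h7 : (R ^ (a + i - 1))⁻¹ * (R ^ (n - i))⁻¹ = (R ^ (a + n - 1))⁻¹ := by
            rw [← mul_inv, ← pow_add]; congr 2; omega
          have h8 := (hCk i).le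
          calc (n.choose i : ℝ) * ‖iteratedFDeriv ℝ i (kern α r) (x - y)‖ *
                ‖iteratedFDeriv ℝ (n - i) χ y‖
              ≤ (n.choose i : ℝ) * (Ck i * (((√r + R / 4) ^ (β + 1))⁻¹ *
                  (4 ^ (n + 2) * (R ^ (a + i - 1))⁻¹))) * (C₀ * (R ^ (n - i))⁻¹) := by
                gcongr
                refine h3.trans ?_
                gcongr
                refine h4.trans ?_
                gcongr
            _ = ((n.choose i : ℝ) * (Ck i * 4 ^ (n + 2) * C₀)) *
                (((R ^ (a + i - 1))⁻¹ * (R ^ (n - i))⁻¹) * ((√r + R / 4) ^ (β + 1))⁻¹) := by ring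
            _ = _ := by rw [h7]
      _ = D * ((R ^ (a + n - 1))⁻¹ * ((√r + R / 4) ^ (β + 1))⁻¹) := by rw [← Finset.sum_mul]
      _ ≤ (1 + D) * (R ^ (a + n - 1))⁻¹ * ((√r + R / 4) ^ (β + 1))⁻¹ := by
          rw [mul_assoc]; gcongr; linarith
  · have h0 : iteratedFDeriv ℝ n (fun y => kern α r (x - y) * χ y) y = 0 := by
      by_contra hne
      exact hy (closure_mono (Function.support_mul_subset_right (fun y => kern α r (x - y)) χ)
        (support_iteratedFDeriv_subset n hne))
    rw [h0, norm_zero]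
    exact indicator_nonneg (fun _ _ => by positivity) _

lemma integrable_pot_integrand {α : List (Fin 3)} {μ : Measure (ℝ × ℝ)} [SFinite μ] {β a k : ℕ}
    {A B : ℝ} (hμ : HasOrder μ β A) (hA : 0 ≤ A) (hN : 3 + α.length = β + a) (ha : 1 ≤ a)
    (ha2 : a ≤ 2) (hB : 0 ≤ B) {g : ℝ → E3 → ℝ} (hm : Measurable (Function.uncurry g))
    (hg : ∀ s y, |g s y| ≤ B * ((1 + ‖y‖) ^ (3 + k))⁻¹) (t : ℝ) (x : E3) :
    Integrable (fun p : (ℝ × ℝ) × E3 => kern α p.1.2 (x - p.2) * g (t - p.1.1) p.2)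
      (μ.prod volume) := by
  obtain ⟨C, hC, h⟩ := lintegral_pot_le α.length
  refine ⟨(measurable_pot_integrand α hm t x).aestronglyMeasurable, ?_⟩
  exact (h α rfl μ β A a hμ hA hN ha ha2 k B g hB hg t x).trans_lt ENNReal.ofReal_lt_top

/-- **Decay of heat potentials.** The part of the data at distance comparable with `R = 1 + |x|` or
larger is estimated by absolute values; near the origin the derivatives that make up the data are
moved, with the help of a cutoff, onto the kernel. -/
theorem exists_abs_pot_le (N n : ℕ) (hn : 1 ≤ n) : ∃ C : ℝ, 0 < C ∧
    ∀ α : List (Fin 3), α.length = N → ∀ (μ : Measure (ℝ × ℝ)) [SFinite μ] (β : ℕ) (A : ℝ) (a : ℕ),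
    HasOrder μ β A → 0 ≤ A → 3 + N = β + a → 1 ≤ a → a ≤ 2 → ∀ (B : ℝ) (g : ℝ → E3 → ℝ), 0 ≤ B →
    IsData n B g → ∀ (t : ℝ) (x : E3),
      |pot μ α g t x| ≤ C * A * B * ((1 + ‖x‖) ^ (a + n - 1))⁻¹ := by
  obtain ⟨C₀, hC₀, hcut⟩ := exists_cutoff n
  obtain ⟨C₁, hC₁, hnear⟩ := exists_norm_iteratedFDeriv_kern_mul_le N n C₀ hC₀
  obtain ⟨C₂, hC₂, hfar⟩ := lintegral_kern_mul_le N
  have hS := sphereArea_nonneg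
  refine ⟨1 + C₂ * 40 ^ (2 + n) * sphereArea + C₁ * sphereArea * 4, by positivity, ?_⟩
  intro α hα μ _ β A a hμ hA hN ha ha2 B g hB hg t x
  obtain ⟨χ, hχ, hχ01, hχd, hχs, hχf⟩ := hcut x
  set R := 1 + ‖x‖ with hRdef
  have hR : 0 < R := by positivity
  have hint : Integrable (fun p : (ℝ × ℝ) × E3 => kern α p.1.2 (x - p.2) * g (t - p.1.1) p.2)
      (μ.prod volume) := by
    refine integrable_pot_integrand hμ hA (by rw [hα]; exact hN) ha ha2 hB hg.meas
      (k := n - 1) (fun s y => ?_) t x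
    have := hg.bound s y
    rwa [show 3 + (n - 1) = 2 + n by omega]
  have hχm : Measurable (fun p : (ℝ × ℝ) × E3 => χ p.2) := hχ.continuous.measurable.comp measurable_snd
  have hi1 : Integrable (fun p : (ℝ × ℝ) × E3 =>
      χ p.2 * (kern α p.1.2 (x - p.2) * g (t - p.1.1) p.2)) (μ.prod volume) := by
    refine hint.bdd_mul (c := 1) hχm.aestronglyMeasurable (Eventually.of_forall fun p => ?_)
    rw [Real.norm_of_nonneg (hχ01 _).1]; exact (hχ01 _).2
  have hi2 : Integrable (fun p : (ℝ × ℝ) × E3 =>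
      (1 - χ p.2) * (kern α p.1.2 (x - p.2) * g (t - p.1.1) p.2)) (μ.prod volume) := by
    simp_rw [sub_mul, one_mul]; exact hint.sub hi1
  have hsplit : pot μ α g t x =
      (∫ p : (ℝ × ℝ) × E3, (1 - χ p.2) * (kern α p.1.2 (x - p.2) * g (t - p.1.1) p.2)
        ∂(μ.prod volume)) +
      ∫ p : (ℝ × ℝ) × E3, χ p.2 * (kern α p.1.2 (x - p.2) * g (t - p.1.1) p.2)
        ∂(μ.prod volume) := by
    rw [← integral_add hi2 hi1]; unfold pot; congr 1; funext p; ring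
  set Q := A * B * (R ^ (a + n - 1))⁻¹ with hQ
  have hQ0 : 0 ≤ Q := by positivity
  -- the far part: where `χ ≠ 1`, `|g| ≤ C (R + |x - y|)^{-2-n}`
  have h1 : ‖∫ p : (ℝ × ℝ) × E3, (1 - χ p.2) * (kern α p.1.2 (x - p.2) * g (t - p.1.1) p.2)
      ∂(μ.prod volume)‖ₑ ≤ ENNReal.ofReal (C₂ * 40 ^ (2 + n) * sphereArea * Q) := by
    calc _ ≤ ∫⁻ p : (ℝ × ℝ) × E3,
          ‖(1 - χ p.2) * (kern α p.1.2 (x - p.2) * g (t - p.1.1) p.2)‖ₑ ∂(μ.prod volume) :=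
          enorm_integral_le_lintegral_enorm _
      _ ≤ ∫⁻ p : (ℝ × ℝ) × E3, ‖kern α p.1.2 (x - p.2)‖ₑ *
          ENNReal.ofReal (B * 40 ^ (2 + n) * ((R + ‖x - p.2‖) ^ (2 + n))⁻¹) ∂(μ.prod volume) := by
          refine lintegral_mono fun p => ?_
          rw [mul_left_comm, enorm_mul]
          gcongr
          rw [← ofReal_norm]
          refine ENNReal.ofReal_le_ofReal ?_
          have hc0 := (hχ01 p.2).1
          have hc1 := (hχ01 p.2).2
          by_cases hc : χ p.2 = 1
          · simp only [hc, sub_self, zero_mul, norm_zero]; positivity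
          · have h3 := hχf p.2 hc
            have h4 := hg.bound (t - p.1.1) p.2
            rw [norm_mul, Real.norm_of_nonneg (by linarith), Real.norm_eq_abs]
            calc (1 - χ p.2) * |g (t - p.1.1) p.2| ≤ 1 * (B * ((1 + ‖p.2‖) ^ (2 + n))⁻¹) := by
                  gcongr; linarith
              _ ≤ 1 * (B * (((R + ‖x - p.2‖) / 40) ^ (2 + n))⁻¹) := by
                  gcongr
                  rw [div_le_iff₀ (by norm_num)]; linarith
              _ = _ := by rw [div_pow, inv_div, div_eq_mul_inv]; ring
      _ ≤ ∫⁻ y, ENNReal.ofReal (C₂ * A * (‖x - y‖ ^ a)⁻¹) *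
          ENNReal.ofReal (B * 40 ^ (2 + n) * ((R + ‖x - y‖) ^ (2 + n))⁻¹) :=
          hfar α hα μ β A a hμ hN ha x
            (fun y => ENNReal.ofReal (B * 40 ^ (2 + n) * ((R + ‖x - y‖) ^ (2 + n))⁻¹)) (by fun_prop)
      _ = ∫⁻ z : E3, ENNReal.ofReal (C₂ * A * (‖z‖ ^ a)⁻¹) *
          ENNReal.ofReal (B * 40 ^ (2 + n) * ((R + ‖z‖) ^ (2 + n))⁻¹) :=
          lintegral_sub_left_eq_self (fun z : E3 => ENNReal.ofReal (C₂ * A * (‖z‖ ^ a)⁻¹) *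
            ENNReal.ofReal (B * 40 ^ (2 + n) * ((R + ‖z‖) ^ (2 + n))⁻¹)) x
      _ = ENNReal.ofReal (C₂ * A * B * 40 ^ (2 + n)) * ∫⁻ z : E3, ENNReal.ofReal ((‖z‖ ^ a)⁻¹ *
          ((R + ‖z‖) ^ (3 + (n - 1)))⁻¹) := by
          rw [← lintegral_const_mul _ (by fun_prop)]
          refine lintegral_congr fun z => ?_
          rw [← ENNReal.ofReal_mul (by positivity), ← ENNReal.ofReal_mul (by positivity),
            show 3 + (n - 1) = 2 + n by omega]
          congr 1; ring
      _ ≤ ENNReal.ofReal (C₂ * A * B * 40 ^ (2 + n)) *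
          ENNReal.ofReal (sphereArea * (R ^ (a + (n - 1)))⁻¹) := by
          gcongr; exact lintegral_norm_pow_mul_add_pow_le ha ha2 hR
      _ = _ := by
          rw [← ENNReal.ofReal_mul (by positivity), hQ, show a + (n - 1) = a + n - 1 by omega]
          congr 1; ring
  -- the near part: for fixed `(σ, r)` the function `K_r(x - ·) χ` is a test function, supported in the
  -- ball of radius `R`, over which `(1 + |y|)^{-2}` has integral of order `R`
  have h2 : ‖∫ p : (ℝ × ℝ) × E3, χ p.2 * (kern α p.1.2 (x - p.2) * g (t - p.1.1) p.2)
      ∂(μ.prod volume)‖ₑ ≤ ENNReal.ofReal (C₁ * sphereArea * 4 * Q) := by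
    rw [integral_prod _ hi1]
    calc _ ≤ ∫⁻ q, ‖∫ y, χ y * (kern α q.2 (x - y) * g (t - q.1) y)‖ₑ ∂μ :=
          enorm_integral_le_lintegral_enorm _
      _ ≤ ∫⁻ q, ENNReal.ofReal (B * (C₁ * (R ^ (a + n - 1))⁻¹) * (sphereArea * R)) *
            ENNReal.ofReal (((√q.2 + R / 4) ^ (β + 1))⁻¹) ∂μ := by
          refine lintegral_mono_ae ?_
          filter_upwards [hμ.pos] with q hq
          have ht : IsTestFun (fun y => kern α q.2 (x - y) * χ y) :=
            hχ.mul_left ((contDiff_kern α q.2).comp (contDiff_const.sub contDiff_id))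
          have h3 := hg.weak (t - q.1) _ ht
          have h4 := hnear α hα β a hN ha ha2 x R χ hR hχ hχd hχs q.2 hq
          have h5 : (fun y => χ y * (kern α q.2 (x - y) * g (t - q.1) y)) =
              fun y => kern α q.2 (x - y) * χ y * g (t - q.1) y := by funext y; ring
          rw [h5]
          refine h3.trans ?_
          set E := C₁ * (R ^ (a + n - 1))⁻¹ * ((√q.2 + R / 4) ^ (β + 1))⁻¹ with hE
          have hE0 : 0 ≤ E := by positivity
          have hms : MeasurableSet {y : E3 | ‖y‖ ≤ R} :=
            measurableSet_le measurable_norm measurable_const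
          calc ENNReal.ofReal B * ∫⁻ y, ‖iteratedFDeriv ℝ n (fun y => kern α q.2 (x - y) * χ y) y‖ₑ *
                ENNReal.ofReal (((1 + ‖y‖) ^ 2)⁻¹)
              ≤ ENNReal.ofReal B * ∫⁻ y, {y : E3 | ‖y‖ ≤ R}.indicator (fun y => ENNReal.ofReal E *
                ENNReal.ofReal (((1 + ‖y‖) ^ 2)⁻¹)) y := by
                gcongr with y
                have h6 := h4 y
                by_cases hy : ‖y‖ ≤ R
                · rw [indicator_of_mem (show y ∈ {y : E3 | ‖y‖ ≤ R} from hy)] at h6 ⊢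
                  gcongr
                  rw [← ofReal_norm]
                  exact ENNReal.ofReal_le_ofReal h6
                · rw [indicator_of_notMem (show y ∉ {y : E3 | ‖y‖ ≤ R} from hy)] at h6 ⊢
                  have : iteratedFDeriv ℝ n (fun y => kern α q.2 (x - y) * χ y) y = 0 :=
                    norm_le_zero_iff.1 h6
                  simp [this]
            _ = ENNReal.ofReal B * (ENNReal.ofReal E *
                ∫⁻ y in {y : E3 | ‖y‖ ≤ R}, ENNReal.ofReal (((1 + ‖y‖) ^ 2)⁻¹)) := by
                rw [lintegral_indicator hms, lintegral_const_mul _ (by fun_prop)]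
            _ ≤ ENNReal.ofReal B * (ENNReal.ofReal E * ENNReal.ofReal (sphereArea * R)) := by
                gcongr; exact setLIntegral_one_add_norm_le hR
            _ = _ := by
                rw [← ENNReal.ofReal_mul hE0, ← ENNReal.ofReal_mul hB,
                  ← ENNReal.ofReal_mul (by positivity), hE]
                congr 1; ring
      _ = ENNReal.ofReal (B * (C₁ * (R ^ (a + n - 1))⁻¹) * (sphereArea * R)) *
            ∫⁻ q, ENNReal.ofReal (((√q.2 + R / 4) ^ (β + 1))⁻¹) ∂μ :=
          lintegral_const_mul _ (by fun_prop)
      _ ≤ ENNReal.ofReal (B * (C₁ * (R ^ (a + n - 1))⁻¹) * (sphereArea * R)) *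
            ENNReal.ofReal (A * (R / 4)⁻¹) := by
          gcongr; exact hμ.bound _ (by positivity)
      _ = _ := by
          rw [← ENNReal.ofReal_mul (by positivity), hQ]
          congr 1; field_simp
  rw [← Real.norm_eq_abs, ← ENNReal.ofReal_le_ofReal_iff (by positivity), ofReal_norm,
    hsplit]
  refine (enorm_add_le _ _).trans ((add_le_add h1 h2).trans ?_)
  rw [← ENNReal.ofReal_add (by positivity) (by positivity)]
  refine ENNReal.ofReal_le_ofReal ?_
  have : (1 + C₂ * 40 ^ (2 + n) * sphereArea + C₁ * sphereArea * 4) * A * B * (R ^ (a + n - 1))⁻¹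
      = (1 + C₂ * 40 ^ (2 + n) * sphereArea + C₁ * sphereArea * 4) * Q := by rw [hQ]; ring
  rw [this]
  nlinarith

/-! ### Heat potentials as distributions -/

/-- The mixing measure `μ` and the derivatives `∂^α` of the heat kernel combine to a kernel of size
`A |z|^{-a}` with `a = 1` or `a = 2`. -/
structure KernelSize (μ : Measure (ℝ × ℝ)) (α : List (Fin 3)) (a : ℕ) (A : ℝ) : Prop where
  order : ∃ β, HasOrder μ β A ∧ 3 + α.length = β + a
  nonneg : 0 ≤ A
  one_le : 1 ≤ a
  le_two : a ≤ 2

/-- Measurable data bounded by `B (1 + |y|)^{-3}`. -/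
structure IsBdd (B : ℝ) (g : ℝ → E3 → ℝ) : Prop where
  meas : Measurable (Function.uncurry g)
  bound : ∀ s y, |g s y| ≤ B * ((1 + ‖y‖) ^ 3)⁻¹
  nonneg : 0 ≤ B

lemma IsData.isBdd {n : ℕ} {B : ℝ} {g : ℝ → E3 → ℝ} (h : IsData n B g) (hn : 1 ≤ n) (hB : 0 ≤ B) :
    IsBdd B g := by
  refine ⟨h.meas, fun s y => (h.bound s y).trans ?_, hB⟩
  have := norm_nonneg y
  gcongr
  · linarith
  · omega

lemma IsBdd.abs_le {B : ℝ} {g : ℝ → E3 → ℝ} (h : IsBdd B g) (s : ℝ) (y : E3) : |g s y| ≤ B := by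
  refine (h.bound s y).trans (mul_le_of_le_one_right h.nonneg ?_)
  exact inv_le_one_of_one_le₀ (one_le_pow₀ (by linarith [norm_nonneg y]))

lemma locallyIntegrable_of_bounded {F : Type*} [NormedAddCommGroup F] {u : E3 → F} {M : ℝ}
    (hm : AEStronglyMeasurable u volume) (hM : ∀ x, ‖u x‖ ≤ M) : LocallyIntegrable u volume := by
  refine (locallyIntegrable_const (μ := (volume : Measure E3)) M).mono hm
    (Eventually.of_forall fun x => ?_)
  exact (hM x).trans (le_abs_self M)

section Potential

variable {μ : Measure (ℝ × ℝ)} [SFinite μ] {α : List (Fin 3)} {a : ℕ} {A B : ℝ} {g : ℝ → E3 → ℝ}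

lemma measurable_pot (hg : Measurable (Function.uncurry g)) :
    Measurable (Function.uncurry (pot μ α g)) := by
  have h : Measurable (fun q : (ℝ × E3) × ((ℝ × ℝ) × E3) =>
      kern α q.2.1.2 (q.1.2 - q.2.2) * g (q.1.1 - q.2.1.1) q.2.2) :=
    ((measurable_kern α).comp (by fun_prop : Measurable fun q : (ℝ × E3) × ((ℝ × ℝ) × E3) =>
      (q.2.1.2, q.1.2 - q.2.2))).mul
    (hg.comp (by fun_prop : Measurable fun q : (ℝ × E3) × ((ℝ × ℝ) × E3) =>
      (q.1.1 - q.2.1.1, q.2.2)))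
  exact (h.stronglyMeasurable.integral_prod_right (ν := μ.prod (volume : Measure E3))).measurable

lemma IsBdd.exists_lintegral_pot_le (hg : IsBdd B g) (hk : KernelSize μ α a A) :
    ∃ M : ℝ, 0 ≤ M ∧ ∀ t x, ∫⁻ p : (ℝ × ℝ) × E3,
      ‖kern α p.1.2 (x - p.2) * g (t - p.1.1) p.2‖ₑ ∂(μ.prod volume) ≤ ENNReal.ofReal M := by
  obtain ⟨β, hβ, hN⟩ := hk.order
  obtain ⟨C, hC, h⟩ := lintegral_pot_le α.length
  refine ⟨C * A * B, mul_nonneg (mul_nonneg hC.le hk.nonneg) hg.nonneg, fun t x => ?_⟩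
  exact h α rfl μ β A a hβ hk.nonneg hN hk.one_le hk.le_two 0 B g hg.nonneg
    (fun s y => by simpa using hg.bound s y) t x

lemma IsBdd.exists_abs_pot_le (hg : IsBdd B g) (hk : KernelSize μ α a A) :
    ∃ M : ℝ, 0 ≤ M ∧ ∀ t x, |pot μ α g t x| ≤ M := by
  obtain ⟨M, hM, h⟩ := hg.exists_lintegral_pot_le hk
  refine ⟨M, hM, fun t x => ?_⟩
  rw [← Real.norm_eq_abs, ← ENNReal.ofReal_le_ofReal_iff hM, ofReal_norm]
  exact (enorm_integral_le_lintegral_enorm _).trans (h t x)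

lemma IsBdd.locallyIntegrable_pot (hg : IsBdd B g) (hk : KernelSize μ α a A) (t : ℝ) :
    LocallyIntegrable (pot μ α g t) volume := by
  obtain ⟨M, hM, h⟩ := hg.exists_abs_pot_le hk
  refine locallyIntegrable_of_bounded (M := M) ?_ (h t)
  exact ((measurable_pot hg.meas).comp
    (by fun_prop : Measurable fun y : E3 => (t, y))).aestronglyMeasurable

lemma IsBdd.integrable_test_mul (hg : IsBdd B g) (hk : KernelSize μ α a A) (t : ℝ) {η : E3 → ℝ}
    (hη : IsTestFun η) :
    Integrable (fun q : E3 × ((ℝ × ℝ) × E3) =>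
      η q.1 * (kern α q.2.1.2 (q.1 - q.2.2) * g (t - q.2.1.1) q.2.2))
      ((volume : Measure E3).prod (μ.prod volume)) := by
  obtain ⟨M, hM, h⟩ := hg.exists_lintegral_pot_le hk
  have hm : Measurable (fun q : E3 × ((ℝ × ℝ) × E3) =>
      η q.1 * (kern α q.2.1.2 (q.1 - q.2.2) * g (t - q.2.1.1) q.2.2)) :=
    (hη.continuous.measurable.comp measurable_fst).mul
    (((measurable_kern α).comp (by fun_prop : Measurable fun q : E3 × ((ℝ × ℝ) × E3) =>
      (q.2.1.2, q.1 - q.2.2))).mul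
    (hg.meas.comp (by fun_prop : Measurable fun q : E3 × ((ℝ × ℝ) × E3) =>
      (t - q.2.1.1, q.2.2))))
  refine ⟨hm.aestronglyMeasurable, ?_⟩
  rw [HasFiniteIntegral, lintegral_prod _ hm.enorm.aemeasurable]
  calc _ ≤ ∫⁻ x, ‖η x‖ₑ * ENNReal.ofReal M := by
        refine lintegral_mono fun x => ?_
        simp_rw [enorm_mul]
        rw [lintegral_const_mul' _ _ enorm_ne_top]
        gcongr
        simp_rw [← enorm_mul]
        exact h t x
    _ = (∫⁻ x, ‖η x‖ₑ) * ENNReal.ofReal M := lintegral_mul_const' _ _ ENNReal.ofReal_ne_top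
    _ < ⊤ := ENNReal.mul_lt_top hη.integrable.2 ENNReal.ofReal_lt_top

lemma integral_test_kern (α : List (Fin 3)) {η : E3 → ℝ} (hη : IsTestFun η) (r c : ℝ) (y : E3) :
    ∫ x, η x * (kern α r (x - y) * c) = (-1) ^ α.length * (c * heatU r (dpart α η) y) := by
  have h := integral_kern_sub_mul α r hη y
  calc ∫ x, η x * (kern α r (x - y) * c) = ∫ x, c * (kern α r (x - y) * η x) := by
        congr 1; funext x; ring
    _ = _ := by rw [integral_const_mul, h]; ring

/-- The dual form of a heat potential: all derivatives and the heat kernel fall on the test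
function. -/
lemma IsBdd.integral_test_mul_pot (hg : IsBdd B g) (hk : KernelSize μ α a A) (t : ℝ) {η : E3 → ℝ}
    (hη : IsTestFun η) :
    Integrable (fun p : (ℝ × ℝ) × E3 => g (t - p.1.1) p.2 * heatU p.1.2 (dpart α η) p.2)
      (μ.prod volume) ∧
    ∫ x, η x * pot μ α g t x = (-1) ^ α.length *
      ∫ p : (ℝ × ℝ) × E3, g (t - p.1.1) p.2 * heatU p.1.2 (dpart α η) p.2 ∂(μ.prod volume) := by
  have hi := hg.integrable_test_mul hk t hη
  have h1 := hi.integral_prod_right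
  simp only [integral_test_kern α hη] at h1
  refine ⟨?_, ?_⟩
  · refine (h1.const_mul ((-1) ^ α.length)).congr (Eventually.of_forall fun p => ?_)
    simp only
    rw [← mul_assoc, ← pow_add, ← two_mul]; simp
  · unfold pot
    simp_rw [← integral_const_mul]
    rw [integral_integral_swap hi]
    simp only [integral_test_kern α hη]

/-- Derivatives of a heat potential fall on the kernel. -/
lemma IsBdd.hasWeakPartial_pot_kern {a' : ℕ} {A' : ℝ} (hg : IsBdd B g) (k : Fin 3)
    (hk : KernelSize μ α a A) (hk' : KernelSize μ (k :: α) a' A') (t : ℝ) :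
    HasWeakPartial k (pot μ α g t) (pot μ (k :: α) g t) := by
  refine ⟨hg.locallyIntegrable_pot hk t, hg.locallyIntegrable_pot hk' t, fun η hη => ?_⟩
  simp only [smul_eq_mul]
  rw [(hg.integral_test_mul_pot hk t (hη.partialD k)).2, (hg.integral_test_mul_pot hk' t hη).2,
    dpart_partialD hη.1, dpart_cons, List.length_cons, pow_succ]
  ring

/-- The heat semigroup may be used as a test function. -/
lemma integral_mul_heatU_partialD {u u' : E3 → ℝ} {k : Fin 3} (hu : HasWeakPartial k u u')
    {M : ℝ} (hM : ∀ y, |u y| ≤ M) (hM' : ∀ y, |u' y| ≤ M) (r : ℝ) {θ : E3 → ℝ} (hθ : IsTestFun θ) :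
    ∫ y, u y * heatU r (partialD k θ) y = -∫ y, u' y * heatU r θ y := by
  have hint : ∀ {w : E3 → ℝ} {χ : E3 → ℝ}, LocallyIntegrable w volume → (∀ y, |w y| ≤ M) →
      IsTestFun χ → Integrable (fun q : E3 × E3 => w q.1 * (heatK r q.2 * χ (q.2 + q.1)))
        ((volume : Measure E3).prod volume) := by
    intro w χ hw hwM hχ
    have h1 : Integrable (fun q : E3 × E3 => heatK r q.1 * χ q.2)
        ((volume : Measure E3).prod volume) := (integrable_heatK r).mul_prod hχ.integrable
    have h2 := (measurePreserving_prod_add (volume : Measure E3) (volume : Measure E3)).integrable_comp_of_integrable h1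
    have h3 := h2.swap
    refine h3.bdd_mul (c := M) (hw.aestronglyMeasurable.comp_fst) ?_
    exact Eventually.of_forall fun q => hwM q.1
  have hswap : ∀ {w : E3 → ℝ} {χ : E3 → ℝ}, LocallyIntegrable w volume → (∀ y, |w y| ≤ M) →
      IsTestFun χ → ∫ y, w y * heatU r χ y = ∫ z, heatK r z * ∫ y, χ (y + z) * w y := by
    intro w χ hw hwM hχ
    simp_rw [heatU_add_right, ← integral_const_mul]
    rw [integral_integral_swap (hint hw hwM hχ)]
    congr 1; funext z; congr 1; funext y; rw [add_comm z y]; ring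
  rw [hswap hu.1 hM (hθ.partialD k), hswap hu.2.1 hM' hθ, ← integral_neg]
  congr 1; funext z
  have := hu.2.2 _ (hθ.comp_add_right z)
  simp only [smul_eq_mul, partialD_comp_add_right] at this
  rw [this]; ring

/-- Derivatives of a heat potential fall on the data. -/
lemma IsBdd.hasWeakPartial_pot_data {g' : ℝ → E3 → ℝ} (hg : IsBdd B g) (hg' : IsBdd B g') (k : Fin 3)
    (hgg' : ∀ s, HasWeakPartial k (g s) (g' s)) (hk : KernelSize μ α a A) (t : ℝ) :
    HasWeakPartial k (pot μ α g t) (pot μ α g' t) := by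
  refine ⟨hg.locallyIntegrable_pot hk t, hg'.locallyIntegrable_pot hk t, fun η hη => ?_⟩
  simp only [smul_eq_mul]
  obtain ⟨h1, h2⟩ := hg.integral_test_mul_pot hk t (hη.partialD k)
  obtain ⟨h3, h4⟩ := hg'.integral_test_mul_pot hk t hη
  rw [h2, h4, integral_prod _ h1, integral_prod _ h3, ← mul_neg, ← integral_neg]
  congr 2; funext q
  rw [dpart_partialD hη.1]
  exact integral_mul_heatU_partialD (hgg' (t - q.1)) (hg.abs_le _) (hg'.abs_le _) q.2 (hη.dpart α)

end Potential

/-! ### The mixing measures of the Stokes system -/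

/-- The image of Lebesgue measure on `(0,∞)` under `s ↦ (s, s)`: heat potentials with this mixing
measure are the Duhamel integrals of the heat equation. -/
noncomputable def muA : Measure (ℝ × ℝ) :=
  ((volume : Measure ℝ).restrict (Ioi 0)).map (fun s => (s, s))

/-- Lebesgue measure on `{0 < σ < r}`, parametrized by `(σ, r - σ)`: with two derivatives on the
heat kernel it yields the part of the Oseen tensor that is due to the pressure. -/
noncomputable def muB : Measure (ℝ × ℝ) :=
  (((volume : Measure ℝ).restrict (Ioi 0)).prod ((volume : Measure ℝ).restrict (Ioi 0))).map
    (fun q => (q.1, q.1 + q.2))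

/-- Lebesgue measure in `r`, without time lag: heat potentials with this mixing measure are
Newtonian potentials. -/
noncomputable def muP : Measure (ℝ × ℝ) :=
  ((volume : Measure ℝ).restrict (Ioi 0)).map (fun r => (0, r))

instance : SFinite muA := by unfold muA; infer_instance
instance : SFinite muB := by unfold muB; infer_instance
instance : SFinite muP := by unfold muP; infer_instance

/-- `∫_σ^∞ (√r + ρ)^{-m-2} dr ≤ 2 (√σ + ρ)^{-m}` for `m ≥ 1`. -/
lemma lintegral_sqrt_add_pow_le {σ ρ : ℝ} (hσ : 0 ≤ σ) (hρ : 0 < ρ) (m : ℕ) (hm : 1 ≤ m) :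
    ∫⁻ τ in Ioi 0, ENNReal.ofReal (((√(σ + τ) + ρ) ^ (m + 2))⁻¹) ≤
      ENNReal.ofReal (2 * ((√σ + ρ) ^ m)⁻¹) := by
  set G : ℝ → ℝ := fun τ => -(2 * ((√(σ + τ) + ρ) ^ m)⁻¹) with hG
  set G' : ℝ → ℝ := fun τ => m * ((√(σ + τ))⁻¹ * ((√(σ + τ) + ρ) ^ (m + 1))⁻¹) with hG'
  have hcont : Continuous G := by
    refine (continuous_const.mul (Continuous.inv₀ (by fun_prop) fun τ => ?_)).neg
    have := Real.sqrt_nonneg (σ + τ)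
    positivity
  have hd : ∀ τ ∈ Ioi (0 : ℝ), HasDerivAt G (G' τ) τ := by
    intro τ hτ
    have hτ0 : 0 < σ + τ := add_pos_of_nonneg_of_pos hσ hτ
    have hs : 0 < √(σ + τ) := Real.sqrt_pos.2 hτ0
    have h1 : HasDerivAt (fun τ => √(σ + τ)) (1 / (2 * √(σ + τ))) τ :=
      ((hasDerivAt_id τ).const_add σ).sqrt hτ0.ne'
    have h2 := ((((h1.add_const ρ).fun_pow m).fun_inv (by positivity)).const_mul 2).neg
    refine h2.congr_deriv ?_
    obtain ⟨k, rfl⟩ : ∃ k, m = k + 1 := ⟨m - 1, by omega⟩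
    simp only [hG', Nat.add_sub_cancel]
    field_simp
    ring
  have hpos : ∀ τ ∈ Ioi (0 : ℝ), 0 ≤ G' τ := fun τ _ => by positivity
  have ht : Tendsto G atTop (𝓝 0) := by
    have h1 : Tendsto (fun τ : ℝ => (√(σ + τ) + ρ) ^ m) atTop atTop :=
      (tendsto_pow_atTop (by omega)).comp (tendsto_atTop_add_const_right _ _
        (Real.tendsto_sqrt_atTop.comp (tendsto_atTop_add_const_left _ _ tendsto_id)))
    simpa using ((tendsto_inv_atTop_zero.comp h1).const_mul 2).neg
  have hi := integrableOn_Ioi_deriv_of_nonneg hcont.continuousWithinAt hd hpos ht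
  have hv := integral_Ioi_of_hasDerivAt_of_nonneg hcont.continuousWithinAt hd hpos ht
  calc _ ≤ ∫⁻ τ in Ioi 0, ENNReal.ofReal (G' τ) := by
        refine setLIntegral_mono' measurableSet_Ioi fun τ hτ => ENNReal.ofReal_le_ofReal ?_
        have hτ0 : 0 < σ + τ := add_pos_of_nonneg_of_pos hσ hτ
        have hs : 0 < √(σ + τ) := Real.sqrt_pos.2 hτ0
        have hm' : (1 : ℝ) ≤ m := by exact_mod_cast hm
        calc ((√(σ + τ) + ρ) ^ (m + 2))⁻¹ = 1 * ((√(σ + τ) + ρ)⁻¹ * ((√(σ + τ) + ρ) ^ (m + 1))⁻¹) := by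
              rw [one_mul, ← mul_inv, ← pow_succ']
          _ ≤ _ := by
              simp only [hG']
              gcongr
              linarith
    _ = ENNReal.ofReal (∫ τ in Ioi 0, G' τ) := by
        rw [ofReal_integral_eq_lintegral_ofReal hi]
        filter_upwards [ae_restrict_mem measurableSet_Ioi] with τ hτ using hpos τ hτ
    _ = _ := by rw [hv, hG]; simp

lemma lintegral_sqrt_add_sq_le {t ρ : ℝ} (ht : 0 ≤ t) (hρ : 0 < ρ) :
    ∫⁻ s in Ioo 0 t, ENNReal.ofReal (((√s + ρ) ^ 2)⁻¹) ≤ ENNReal.ofReal (2 * √t * ρ⁻¹) := by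
  have hi : IntervalIntegrable (fun s : ℝ => s ^ (-(1 / 2) : ℝ)) volume 0 t :=
    intervalIntegral.intervalIntegrable_rpow' (by norm_num)
  have hv : ∫ s in (0 : ℝ)..t, s ^ (-(1 / 2) : ℝ) = 2 * √t := by
    rw [integral_rpow (Or.inl (by norm_num)), Real.sqrt_eq_rpow]; norm_num
    ring
  rw [intervalIntegral.integral_of_le ht, integral_Ioc_eq_integral_Ioo] at hv
  rw [intervalIntegrable_iff_integrableOn_Ioo_of_le ht] at hi
  calc _ ≤ ∫⁻ s in Ioo 0 t, ENNReal.ofReal (s ^ (-(1 / 2) : ℝ) * ρ⁻¹) := by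
        refine setLIntegral_mono' measurableSet_Ioo fun s hs => ENNReal.ofReal_le_ofReal ?_
        have hs0 : 0 < √s := Real.sqrt_pos.2 hs.1
        rw [Real.rpow_neg hs.1.le, ← Real.sqrt_eq_rpow, ← mul_inv]
        gcongr
        nlinarith
    _ = ENNReal.ofReal (∫ s in Ioo 0 t, s ^ (-(1 / 2) : ℝ) * ρ⁻¹) := by
        rw [ofReal_integral_eq_lintegral_ofReal (hi.mul_const _)]
        filter_upwards [ae_restrict_mem measurableSet_Ioo] with s hs
        have := hs.1
        positivity
    _ = _ := by rw [integral_mul_const, hv]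

lemma measurable_pair_self : Measurable (fun s : ℝ => (s, s)) := by fun_prop
lemma measurable_shear : Measurable (fun q : ℝ × ℝ => (q.1, q.1 + q.2)) := by fun_prop
lemma measurable_vert : Measurable (fun r : ℝ => ((0 : ℝ), r)) := by fun_prop

lemma measurable_order_integrand (ρ : ℝ) (m : ℕ) :
    Measurable (fun q : ℝ × ℝ => ENNReal.ofReal (((√q.2 + ρ) ^ m)⁻¹)) := by fun_prop

lemma hasOrder_muA : HasOrder muA 2 2 := by
  refine ⟨?_, fun ρ hρ => ?_⟩
  · rw [muA, ae_map_iff measurable_pair_self.aemeasurable (measurableSet_lt measurable_const measurable_snd)]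
    exact ae_restrict_mem measurableSet_Ioi
  · rw [muA, lintegral_map (measurable_order_integrand ρ _) measurable_pair_self]
    simpa using lintegral_sqrt_add_pow_le le_rfl hρ 1 le_rfl

lemma hasOrder_muP : HasOrder muP 2 2 := by
  refine ⟨?_, fun ρ hρ => ?_⟩
  · rw [muP, ae_map_iff measurable_vert.aemeasurable (measurableSet_lt measurable_const measurable_snd)]
    exact ae_restrict_mem measurableSet_Ioi
  · rw [muP, lintegral_map (measurable_order_integrand ρ _) measurable_vert]
    simpa using lintegral_sqrt_add_pow_le le_rfl hρ 1 le_rfl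

lemma muB_pos : ∀ᵐ q ∂muB, 0 < q.2 := by
  rw [muB, ae_map_iff measurable_shear.aemeasurable (measurableSet_lt measurable_const measurable_snd),
    Measure.prod_restrict]
  filter_upwards [ae_restrict_mem (measurableSet_Ioi.prod measurableSet_Ioi)] with q hq
  exact add_pos hq.1 hq.2

lemma muB_fst_pos : ∀ᵐ q ∂muB, 0 < q.1 := by
  rw [muB, ae_map_iff measurable_shear.aemeasurable (measurableSet_lt measurable_const measurable_fst),
    Measure.prod_restrict]
  filter_upwards [ae_restrict_mem (measurableSet_Ioi.prod measurableSet_Ioi)] with q hq using hq.1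

lemma lintegral_muB_le {S : Set ℝ} (hS : S ⊆ Ioi 0) (hSm : MeasurableSet S) {ρ : ℝ} (hρ : 0 < ρ)
    (m : ℕ) (hm : 1 ≤ m) :
    ∫⁻ q in S ×ˢ univ, ENNReal.ofReal (((√q.2 + ρ) ^ (m + 2))⁻¹) ∂muB ≤
      ENNReal.ofReal 2 * ∫⁻ s in S, ENNReal.ofReal (((√s + ρ) ^ m)⁻¹) := by
  have hpre : (fun q : ℝ × ℝ => (q.1, q.1 + q.2)) ⁻¹' (S ×ˢ univ) = S ×ˢ univ := by
    ext q; simp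
  rw [muB, setLIntegral_map (hSm.prod MeasurableSet.univ) (measurable_order_integrand ρ _)
    measurable_shear, hpre, Measure.prod_restrict, Measure.restrict_restrict (hSm.prod MeasurableSet.univ),
    prod_inter_prod, inter_eq_left.2 hS, univ_inter, ← Measure.prod_restrict,
    lintegral_prod _ (by fun_prop), ← lintegral_const_mul _ (by fun_prop)]
  refine setLIntegral_mono' hSm fun s hs => ?_
  refine (lintegral_sqrt_add_pow_le (le_of_lt (hS hs)) hρ m hm).trans ?_
  rw [ENNReal.ofReal_mul (by norm_num)]

lemma hasOrder_muB : HasOrder muB 4 4 := by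
  refine ⟨muB_pos, fun ρ hρ => ?_⟩
  have hS : ∫⁻ q, ENNReal.ofReal (((√q.2 + ρ) ^ (4 + 1))⁻¹) ∂muB =
      ∫⁻ q in Ioi 0 ×ˢ univ, ENNReal.ofReal (((√q.2 + ρ) ^ (3 + 2))⁻¹) ∂muB := by
    have : muB.restrict (Ioi 0 ×ˢ univ) = muB := by
      refine Measure.restrict_eq_self_of_ae_mem ?_
      filter_upwards [muB_fst_pos] with q hq using ⟨hq, mem_univ _⟩
    rw [this]
  rw [hS]
  refine (lintegral_muB_le subset_rfl measurableSet_Ioi hρ 3 (by norm_num)).trans ?_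
  have h := lintegral_sqrt_add_pow_le le_rfl hρ 1 le_rfl
  simp only [zero_add, Real.sqrt_zero, pow_one] at h
  calc _ ≤ ENNReal.ofReal 2 * ENNReal.ofReal (2 * ρ⁻¹) := by gcongr
    _ = _ := by rw [← ENNReal.ofReal_mul (by norm_num)]; congr 1; ring

/-- Cutting the time lag at `t` lowers the order by one and yields the factor `√t`. -/
lemma hasOrder_muA_restrict {t : ℝ} (ht : 0 ≤ t) :
    HasOrder (muA.restrict (Iio t ×ˢ univ)) 1 (2 * √t) := by
  refine ⟨ae_restrict_of_ae hasOrder_muA.pos, fun ρ hρ => ?_⟩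
  have hpre : (fun s : ℝ => (s, s)) ⁻¹' (Iio t ×ˢ univ) = Iio t := by ext q; simp
  rw [muA, setLIntegral_map (measurableSet_Iio.prod MeasurableSet.univ)
    (measurable_order_integrand ρ _) measurable_pair_self, hpre,
    Measure.restrict_restrict measurableSet_Iio, inter_comm, Ioi_inter_Iio]
  exact lintegral_sqrt_add_sq_le ht hρ

lemma hasOrder_muB_restrict {t : ℝ} (ht : 0 ≤ t) :
    HasOrder (muB.restrict (Iio t ×ˢ univ)) 3 (4 * √t) := by
  refine ⟨ae_restrict_of_ae hasOrder_muB.pos, fun ρ hρ => ?_⟩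
  have hS : muB.restrict (Iio t ×ˢ univ) = muB.restrict (Ioo 0 t ×ˢ univ) := by
    refine Measure.restrict_congr_set ?_
    filter_upwards [muB_fst_pos] with q hq
    apply propext
    show (q.1 ∈ Iio t ∧ q.2 ∈ univ) ↔ (q.1 ∈ Ioo 0 t ∧ q.2 ∈ univ)
    simp [hq]
  rw [hS]
  refine (lintegral_muB_le Ioo_subset_Ioi_self measurableSet_Ioo hρ 2 (by norm_num)).trans ?_
  calc _ ≤ ENNReal.ofReal 2 * ENNReal.ofReal (2 * √t * ρ⁻¹) := by
        gcongr; exact lintegral_sqrt_add_sq_le ht hρ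
    _ = _ := by rw [← ENNReal.ofReal_mul (by norm_num)]; congr 1; ring

/-- Data that vanish for negative times are only sampled at time lags `σ < t`. -/
lemma pot_restrict (μ : Measure (ℝ × ℝ)) [SFinite μ] (α : List (Fin 3)) {g : ℝ → E3 → ℝ}
    (hg : ∀ s ≤ 0, g s = 0) (t : ℝ) (x : E3) :
    pot (μ.restrict (Iio t ×ˢ univ)) α g t x = pot μ α g t x := by
  have h : (μ.restrict (Iio t ×ˢ univ)).prod (volume : Measure E3) =
      (μ.prod volume).restrict ((Iio t ×ˢ univ) ×ˢ univ) := by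
    conv_lhs => rw [← Measure.restrict_univ (μ := (volume : Measure E3))]
    exact Measure.prod_restrict _ _
  unfold pot
  rw [h]
  refine setIntegral_eq_integral_of_forall_compl_eq_zero fun p hp => ?_
  have : t - p.1.1 ≤ 0 := by simpa using hp
  rw [hg _ this]; simp

lemma kernelSize_muA_nil : KernelSize muA [] 1 2 := ⟨⟨2, hasOrder_muA, rfl⟩, by norm_num, le_rfl, by norm_num⟩
lemma kernelSize_muA (k : Fin 3) : KernelSize muA [k] 2 2 :=
  ⟨⟨2, hasOrder_muA, rfl⟩, by norm_num, by norm_num, le_rfl⟩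
lemma kernelSize_muB (i j : Fin 3) : KernelSize muB [i, j] 1 4 :=
  ⟨⟨4, hasOrder_muB, rfl⟩, by norm_num, le_rfl, by norm_num⟩
lemma kernelSize_muB' (k i j : Fin 3) : KernelSize muB [k, i, j] 2 4 :=
  ⟨⟨4, hasOrder_muB, rfl⟩, by norm_num, by norm_num, le_rfl⟩
lemma kernelSize_muP (j : Fin 3) : KernelSize muP [j] 2 2 :=
  ⟨⟨2, hasOrder_muP, rfl⟩, by norm_num, by norm_num, le_rfl⟩

/-! ### Duhamel's principle in weak form -/

/-- Lebesgue measure on `(0,∞)`. -/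
noncomputable abbrev halfLine : Measure ℝ := (volume : Measure ℝ).restrict (Ioi 0)

/-- The weight `e(σ, y)` may be integrated against `g(t - σ, y)`, with a bound uniform in `t`. -/
structure UnifInt (g e : ℝ → E3 → ℝ) : Prop where
  meas : Measurable (Function.uncurry e)
  bound : ∃ M : ℝ, 0 ≤ M ∧ ∀ t, ∫⁻ q : ℝ × E3, ‖g (t - q.1) q.2 * e q.1 q.2‖ₑ
    ∂(halfLine.prod volume) ≤ ENNReal.ofReal M

lemma measurable_shifted {g e : ℝ → E3 → ℝ} (hg : Measurable (Function.uncurry g))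
    (he : Measurable (Function.uncurry e)) (t : ℝ) :
    Measurable (fun q : ℝ × E3 => g (t - q.1) q.2 * e q.1 q.2) :=
  (hg.comp (by fun_prop : Measurable fun q : ℝ × E3 => (t - q.1, q.2))).mul he

lemma UnifInt.integrable {g e : ℝ → E3 → ℝ} (he : UnifInt g e)
    (hg : Measurable (Function.uncurry g)) (t : ℝ) :
    Integrable (fun q : ℝ × E3 => g (t - q.1) q.2 * e q.1 q.2) (halfLine.prod volume) := by
  obtain ⟨M, -, h⟩ := he.bound
  exact ⟨(measurable_shifted hg he.meas t).aestronglyMeasurable, (h t).trans_lt ENNReal.ofReal_lt_top⟩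

lemma UnifInt.const_mul {g e : ℝ → E3 → ℝ} (h : UnifInt g e) (c : ℝ) :
    UnifInt g (fun σ y => c * e σ y) := by
  obtain ⟨M, hM, hb⟩ := h.bound
  refine ⟨h.meas.const_mul c, |c| * M, by positivity, fun t => ?_⟩
  simp_rw [mul_left_comm _ c, enorm_mul c]
  rw [lintegral_const_mul' _ _ enorm_ne_top, ENNReal.ofReal_mul (abs_nonneg c),
    ← Real.norm_eq_abs, ofReal_norm]
  gcongr
  exact hb t

section Pairing

variable {μ : Measure (ℝ × ℝ)} [SFinite μ] {α : List (Fin 3)} {a : ℕ} {A B : ℝ} {g : ℝ → E3 → ℝ}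

lemma measurable_dual_integrand (hg : Measurable (Function.uncurry g)) {θ : E3 → ℝ}
    (hθ : IsTestFun θ) (t : ℝ) :
    Measurable (fun p : (ℝ × ℝ) × E3 => g (t - p.1.1) p.2 * heatU p.1.2 θ p.2) :=
  (hg.comp (by fun_prop : Measurable fun p : (ℝ × ℝ) × E3 => (t - p.1.1, p.2))).mul
    ((measurable_heatU hθ).comp (by fun_prop : Measurable fun p : (ℝ × ℝ) × E3 => (p.1.2, p.2)))

lemma IsBdd.exists_lintegral_dual_le (hg : IsBdd B g) (hk : KernelSize μ α a A) {η : E3 → ℝ}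
    (hη : IsTestFun η) : ∃ M : ℝ, 0 ≤ M ∧ ∀ t, ∫⁻ p : (ℝ × ℝ) × E3,
      ‖g (t - p.1.1) p.2 * heatU p.1.2 (dpart α η) p.2‖ₑ ∂(μ.prod volume) ≤ ENNReal.ofReal M := by
  obtain ⟨M, hM, h⟩ := hg.exists_lintegral_pot_le hk
  refine ⟨M * ∫ x, ‖η x‖, by positivity, fun t => ?_⟩
  have hm : Measurable (fun q : E3 × ((ℝ × ℝ) × E3) =>
      η q.1 * (kern α q.2.1.2 (q.1 - q.2.2) * g (t - q.2.1.1) q.2.2)) :=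
    (hη.continuous.measurable.comp measurable_fst).mul
    (((measurable_kern α).comp (by fun_prop : Measurable fun q : E3 × ((ℝ × ℝ) × E3) =>
      (q.2.1.2, q.1 - q.2.2))).mul
    (hg.meas.comp (by fun_prop : Measurable fun q : E3 × ((ℝ × ℝ) × E3) =>
      (t - q.2.1.1, q.2.2))))
  calc ∫⁻ p : (ℝ × ℝ) × E3, ‖g (t - p.1.1) p.2 * heatU p.1.2 (dpart α η) p.2‖ₑ ∂(μ.prod volume)
      ≤ ∫⁻ p : (ℝ × ℝ) × E3, ∫⁻ x, ‖η x * (kern α p.1.2 (x - p.2) * g (t - p.1.1) p.2)‖ₑ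
          ∂volume ∂(μ.prod volume) := by
        refine lintegral_mono fun p => ?_
        refine le_trans (le_of_eq ?_) (enorm_integral_le_lintegral_enorm _)
        simp only
        rw [integral_test_kern α hη, enorm_mul ((-1 : ℝ) ^ _)]
        have : ‖(-1 : ℝ) ^ α.length‖ₑ = 1 := by
          rw [← ofReal_norm]; simp
        rw [this, one_mul]
    _ = ∫⁻ x, ∫⁻ p : (ℝ × ℝ) × E3, ‖η x * (kern α p.1.2 (x - p.2) * g (t - p.1.1) p.2)‖ₑ
          ∂(μ.prod volume) ∂volume := lintegral_lintegral_swap hm.enorm.aemeasurable.prod_swap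
    _ ≤ ∫⁻ x, ‖η x‖ₑ * ENNReal.ofReal M := by
        refine lintegral_mono fun x => ?_
        simp_rw [enorm_mul (η x)]
        rw [lintegral_const_mul' _ _ enorm_ne_top]
        gcongr
        exact h t x
    _ = (∫⁻ x, ‖η x‖ₑ) * ENNReal.ofReal M := lintegral_mul_const' _ _ ENNReal.ofReal_ne_top
    _ = ENNReal.ofReal (M * ∫ x, ‖η x‖) := by
        rw [← ofReal_integral_norm_eq_lintegral_enorm hη.integrable, mul_comm M,
          ENNReal.ofReal_mul (by positivity)]

end Pairing

lemma muA_prod : muA.prod (volume : Measure E3) =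
    (halfLine.prod volume).map (fun q : ℝ × E3 => ((q.1, q.1), q.2)) := by
  have h := Measure.map_prod_map halfLine (volume : Measure E3) measurable_pair_self measurable_id
  rw [Measure.map_id] at h
  exact h

lemma muP_prod : muP.prod (volume : Measure E3) =
    (halfLine.prod volume).map (fun q : ℝ × E3 => ((0, q.1), q.2)) := by
  have h := Measure.map_prod_map halfLine (volume : Measure E3) measurable_vert measurable_id
  rw [Measure.map_id] at h
  exact h

lemma muB_prod : muB.prod (volume : Measure E3) =
    ((halfLine.prod halfLine).prod volume).map
      (fun p : (ℝ × ℝ) × E3 => ((p.1.1, p.1.1 + p.1.2), p.2)) := by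
  have h := Measure.map_prod_map (halfLine.prod halfLine) (volume : Measure E3) measurable_shear measurable_id
  rw [Measure.map_id] at h
  exact h

/-- Exchange of the last two variables in a triple product. -/
lemma measurePreserving_rotate (ν : Measure ℝ) [SFinite ν] :
    MeasurePreserving (fun p : (ℝ × E3) × ℝ => ((p.1.1, p.2), p.1.2))
      ((ν.prod (volume : Measure E3)).prod ν) ((ν.prod ν).prod (volume : Measure E3)) := by
  have h1 := measurePreserving_prodAssoc ν (volume : Measure E3) ν
  have h2 := (MeasurePreserving.id ν).prod
    (Measure.measurePreserving_swap (μ := (volume : Measure E3)) (ν := ν))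
  have h3 := (measurePreserving_prodAssoc ν ν (volume : Measure E3)).symm
  exact h3.comp (h2.comp h1)

lemma measurable_heatV {θ : E3 → ℝ} (hθ : IsTestFun θ) :
    Measurable (fun q : ℝ × E3 => ∫ τ in Ioi 0, heatU (q.1 + τ) θ q.2) := by
  have h : Measurable (fun p : (ℝ × E3) × ℝ => heatU (p.1.1 + p.2) θ p.1.2) :=
    (measurable_heatU hθ).comp (by fun_prop : Measurable fun p : (ℝ × E3) × ℝ => (p.1.1 + p.2, p.1.2))
  exact (h.stronglyMeasurable.integral_prod_right (ν := halfLine)).measurable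

lemma heatV_eq (σ : ℝ) (θ : E3 → ℝ) (y : E3) :
    heatV σ θ y = ∫ τ in Ioi 0, heatU (σ + τ) θ y := by
  have h := (measurePreserving_add_left (volume : Measure ℝ) σ).setIntegral_preimage_emb
    (MeasurableEquiv.addLeft σ).measurableEmbedding (fun r => heatU r θ y) (Ioi σ)
  have hp : (fun τ => σ + τ) ⁻¹' Ioi σ = Ioi 0 := by ext τ; simp
  rw [hp] at h
  exact h.symm

section Pairing

variable {α : List (Fin 3)} {a : ℕ} {A B : ℝ} {g : ℝ → E3 → ℝ}

lemma IsBdd.unifInt_heatU (hg : IsBdd B g) {η : E3 → ℝ} (hη : IsTestFun η) :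
    UnifInt g (fun σ y => heatU σ η y) := by
  obtain ⟨M, hM, h⟩ := hg.exists_lintegral_dual_le kernelSize_muA_nil hη
  refine ⟨measurable_heatU hη, M, hM, fun t => ?_⟩
  have := h t
  rw [muA_prod, lintegral_map (measurable_dual_integrand hg.meas (hη.dpart []) t).enorm
    (by fun_prop)] at this
  exact this

lemma IsBdd.integral_test_mul_pot_muA (hg : IsBdd B g) (hk : KernelSize muA α a A) {η : E3 → ℝ}
    (hη : IsTestFun η) (t : ℝ) :
    ∫ x, η x * pot muA α g t x = (-1) ^ α.length *
      ∫ q : ℝ × E3, g (t - q.1) q.2 * heatU q.1 (dpart α η) q.2 ∂(halfLine.prod volume) := by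
  rw [(hg.integral_test_mul_pot hk t hη).2, muA_prod, integral_map (by fun_prop)
    (measurable_dual_integrand hg.meas (hη.dpart α) t).aestronglyMeasurable]

lemma IsBdd.integral_test_mul_pot_muP (hg : IsBdd B g) (hk : KernelSize muP α a A) {η : E3 → ℝ}
    (hη : IsTestFun η) (t : ℝ) :
    ∫ x, η x * pot muP α g t x = (-1) ^ α.length * ∫ y, g t y * heatV 0 (dpart α η) y := by
  obtain ⟨h1, h2⟩ := hg.integral_test_mul_pot hk t hη
  have hm := (measurable_dual_integrand hg.meas (hη.dpart α) t).aestronglyMeasurable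
    (μ := muP.prod volume)
  rw [muP_prod] at h1 h2 hm
  rw [integral_map (by fun_prop) hm] at h2
  have h3 := (integrable_map_measure hm (by fun_prop)).1 h1
  have h4 : Integrable (fun q : ℝ × E3 => g t q.2 * heatU q.1 (dpart α η) q.2)
      (halfLine.prod volume) := by
    refine h3.congr (Eventually.of_forall fun q => ?_)
    simp
  rw [h2]
  congr 1
  simp only [sub_zero]
  rw [integral_prod_symm _ h4]
  simp_rw [integral_const_mul, heatV]

lemma IsBdd.unifInt_heatV (hg : IsBdd B g) (hk : KernelSize muB α a A) {η : E3 → ℝ}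
    (hη : IsTestFun η) : UnifInt g (fun σ y => heatV σ (dpart α η) y) ∧
    ∀ t, ∫ x, η x * pot muB α g t x = (-1) ^ α.length *
      ∫ q : ℝ × E3, g (t - q.1) q.2 * heatV q.1 (dpart α η) q.2 ∂(halfLine.prod volume) := by
  have hms : Measurable (fun p : (ℝ × ℝ) × E3 => ((p.1.1, p.1.1 + p.1.2), p.2)) := by fun_prop
  have hmr := (measurePreserving_rotate halfLine).measurable
  have hm := fun t => measurable_dual_integrand hg.meas (hη.dpart α) t
  refine ⟨?_, fun t => ?_⟩
  · obtain ⟨M, hM, h⟩ := hg.exists_lintegral_dual_le hk hη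
    refine ⟨?_, M, hM, fun t => ?_⟩
    · have := measurable_heatV (hη.dpart α)
      simp_rw [← heatV_eq] at this
      exact this
    · have h1 := h t
      have hmc : Measurable (fun p : (ℝ × ℝ) × E3 =>
          ‖g (t - p.1.1) p.2 * heatU (p.1.1 + p.1.2) (dpart α η) p.2‖ₑ) := ((hm t).comp hms).enorm
      rw [muB_prod, lintegral_map (hm t).enorm hms,
        ← (measurePreserving_rotate halfLine).lintegral_comp hmc] at h1
      have h2 := lintegral_prod (μ := halfLine.prod (volume : Measure E3)) (ν := halfLine) _
        (hmc.comp hmr).aemeasurable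
      simp only [Function.comp_def] at h1 h2
      rw [h2] at h1
      refine le_trans (lintegral_mono fun q => ?_) h1
      simp only [heatV_eq, ← integral_const_mul]
      exact enorm_integral_le_lintegral_enorm _
  · obtain ⟨h1, h2⟩ := hg.integral_test_mul_pot hk t hη
    rw [muB_prod] at h1 h2
    rw [integral_map hms.aemeasurable (hm t).aestronglyMeasurable] at h2
    have h3 := (integrable_map_measure (hm t).aestronglyMeasurable hms.aemeasurable).1 h1
    have h4 := (measurePreserving_rotate halfLine).integrable_comp_of_integrable h3
    have h5 := integral_map (μ := (halfLine.prod (volume : Measure E3)).prod halfLine)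
      hmr.aemeasurable (((hm t).comp hms).aestronglyMeasurable (μ := Measure.map
        (fun p : (ℝ × E3) × ℝ => ((p.1.1, p.2), p.1.2)) _))
    rw [(measurePreserving_rotate halfLine).map_eq] at h5
    simp only [Function.comp_def] at h4 h5
    rw [h2, h5, integral_prod _ h4]
    congr 2; funext q
    simp only [heatV_eq, ← integral_const_mul]

end Pairing

/-- **Duhamel's principle, weak form.** If `∂_σ e = e'` for `σ > 0` and `e(0+) = e₀`, then the
retarded integral `∫∫ g(t - σ, y) e(σ, y)` has the weak time derivative
`∫∫ g(t - σ, y) e'(σ, y) + ∫ g(t, y) e₀(y)`. -/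
theorem duhamel_weak {B : ℝ} {g e e' : ℝ → E3 → ℝ} {e0 : E3 → ℝ} (hg : IsBdd B g)
    (he : UnifInt g e) (he' : UnifInt g e')
    (hd : ∀ y σ, 0 < σ → HasDerivAt (fun σ => e σ y) (e' σ y) σ)
    (h0 : ∀ y, Tendsto (fun σ => e σ y) (𝓝[>] 0) (𝓝 (e0 y)))
    (hM : ∀ y, ∃ M, ∀ σ, 0 < σ → |e σ y| ≤ M ∧ |e' σ y| ≤ M)
    {ψ : ℝ → ℝ} (hψ : ContDiff ℝ ∞ ψ) (hψc : HasCompactSupport ψ) :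
    (∫ t, deriv ψ t * ∫ q : ℝ × E3, g (t - q.1) q.2 * e q.1 q.2 ∂(halfLine.prod volume)) +
      (∫ t, ψ t * ∫ q : ℝ × E3, g (t - q.1) q.2 * e' q.1 q.2 ∂(halfLine.prod volume)) =
    -∫ t, ψ t * ∫ y, g t y * e0 y := by
  -- Fubini for one of the two terms, followed by the substitution `t = s + σ`
  have key : ∀ {χ : ℝ → ℝ} {w : ℝ → E3 → ℝ}, Continuous χ → HasCompactSupport χ → UnifInt g w →
      Integrable (fun p : ℝ × (ℝ × E3) => χ (p.1 + p.2.1) * (g p.1 p.2.2 * w p.2.1 p.2.2))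
        ((volume : Measure ℝ).prod (halfLine.prod volume)) ∧
      ∫ t, χ t * ∫ q : ℝ × E3, g (t - q.1) q.2 * w q.1 q.2 ∂(halfLine.prod volume) =
        ∫ p : ℝ × (ℝ × E3), χ (p.1 + p.2.1) * (g p.1 p.2.2 * w p.2.1 p.2.2)
          ∂((volume : Measure ℝ).prod (halfLine.prod volume)) := by
    intro χ w hχ hχc hw
    have hχi : Integrable χ := hχ.integrable_of_hasCompactSupport hχc
    obtain ⟨K, hK, hb⟩ := hw.bound
    have hm : Measurable (fun p : ℝ × (ℝ × E3) => χ p.1 * (g (p.1 - p.2.1) p.2.2 * w p.2.1 p.2.2)) :=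
      (hχ.measurable.comp measurable_fst).mul ((hg.meas.comp
        (by fun_prop : Measurable fun p : ℝ × (ℝ × E3) => (p.1 - p.2.1, p.2.2))).mul
          (hw.meas.comp measurable_snd))
    have hi : Integrable (fun p : ℝ × (ℝ × E3) => χ p.1 * (g (p.1 - p.2.1) p.2.2 * w p.2.1 p.2.2))
        ((volume : Measure ℝ).prod (halfLine.prod volume)) := by
      refine ⟨hm.aestronglyMeasurable, ?_⟩
      rw [HasFiniteIntegral, lintegral_prod _ hm.enorm.aemeasurable]
      calc _ ≤ ∫⁻ t, ‖χ t‖ₑ * ENNReal.ofReal K := by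
            refine lintegral_mono fun t => ?_
            simp_rw [enorm_mul (χ _)]
            rw [lintegral_const_mul' _ _ enorm_ne_top]
            gcongr
            exact hb t
        _ = (∫⁻ t, ‖χ t‖ₑ) * ENNReal.ofReal K := lintegral_mul_const' _ _ ENNReal.ofReal_ne_top
        _ < ⊤ := ENNReal.mul_lt_top hχi.2 ENNReal.ofReal_lt_top
    have hm2 : Measurable (fun p : ℝ × (ℝ × E3) =>
        χ (p.1 + p.2.1) * (g p.1 p.2.2 * w p.2.1 p.2.2)) :=
      (hχ.measurable.comp (by fun_prop : Measurable fun p : ℝ × (ℝ × E3) => p.1 + p.2.1)).mul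
        ((hg.meas.comp (by fun_prop : Measurable fun p : ℝ × (ℝ × E3) => (p.1, p.2.2))).mul
          (hw.meas.comp measurable_snd))
    have hi2 : Integrable (fun p : ℝ × (ℝ × E3) =>
        χ (p.1 + p.2.1) * (g p.1 p.2.2 * w p.2.1 p.2.2))
        ((volume : Measure ℝ).prod (halfLine.prod volume)) := by
      refine ⟨hm2.aestronglyMeasurable, ?_⟩
      have h1 := hi.2
      rw [HasFiniteIntegral, lintegral_prod_symm _ hm.enorm.aemeasurable] at h1
      rw [HasFiniteIntegral, lintegral_prod_symm _ hm2.enorm.aemeasurable]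
      refine lt_of_le_of_lt (le_of_eq (lintegral_congr fun q => ?_)) h1
      have := lintegral_add_right_eq_self (μ := (volume : Measure ℝ))
        (fun t => ‖χ t * (g (t - q.1) q.2 * w q.1 q.2)‖ₑ) q.1
      rw [← this]
      simp
    refine ⟨hi2, ?_⟩
    simp_rw [← integral_const_mul]
    rw [integral_integral_swap hi, integral_prod_symm _ hi2]
    congr 1; funext q
    have := integral_add_right_eq_self (μ := (volume : Measure ℝ))
      (fun t => χ t * (g (t - q.1) q.2 * w q.1 q.2)) q.1
    rw [← this]
    simp
  obtain ⟨i1, h1⟩ := key (hψ.continuous_deriv (by simp)) hψc.deriv he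
  obtain ⟨i2, h2⟩ := key hψ.continuous hψc he'
  have i12 : Integrable (fun p : ℝ × (ℝ × E3) => deriv ψ (p.1 + p.2.1) *
      (g p.1 p.2.2 * e p.2.1 p.2.2) + ψ (p.1 + p.2.1) * (g p.1 p.2.2 * e' p.2.1 p.2.2))
      ((volume : Measure ℝ).prod (halfLine.prod volume)) := i1.add i2
  -- for fixed `s` and `y` the two integrands add up to `g(s, y) ∂_σ (ψ(s + σ) e(σ, y))`
  rw [h1, h2, ← integral_add i1 i2, integral_prod _ i12, ← integral_neg]
  have hsl := i12.prod_right_ae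
  refine integral_congr_ae ?_
  filter_upwards [hsl] with s hs
  rw [integral_prod_symm _ hs, ← integral_const_mul, ← integral_neg]
  congr 1; funext y
  obtain ⟨M, hMy⟩ := hM y
  obtain ⟨j1, j2, hj⟩ := integral_deriv_mul_add_mul_deriv (s := s) hψ hψc (hd y) (h0 y)
    ((he'.meas.comp (by fun_prop : Measurable fun σ : ℝ => (σ, y))).aestronglyMeasurable) hMy
  have e1 : ∀ σ, deriv ψ (s + σ) * (g s y * e σ y) + ψ (s + σ) * (g s y * e' σ y) =
      g s y * (deriv ψ (s + σ) * e σ y + ψ (s + σ) * e' σ y) := fun σ => by ring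
  simp only [e1]
  rw [integral_const_mul, integral_add j1 j2, hj]
  ring

/-! ### Square integrability and weak derivatives of vector fields -/

section Weights

variable {F : Type*} [NormedAddCommGroup F]

instance (τ : ℝ) : IsFiniteMeasure ((volume : Measure ℝ).restrict (Ioo 0 τ)) :=
  ⟨by simp⟩

lemma memLp_weight : MemLp (fun x : E3 => ((1 + ‖x‖) ^ 2)⁻¹) 2 volume := by
  have hm : Measurable (fun x : E3 => ((1 + ‖x‖) ^ 2)⁻¹) := by fun_prop
  rw [memLp_two_iff_integrable_sq hm.aestronglyMeasurable]
  refine ⟨(hm.pow_const 2).aestronglyMeasurable, ?_⟩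
  refine lt_of_le_of_lt (le_of_eq ?_) ((lintegral_one_add_norm_le 0).trans_lt ENNReal.ofReal_lt_top)
  refine lintegral_congr fun x => ?_
  rw [← ofReal_norm, Real.norm_of_nonneg (by positivity)]
  simp only [← inv_pow, ← pow_mul]

lemma memLp_weight_six : MemLp (fun x : E3 => ((1 + ‖x‖) ^ 2)⁻¹) 6 volume := by
  have hm : Measurable (fun x : E3 => ((1 + ‖x‖) ^ 2)⁻¹) := by fun_prop
  refine ⟨hm.aestronglyMeasurable, ?_⟩
  rw [eLpNorm_lt_top_iff_lintegral_rpow_enorm_lt_top (by norm_num) (by norm_num)]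
  refine lt_of_le_of_lt (le_of_eq ?_) ((lintegral_one_add_norm_le 8).trans_lt ENNReal.ofReal_lt_top)
  refine lintegral_congr fun x => ?_
  rw [← ofReal_norm, Real.norm_of_nonneg (by positivity), ← inv_pow]
  have h6 : (6 : ℝ≥0∞).toReal = ((6 : ℕ) : ℝ) := by simp
  rw [h6, ENNReal.rpow_natCast, ← ENNReal.ofReal_pow (by positivity), ← pow_mul, inv_pow]

lemma memL2L2_of_bound {u : ℝ → E3 → F} {K τ : ℝ} (hm : AEStronglyMeasurable (Function.uncurry u) (stMeasure (Ioo 0 τ)))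
    (hb : ∀ t ∈ Ioo 0 τ, ∀ x, ‖u t x‖ ≤ K * ((1 + ‖x‖) ^ 2)⁻¹) :
    MemLp (Function.uncurry u) 2 (stMeasure (Ioo 0 τ)) := by
  have h := (memLp_weight.const_mul K).comp_snd ((volume : Measure ℝ).restrict (Ioo 0 τ))
  refine h.mono' hm ?_
  have : ∀ᵐ p ∂(stMeasure (Ioo 0 τ)), p.1 ∈ Ioo 0 τ := by
    unfold stMeasure
    exact Measure.quasiMeasurePreserving_fst.ae (ae_restrict_mem measurableSet_Ioo)
  filter_upwards [this] with p hp
  exact hb p.1 hp p.2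

end Weights

lemma LocallyIntegrable.of_apply {u : E3 → E3} (h : ∀ i, LocallyIntegrable (fun x => u x i) volume) :
    LocallyIntegrable u volume := by
  rw [locallyIntegrable_iff]
  intro K hK
  exact Integrable.of_eval_piLp fun i => (h i).integrableOn_isCompact hK

lemma LocallyIntegrable.apply {ι : Type*} [Fintype ι] {u : E3 → EuclideanSpace ℝ ι}
    (h : LocallyIntegrable u volume) (i : ι) : LocallyIntegrable (fun x => u x i) volume := by
  rw [locallyIntegrable_iff]
  intro K hK
  exact Integrable.eval_piLp (h.integrableOn_isCompact hK) i

lemma IsTestFun.integrable_mul {η u : E3 → ℝ} (hη : IsTestFun η) (hu : LocallyIntegrable u volume) :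
    Integrable (fun x => η x * u x) volume :=
  hu.integrable_smul_left_of_hasCompactSupport hη.continuous hη.2

lemma IsTestFun.integrable_smul {F : Type*} [NormedAddCommGroup F] [NormedSpace ℝ F] {η : E3 → ℝ}
    {u : E3 → F} (hη : IsTestFun η) (hu : LocallyIntegrable u volume) :
    Integrable (fun x => η x • u x) volume :=
  hu.integrable_smul_left_of_hasCompactSupport hη.continuous hη.2

lemma HasWeakPartial.of_apply {i : Fin 3} {u g : E3 → E3}
    (h : ∀ j, HasWeakPartial i (fun x => u x j) (fun x => g x j)) : HasWeakPartial i u g := by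
  have hu := LocallyIntegrable.of_apply fun j => (h j).1
  have hg := LocallyIntegrable.of_apply fun j => (h j).2.1
  refine ⟨hu, hg, fun η hη => ?_⟩
  ext j
  have h1 := ((hη.partialD i).integrable_smul hu)
  have h2 := (hη.integrable_smul hg)
  rw [eval_integral_piLp fun k => h1.eval_piLp k, PiLp.neg_apply, eval_integral_piLp fun k => h2.eval_piLp k]
  exact (h j).2.2 η hη

lemma HasWeakPartial.apply {i : Fin 3} {u g : E3 → E3} (h : HasWeakPartial i u g) (j : Fin 3) :
    HasWeakPartial i (fun x => u x j) (fun x => g x j) := by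
  refine ⟨LocallyIntegrable.apply h.1 j, LocallyIntegrable.apply h.2.1 j, fun η hη => ?_⟩
  have h1 := ((hη.partialD i).integrable_smul h.1)
  have h2 := (hη.integrable_smul h.2.1)
  have := congrArg (fun w : E3 => w j) (h.2.2 η hη)
  simp only at this
  rw [eval_integral_piLp fun k => h1.eval_piLp k, PiLp.neg_apply, eval_integral_piLp fun k => h2.eval_piLp k] at this
  exact this

lemma ae_eq_zero_of_test {F : Type*} [NormedAddCommGroup F] [NormedSpace ℝ F] [CompleteSpace F]
    {u : E3 → F} (hu : LocallyIntegrable u volume)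
    (h : ∀ η, IsTestFun η → ∫ x, η x • u x = 0) : ∀ᵐ x, u x = 0 :=
  ae_eq_zero_of_integral_contDiff_smul_eq_zero hu fun η h1 h2 => h η ⟨h1, h2⟩

lemma HasWeakPartial.ae_unique {F : Type*} [NormedAddCommGroup F] [NormedSpace ℝ F] [CompleteSpace F]
    {i : Fin 3} {u g g' : E3 → F} (h : HasWeakPartial i u g) (h' : HasWeakPartial i u g') :
    g =ᵐ[volume] g' := by
  have := ae_eq_zero_of_test (h.2.1.sub h'.2.1) fun η hη => ?_
  · filter_upwards [this] with x hx using sub_eq_zero.1 hx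
  · have h3 := (h.2.2 η hη).symm.trans (h'.2.2 η hη)
    simp only [Pi.sub_apply, smul_sub]
    rw [integral_sub (hη.integrable_smul h.2.1) (hη.integrable_smul h'.2.1), neg_injective h3, sub_self]

lemma HasWeakPartial.add {F : Type*} [NormedAddCommGroup F] [NormedSpace ℝ F]
    {i : Fin 3} {u g u' g' : E3 → F} (h : HasWeakPartial i u g) (h' : HasWeakPartial i u' g') :
    HasWeakPartial i (fun x => u x + u' x) (fun x => g x + g' x) := by
  refine ⟨h.1.add h'.1, h.2.1.add h'.2.1, fun η hη => ?_⟩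
  simp only [smul_add]
  rw [integral_add ((hη.partialD i).integrable_smul h.1) ((hη.partialD i).integrable_smul h'.1),
    integral_add (hη.integrable_smul h.2.1) (hη.integrable_smul h'.2.1), h.2.2 η hη, h'.2.2 η hη]
  abel

lemma HasWeakPartial.neg {F : Type*} [NormedAddCommGroup F] [NormedSpace ℝ F]
    {i : Fin 3} {u g : E3 → F} (h : HasWeakPartial i u g) :
    HasWeakPartial i (fun x => -u x) (fun x => -g x) := by
  refine ⟨h.1.neg, h.2.1.neg, fun η hη => ?_⟩
  simp only [smul_neg, integral_neg, h.2.2 η hη]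

lemma HasWeakPartial.zero {F : Type*} [NormedAddCommGroup F] [NormedSpace ℝ F] (i : Fin 3) :
    HasWeakPartial i (fun _ => (0 : F)) (fun _ => 0) :=
  ⟨locallyIntegrable_zero, locallyIntegrable_zero, fun η _ => by simp⟩

lemma HasWeakPartial.sum {F : Type*} [NormedAddCommGroup F] [NormedSpace ℝ F]
    {i : Fin 3} {ι : Type*} (s : Finset ι) {u g : ι → E3 → F} (h : ∀ k, HasWeakPartial i (u k) (g k)) :
    HasWeakPartial i (fun x => ∑ k ∈ s, u k x) (fun x => ∑ k ∈ s, g k x) := by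
  classical
  induction s using Finset.induction_on with
  | empty => simpa using HasWeakPartial.zero i
  | insert k s hk ih => simpa [Finset.sum_insert hk] using (h k).add ih

lemma HasWeakPartial.congr {F : Type*} [NormedAddCommGroup F] [NormedSpace ℝ F]
    {i : Fin 3} {u g u' g' : E3 → F} (h : HasWeakPartial i u g) (hu : u =ᵐ[volume] u')
    (hg : g =ᵐ[volume] g') : HasWeakPartial i u' g' := by
  refine ⟨h.1.congr hu, h.2.1.congr hg, fun η hη => ?_⟩
  have e1 : ∫ x, partialD i η x • u' x = ∫ x, partialD i η x • u x :=
    integral_congr_ae (hu.mono fun x hx => by simp only [hx])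
  have e2 : ∫ x, η x • g' x = ∫ x, η x • g x :=
    integral_congr_ae (hg.mono fun x hx => by simp only [hx])
  rw [e1, e2, h.2.2 η hη]

/-- For bounded functions a weak time derivative may be checked against test functions in `x`. -/
lemma ae_integral_deriv_mul_eq {u u' : ℝ → E3 → ℝ} {M : ℝ} (hm : Measurable (Function.uncurry u))
    (hm' : Measurable (Function.uncurry u')) (hM : ∀ t x, |u t x| ≤ M) (hM' : ∀ t x, |u' t x| ≤ M)
    {ψ : ℝ → ℝ} (hψ : ContDiff ℝ ∞ ψ) (hψc : HasCompactSupport ψ)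
    (h : ∀ η, IsTestFun η → ∫ t, deriv ψ t * ∫ x, η x * u t x = -∫ t, ψ t * ∫ x, η x * u' t x) :
    ∀ᵐ x, ∫ t, deriv ψ t * u t x = -∫ t, ψ t * u' t x := by
  have key : ∀ {χ : ℝ → ℝ} {w : ℝ → E3 → ℝ}, Continuous χ → HasCompactSupport χ →
      Measurable (Function.uncurry w) → (∀ t x, |w t x| ≤ M) →
      LocallyIntegrable (fun x => ∫ t, χ t * w t x) volume ∧ ∀ η, IsTestFun η →
        ∫ x, η x * ∫ t, χ t * w t x = ∫ t, χ t * ∫ x, η x * w t x := by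
    intro χ w hχ hχc hw hwM
    have hχi : Integrable χ := hχ.integrable_of_hasCompactSupport hχc
    refine ⟨?_, fun η hη => ?_⟩
    · refine locallyIntegrable_of_bounded (M := ∫ t, |χ t| * M) ?_ fun x => ?_
      · have : Measurable (fun q : E3 × ℝ => χ q.2 * w q.2 q.1) :=
          (hχ.measurable.comp measurable_snd).mul (hw.comp measurable_swap)
        exact (this.stronglyMeasurable.integral_prod_right).aestronglyMeasurable
      · refine norm_integral_le_of_norm_le (hχi.abs.mul_const M) (Eventually.of_forall fun t => ?_)
        rw [norm_mul, Real.norm_eq_abs, Real.norm_eq_abs]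
        gcongr
        exact hwM t x
    · have hi : Integrable (fun q : E3 × ℝ => η q.1 * (χ q.2 * w q.2 q.1))
          ((volume : Measure E3).prod volume) := by
        have h1 := hη.integrable.mul_prod hχi
        refine (h1.mul_bdd (c := M) (hw.comp measurable_swap).aestronglyMeasurable
          (Eventually.of_forall fun q => hwM q.2 q.1)).congr (Eventually.of_forall fun q => ?_)
        simp only [Function.comp_apply, Function.uncurry, Prod.swap]
        ring
      simp_rw [← integral_const_mul]
      rw [integral_integral_swap hi]
      congr 1; funext t; congr 1; funext x; ring
  obtain ⟨i1, h1⟩ := key (hψ.continuous_deriv (by simp)) hψc.deriv hm hM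
  obtain ⟨i2, h2⟩ := key hψ.continuous hψc hm' hM'
  have := ae_eq_zero_of_test (i1.add i2) fun η hη => ?_
  · filter_upwards [this] with x hx
    exact eq_neg_of_add_eq_zero_left hx
  · simp only [Pi.add_apply, smul_eq_mul, mul_add]
    rw [integral_add (hη.integrable_mul i1) (hη.integrable_mul i2), h1 η hη, h2 η hη, h η hη]
    ring

lemma locallyIntegrableOn_of_bounded {F : Type*} [NormedAddCommGroup F] {u : ℝ → F} {M : ℝ}
    (hm : AEStronglyMeasurable u volume) (hM : ∀ x, ‖u x‖ ≤ M) (I : Set ℝ) :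
    LocallyIntegrableOn u I volume := by
  refine LocallyIntegrable.locallyIntegrableOn ?_ I
  exact (locallyIntegrable_const (μ := (volume : Measure ℝ)) M).mono hm
    (Eventually.of_forall fun x => (hM x).trans (le_abs_self M))

lemma HasWeakTimeDeriv.of_test {u u' : ℝ → E3 → E3} {M : ℝ}
    (hm : ∀ i, Measurable (Function.uncurry fun t x => u t x i))
    (hm' : ∀ i, Measurable (Function.uncurry fun t x => u' t x i)) (hM : ∀ i t x, |u t x i| ≤ M)
    (hM' : ∀ i t x, |u' t x i| ≤ M)
    (h : ∀ i ψ η, ContDiff ℝ ∞ ψ → HasCompactSupport ψ → IsTestFun η →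
      ∫ t, deriv ψ t * ∫ x, η x * u t x i = -∫ t, ψ t * ∫ x, η x * u' t x i) (I : Set ℝ) :
    HasWeakTimeDeriv I u u' := by
  have hI : ∀ {w : ℝ → E3 → E3}, (∀ i, Measurable (Function.uncurry fun t x => w t x i)) →
      (∀ i t x, |w t x i| ≤ M) → ∀ {χ : ℝ → ℝ}, Continuous χ → HasCompactSupport χ →
      ∀ x i, Integrable (fun t => χ t * w t x i) volume := by
    intro w hw hwM χ hχ hχc x i
    refine (hχ.integrable_of_hasCompactSupport hχc).mul_bdd (c := M)
      ((hw i).comp (by fun_prop : Measurable fun t : ℝ => (t, x))).aestronglyMeasurable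
      (Eventually.of_forall fun t => hwM i t x)
  have hL : ∀ {w : ℝ → E3 → E3}, (∀ i, Measurable (Function.uncurry fun t x => w t x i)) →
      (∀ i t x, |w t x i| ≤ M) → ∀ x, LocallyIntegrableOn (fun t => w t x) I volume := by
    intro w hw hwM x
    refine LocallyIntegrable.locallyIntegrableOn ?_ I
    rw [locallyIntegrable_iff]
    intro K hK
    exact Integrable.of_eval_piLp fun i => ((locallyIntegrableOn_of_bounded (M := M)
      ((hw i).comp (by fun_prop : Measurable fun t : ℝ => (t, x))).aestronglyMeasurable
      (fun t => hwM i t x) K).integrableOn_isCompact hK)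
  refine ⟨Eventually.of_forall fun x => ⟨hL hm hM x, hL hm' hM' x⟩, fun ψ hψ hψc _ => ?_⟩
  have h1 := fun i => ae_integral_deriv_mul_eq (hm i) (hm' i) (hM i) (hM' i) hψ hψc
    fun η hη => h i ψ η hψ hψc hη
  filter_upwards [ae_all_iff.2 h1] with x hx
  ext i
  rw [PiLp.neg_apply, eval_integral_piLp, eval_integral_piLp]
  · exact hx i
  · exact fun i => hI hm' hM' hψ.continuous hψc x i
  · exact fun i => hI hm hM (hψ.continuous_deriv (by simp)) hψc.deriv x i

/-! ### The velocity and the pressure -/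

/-- Data `f` with spatial gradient `Df l j = ∂_l f_j`, of the size required of `div G`. -/
structure StokesData (B : ℝ) (f : Fin 3 → ℝ → E3 → ℝ) (Df : Fin 3 → Fin 3 → ℝ → E3 → ℝ) : Prop where
  nonneg : 0 ≤ B
  data : ∀ j, IsData 1 B (f j)
  grad : ∀ l j, IsData 2 B (Df l j)
  weak : ∀ l j s, HasWeakPartial l (f j s) (Df l j s)

/-- The derivative `∂^α` of the `i`-th velocity component, the Oseen potential
`∫ ∂^α e^{σΔ} (g_i - ∑ⱼ ∂ᵢ∂ⱼ Δ⁻¹ g_j)(t - σ) dσ`, in which `-e^{σΔ} Δ⁻¹ = ∫_σ^∞ e^{rΔ} dr`. -/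
noncomputable def vel (α : List (Fin 3)) (i : Fin 3) (g : Fin 3 → ℝ → E3 → ℝ) (t : ℝ) (x : E3) : ℝ :=
  pot muA α (g i) t x + ∑ j, pot muB (α ++ [i, j]) (g j) t x

/-- The pressure `∑ⱼ ∂ⱼ Δ⁻¹ g_j`. -/
noncomputable def prs (g : Fin 3 → ℝ → E3 → ℝ) (t : ℝ) (x : E3) : ℝ :=
  ∑ j, -pot muP [j] (g j) t x

lemma measurable_vel (α : List (Fin 3)) (i : Fin 3) {g : Fin 3 → ℝ → E3 → ℝ}
    (hg : ∀ j, Measurable (Function.uncurry (g j))) : Measurable (Function.uncurry (vel α i g)) := by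
  have : Function.uncurry (vel α i g) = fun p => Function.uncurry (pot muA α (g i)) p +
      ∑ j, Function.uncurry (pot muB (α ++ [i, j]) (g j)) p := rfl
  rw [this]
  exact (measurable_pot (hg i)).add (Finset.measurable_fun_sum _ fun j _ => measurable_pot (hg j))

lemma measurable_prs {g : Fin 3 → ℝ → E3 → ℝ}
    (hg : ∀ j, Measurable (Function.uncurry (g j))) : Measurable (Function.uncurry (prs g)) := by
  have : Function.uncurry (prs g) = fun p =>
      ∑ j, -Function.uncurry (pot muP [j] (g j)) p := rfl
  rw [this]
  exact Finset.measurable_fun_sum _ fun j _ => (measurable_pot (hg j)).neg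

lemma exists_abs_vel_le (k n : ℕ) (hk : k ≤ 1) (hn : 1 ≤ n) : ∃ C : ℝ, 0 < C ∧
    ∀ α : List (Fin 3), α.length = k → ∀ (i : Fin 3) (B : ℝ) (g : Fin 3 → ℝ → E3 → ℝ), 0 ≤ B →
      (∀ j, IsData n B (g j)) → ∀ t x, |vel α i g t x| ≤ C * B * ((1 + ‖x‖) ^ (k + n))⁻¹ := by
  obtain ⟨C₁, hC₁, h₁⟩ := exists_abs_pot_le k n hn
  obtain ⟨C₂, hC₂, h₂⟩ := exists_abs_pot_le (k + 2) n hn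
  refine ⟨C₁ * 2 + ∑ _j : Fin 3, C₂ * 4, by positivity, fun α hα i B g hB hg t x => ?_⟩
  unfold vel
  refine (abs_add_le _ _).trans ?_
  have e : 1 + k + n - 1 = k + n := by omega
  rw [add_mul, add_mul, Finset.sum_mul, Finset.sum_mul]
  refine add_le_add ?_ ((Finset.abs_sum_le_sum_abs _ _).trans (Finset.sum_le_sum fun j _ => ?_))
  · have := h₁ α hα muA 2 2 (1 + k) hasOrder_muA (by norm_num) (by ring) (by omega) (by omega) B _ hB (hg i) t x
    rwa [e] at this
  · have := h₂ (α ++ [i, j]) (by simp [hα]) muB 4 4 (1 + k) hasOrder_muB (by norm_num) (by ring)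
      (by omega) (by omega) B _ hB (hg j) t x
    rwa [e] at this

lemma exists_abs_prs_le (n : ℕ) (hn : 1 ≤ n) : ∃ C : ℝ, 0 < C ∧
    ∀ (B : ℝ) (g : Fin 3 → ℝ → E3 → ℝ), 0 ≤ B →
      (∀ j, IsData n B (g j)) → ∀ t x, |prs g t x| ≤ C * B * ((1 + ‖x‖) ^ (n + 1))⁻¹ := by
  obtain ⟨C, hC, h⟩ := exists_abs_pot_le 1 n hn
  refine ⟨∑ _j : Fin 3, C * 2, by positivity, fun B g hB hg t x => ?_⟩
  unfold prs
  rw [Finset.sum_mul, Finset.sum_mul]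
  refine (Finset.abs_sum_le_sum_abs _ _).trans (Finset.sum_le_sum fun j _ => ?_)
  have := h [j] rfl muP 2 2 2 hasOrder_muP (by norm_num) (by ring) (by omega) (by omega) B _ hB (hg j) t x
  rwa [abs_neg, show n + 1 = 2 + n - 1 by omega]

/-- For short times the velocity is small, and decays as in `L²`: the part `σ < t` of the mixing
measures has one order less. -/
lemma exists_abs_vel_le_sqrt : ∃ C : ℝ, 0 < C ∧
    ∀ (i : Fin 3) (B : ℝ) (g : Fin 3 → ℝ → E3 → ℝ), 0 ≤ B →
      (∀ j, IsData 1 B (g j)) → ∀ t, 0 ≤ t → ∀ x,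
        |vel [] i g t x| ≤ C * √t * B * ((1 + ‖x‖) ^ 2)⁻¹ := by
  obtain ⟨C₁, hC₁, h₁⟩ := exists_abs_pot_le 0 1 le_rfl
  obtain ⟨C₂, hC₂, h₂⟩ := exists_abs_pot_le 2 1 le_rfl
  refine ⟨C₁ * 2 + ∑ _j : Fin 3, C₂ * 4, by positivity, fun i B g hB hg t ht x => ?_⟩
  unfold vel
  refine (abs_add_le _ _).trans ?_
  rw [add_mul, add_mul, add_mul, Finset.sum_mul, Finset.sum_mul, Finset.sum_mul]
  refine add_le_add ?_ ((Finset.abs_sum_le_sum_abs _ _).trans (Finset.sum_le_sum fun j _ => ?_))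
  · rw [← pot_restrict muA [] (hg i).past, mul_assoc C₁]
    exact h₁ [] rfl _ 1 _ 2 (hasOrder_muA_restrict ht) (by positivity) (by ring) (by omega)
      (by omega) B _ hB (hg i) t x
  · rw [← pot_restrict muB _ (hg j).past, mul_assoc C₂]
    exact h₂ _ rfl _ 3 _ 2 (hasOrder_muB_restrict ht) (by positivity) (by ring) (by omega)
      (by omega) B _ hB (hg j) t x

section Equations

variable {B : ℝ} {f : Fin 3 → ℝ → E3 → ℝ} {Df : Fin 3 → Fin 3 → ℝ → E3 → ℝ}

lemma StokesData.isBdd (h : StokesData B f Df) (j : Fin 3) : IsBdd B (f j) :=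
  (h.data j).isBdd le_rfl h.nonneg

lemma StokesData.isBdd_grad (h : StokesData B f Df) (l j : Fin 3) : IsBdd B (Df l j) :=
  (h.grad l j).isBdd one_le_two h.nonneg

lemma StokesData.hasWeakPartial_vel (h : StokesData B f Df) (k i : Fin 3) (t : ℝ) :
    HasWeakPartial k (vel [] i f t) (vel [k] i f t) :=
  ((h.isBdd i).hasWeakPartial_pot_kern k kernelSize_muA_nil (kernelSize_muA k) t).add
    (HasWeakPartial.sum _ fun j => (h.isBdd j).hasWeakPartial_pot_kern k (kernelSize_muB i j)
      (kernelSize_muB' k i j) t)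

lemma StokesData.hasWeakPartial_vel_grad (h : StokesData B f Df) (l k i : Fin 3) (t : ℝ) :
    HasWeakPartial l (vel [k] i f t) (vel [k] i (Df l) t) :=
  ((h.isBdd i).hasWeakPartial_pot_data (h.isBdd_grad l i) l (h.weak l i) (kernelSize_muA k) t).add
    (HasWeakPartial.sum _ fun j => (h.isBdd j).hasWeakPartial_pot_data (h.isBdd_grad l j) l
      (h.weak l j) (kernelSize_muB' k i j) t)

lemma StokesData.hasWeakPartial_prs (h : StokesData B f Df) (l : Fin 3) (t : ℝ) :
    HasWeakPartial l (prs f t) (prs (Df l) t) :=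
  HasWeakPartial.sum _ fun j => ((h.isBdd j).hasWeakPartial_pot_data (h.isBdd_grad l j) l
      (h.weak l j) (kernelSize_muP j) t).neg

lemma heatV_sum {ι : Type*} (s : Finset ι) (σ : ℝ) (hσ : 0 ≤ σ) {θ : ι → E3 → ℝ} (h : ∀ i, IsTestFun (θ i))
    (y : E3) : heatV σ (fun x => ∑ i ∈ s, θ i x) y = ∑ i ∈ s, heatV σ (θ i) y := by
  unfold heatV
  rw [← integral_finsetSum _ fun i _ => (integrableOn_heatU (h i) y).mono_set (Ioi_subset_Ioi hσ)]
  congr 1; funext r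
  unfold heatU
  simp_rw [Finset.mul_sum]
  exact integral_finsetSum _ fun i _ => integrable_kern_sub_mul [] r (h i) y

lemma ae_halfLine_prod_pos : ∀ᵐ q ∂(halfLine.prod (volume : Measure E3)), 0 < q.1 :=
  Measure.quasiMeasurePreserving_fst.ae (ae_restrict_mem measurableSet_Ioi)

/-- The velocity is divergence free. -/
theorem StokesData.divergence (h : StokesData B f Df) (t : ℝ) :
    ∀ᵐ x, ∑ i, vel [i] i f t x = 0 := by
  have hA := fun i => (h.isBdd i).locallyIntegrable_pot (kernelSize_muA i) t
  have hB := fun i j => (h.isBdd j).locallyIntegrable_pot (kernelSize_muB' i i j) t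
  have hBs : ∀ i, LocallyIntegrable (fun x => ∑ j, pot muB [i, i, j] (f j) t x) volume :=
    fun i => locallyIntegrable_finsetSum _ fun j _ => hB i j
  have hv : ∀ i, LocallyIntegrable (vel [i] i f t) volume := fun i => (hA i).add (hBs i)
  refine ae_eq_zero_of_test (locallyIntegrable_finsetSum _ fun i _ => hv i) fun η hη => ?_
  simp only [smul_eq_mul, Finset.mul_sum]
  rw [integral_finsetSum _ fun i _ => hη.integrable_mul (hv i)]
  have hV := fun i j => ((h.isBdd j).unifInt_heatV (kernelSize_muB' i i j) hη)
  have e : ∀ i, ∫ x, η x * vel [i] i f t x =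
      -(∫ q : ℝ × E3, f i (t - q.1) q.2 * heatU q.1 (partialD i η) q.2 ∂(halfLine.prod volume)) +
      ∑ j, -∫ q : ℝ × E3, f j (t - q.1) q.2 * heatV q.1 (dpart [i, i, j] η) q.2
        ∂(halfLine.prod volume) := by
    intro i
    simp only [vel, mul_add, Finset.mul_sum, List.cons_append, List.nil_append]
    rw [integral_add (hη.integrable_mul (hA i)) (integrable_finsetSum _ fun j _ =>
      hη.integrable_mul (hB i j)), integral_finsetSum _ fun j _ => hη.integrable_mul (hB i j),
      (h.isBdd i).integral_test_mul_pot_muA (kernelSize_muA i) hη]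
    congr 1
    · simp
    · refine Finset.sum_congr rfl fun j _ => ?_
      rw [(hV i j).2]
      norm_num [pow_succ]
  simp only [e]
  rw [Finset.sum_add_distrib, Finset.sum_comm, ← Finset.sum_add_distrib]
  refine Finset.sum_eq_zero fun j _ => ?_
  rw [Finset.sum_neg_distrib, ← integral_finsetSum _ fun i _ => (hV i j).1.integrable (h.data j).meas t,
    ← neg_add, neg_eq_zero]
  have : ∀ᵐ q ∂(halfLine.prod (volume : Measure E3)),
      ∑ i, f j (t - q.1) q.2 * heatV q.1 (dpart [i, i, j] η) q.2 =
        -(f j (t - q.1) q.2 * heatU q.1 (partialD j η) q.2) := by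
    filter_upwards [ae_halfLine_prod_pos] with q hq
    rw [← Finset.mul_sum, ← heatV_sum _ _ hq.le fun i => hη.dpart [i, i, j], neg_mul_eq_mul_neg,
      ← heatV_lap hq (hη.partialD j)]
    rfl
  rw [integral_congr_ae this, integral_neg, add_neg_cancel]

lemma integrable_mul_integral_test {χ : ℝ → ℝ} (hχ : Continuous χ) (hχc : HasCompactSupport χ)
    {η : E3 → ℝ} (hη : IsTestFun η) {w : ℝ → E3 → ℝ} {M : ℝ} (hw : Measurable (Function.uncurry w))
    (hM : ∀ t x, |w t x| ≤ M) : Integrable (fun t => χ t * ∫ x, η x * w t x) := by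
  refine (hχ.integrable_of_hasCompactSupport hχc).mul_bdd (c := ∫ x, ‖η x‖ * M) ?_
    (Eventually.of_forall fun t => ?_)
  · have : Measurable (fun q : ℝ × E3 => η q.2 * w q.1 q.2) :=
      (hη.continuous.measurable.comp measurable_snd).mul hw
    exact (this.stronglyMeasurable.integral_prod_right).aestronglyMeasurable
  · refine norm_integral_le_of_norm_le (hη.integrable.norm.mul_const M) (Eventually.of_forall fun x => ?_)
    rw [norm_mul]
    gcongr
    exact hM t x

/-- Time derivative of the heat part of the velocity. -/
lemma StokesData.duhamel_muA (h : StokesData B f Df) (i : Fin 3) {ψ : ℝ → ℝ} (hψ : ContDiff ℝ ∞ ψ)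
    (hψc : HasCompactSupport ψ) {η : E3 → ℝ} (hη : IsTestFun η) :
    (∫ t, deriv ψ t * ∫ x, η x * pot muA [] (f i) t x) +
      (∫ t, ψ t * ∫ x, lap η x * pot muA [] (f i) t x) = -∫ t, ψ t * ∫ x, η x * f i t x := by
  have hg := h.isBdd i
  obtain ⟨M₁, -, h₁⟩ := hη.exists_abs_heatU_le
  obtain ⟨M₂, -, h₂⟩ := hη.lap.exists_abs_heatU_le
  have := duhamel_weak hg (hg.unifInt_heatU hη) (hg.unifInt_heatU hη.lap)
    (fun y σ hσ => hasDerivAt_heatU hσ hη y) (fun y => tendsto_heatU_zero hη y)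
    (fun y => ⟨max M₁ M₂, fun σ hσ => ⟨(h₁ σ hσ y).1.trans (le_max_left _ _),
      (h₂ σ hσ y).1.trans (le_max_right _ _)⟩⟩) hψ hψc
  simp_rw [hg.integral_test_mul_pot_muA kernelSize_muA_nil hη,
    hg.integral_test_mul_pot_muA kernelSize_muA_nil hη.lap]
  simpa [mul_comm] using this

/-- Time derivative of the Riesz part of the velocity. -/
lemma StokesData.duhamel_muB (h : StokesData B f Df) (i j : Fin 3) {ψ : ℝ → ℝ} (hψ : ContDiff ℝ ∞ ψ)
    (hψc : HasCompactSupport ψ) {η : E3 → ℝ} (hη : IsTestFun η) :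
    (∫ t, deriv ψ t * ∫ x, η x * pot muB [i, j] (f j) t x) +
      (∫ t, ψ t * ∫ x, lap η x * pot muB [i, j] (f j) t x) =
      ∫ t, ψ t * ∫ x, partialD i η x * pot muP [j] (f j) t x := by
  have hg := h.isBdd j
  have hθ := hη.dpart [i, j]
  obtain ⟨M, -, hM⟩ := hθ.exists_abs_heatU_le
  have h1 := (hg.unifInt_heatU hθ).const_mul (-1)
  simp only [neg_one_mul] at h1
  have := duhamel_weak hg (hg.unifInt_heatV (kernelSize_muB i j) hη).1 h1
    (fun y σ hσ => hasDerivAt_heatV hσ hθ y) (fun y => tendsto_heatV_zero hθ y)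
    (fun y => ⟨max (∫ r in Ioi 0, |heatU r (dpart [i, j] η) y|) M, fun σ hσ =>
      ⟨(abs_heatV_le hσ.le hθ y).trans (le_max_left _ _), by
        rw [abs_neg]; exact (hM σ hσ y).1.trans (le_max_right _ _)⟩⟩) hψ hψc
  have e1 : ∀ t, ∫ x, lap η x * pot muB [i, j] (f j) t x =
      ∫ q : ℝ × E3, f j (t - q.1) q.2 * -heatU q.1 (dpart [i, j] η) q.2 ∂(halfLine.prod volume) := by
    intro t
    rw [(hg.unifInt_heatV (kernelSize_muB i j) hη.lap).2 t, dpart_lap hη]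
    simp only [List.length_cons, List.length_nil, zero_add, Nat.reduceAdd, even_two, Even.neg_pow,
      one_pow, one_mul]
    refine integral_congr_ae ?_
    filter_upwards [ae_halfLine_prod_pos] with q hq
    rw [heatV_lap hq hθ]
  have e2 : ∀ t, ∫ x, partialD i η x * pot muP [j] (f j) t x =
      -∫ y, f j t y * heatV 0 (dpart [i, j] η) y := by
    intro t
    rw [hg.integral_test_mul_pot_muP (kernelSize_muP j) (hη.partialD i), dpart_partialD hη.1]
    simp
  simp_rw [e1, e2, (hg.unifInt_heatV (kernelSize_muB i j) hη).2, mul_neg (ψ _), integral_neg]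
  simpa using this

/-- The momentum equation, tested in space and time. -/
theorem StokesData.momentum (h : StokesData B f Df) (i : Fin 3) {ψ : ℝ → ℝ} {η : E3 → ℝ}
    (hψ : ContDiff ℝ ∞ ψ) (hψc : HasCompactSupport ψ) (hη : IsTestFun η) :
    ∫ t, deriv ψ t * ∫ x, η x * vel [] i f t x = -∫ t, ψ t * ∫ x, η x *
      ((∑ k, vel [k] i (Df k) t x) - prs (Df i) t x + f i t x) := by
  have hA := fun t => (h.isBdd i).locallyIntegrable_pot kernelSize_muA_nil t
  have hB := fun j t => (h.isBdd j).locallyIntegrable_pot (kernelSize_muB i j) t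
  have hP := fun j t => (h.isBdd j).locallyIntegrable_pot (kernelSize_muP j) t
  obtain ⟨MA, -, bA⟩ := (h.isBdd i).exists_abs_pot_le kernelSize_muA_nil
  choose MB _ bB using fun j => (h.isBdd j).exists_abs_pot_le (kernelSize_muB i j)
  choose MP _ bP using fun j => (h.isBdd j).exists_abs_pot_le (kernelSize_muP j)
  have mA : Measurable (Function.uncurry (pot muA [] (f i))) := measurable_pot (h.data i).meas
  have mB := fun j => measurable_pot (μ := muB) (α := [i, j]) (h.data j).meas
  have mP := fun j => measurable_pot (μ := muP) (α := [j]) (h.data j).meas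
  have hv : ∀ {θ : E3 → ℝ}, IsTestFun θ → ∀ t, ∫ x, θ x * vel [] i f t x =
      (∫ x, θ x * pot muA [] (f i) t x) + ∑ j, ∫ x, θ x * pot muB [i, j] (f j) t x := by
    intro θ hθ t
    simp only [vel, mul_add, Finset.mul_sum, List.nil_append]
    rw [integral_add (hθ.integrable_mul (hA t)) (integrable_finsetSum _ fun j _ =>
      hθ.integrable_mul (hB j t)), integral_finsetSum _ fun j _ => hθ.integrable_mul (hB j t)]
  -- the right-hand side, with all derivatives on the test function
  have hr : ∀ t, ∫ x, η x * ((∑ k, vel [k] i (Df k) t x) - prs (Df i) t x + f i t x) =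
      (∫ x, lap η x * pot muA [] (f i) t x) + (∑ j, ∫ x, lap η x * pot muB [i, j] (f j) t x)
        - (∑ j, ∫ x, partialD i η x * pot muP [j] (f j) t x) + ∫ x, η x * f i t x := by
    intro t
    have i1 := fun k => (h.hasWeakPartial_vel_grad k k i t)
    have i2 := fun k => (h.hasWeakPartial_vel k i t)
    have i3 := (h.hasWeakPartial_prs i t)
    have hf : LocallyIntegrable (f i t) volume := (h.weak i i t).1
    have s1 : ∀ k, ∫ x, η x * vel [k] i (Df k) t x = ∫ x, dpart [k, k] η x * vel [] i f t x := by
      intro k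
      have a1 := (i1 k).2.2 η hη
      have a2 := (i2 k).2.2 _ (hη.partialD k)
      simp only [smul_eq_mul] at a1 a2
      rw [← neg_eq_iff_eq_neg] at a1 a2
      rw [← a1, ← a2, neg_neg]; rfl
    have s2 : ∫ x, η x * prs (Df i) t x = ∑ j, ∫ x, partialD i η x * pot muP [j] (f j) t x := by
      have a1 := i3.2.2 η hη
      simp only [smul_eq_mul] at a1
      rw [← neg_eq_iff_eq_neg] at a1
      rw [← a1]
      simp only [prs, Finset.mul_sum, mul_neg, Finset.sum_neg_distrib, integral_neg, neg_neg]
      rw [integral_finsetSum _ fun j _ => (hη.partialD i).integrable_mul (hP j t)]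
    have s3 : ∑ k, ∫ x, dpart [k, k] η x * vel [] i f t x = ∫ x, lap η x * vel [] i f t x := by
      rw [← integral_finsetSum _ fun k _ => (hη.dpart [k, k]).integrable_mul (i2 k).1]
      simp only [lap, Finset.sum_mul]
    simp only [mul_add, mul_sub, Finset.mul_sum]
    rw [integral_add ?_ (hη.integrable_mul hf), integral_sub ?_ (hη.integrable_mul i3.2.1),
      integral_finsetSum _ fun k _ => hη.integrable_mul (i1 k).2.1, s2]
    · simp only [s1]
      rw [s3, hv hη.lap]
    · exact integrable_finsetSum _ fun k _ => hη.integrable_mul (i1 k).2.1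
    · exact (integrable_finsetSum _ fun k _ => hη.integrable_mul (i1 k).2.1).sub
        (hη.integrable_mul i3.2.1)
  have cψ := hψ.continuous
  have cψ' := hψ.continuous_deriv (by simp)
  simp only [hv hη, hr]
  simp only [mul_add, mul_sub, Finset.mul_sum]
  have j1 := integrable_mul_integral_test cψ' hψc.deriv hη mA bA
  have j2 := fun j => integrable_mul_integral_test cψ' hψc.deriv hη (mB j) (bB j)
  have j3 := integrable_mul_integral_test cψ hψc hη.lap mA bA
  have j4 := fun j => integrable_mul_integral_test cψ hψc hη.lap (mB j) (bB j)
  have j5 := fun j => integrable_mul_integral_test cψ hψc (hη.partialD i) (mP j) (bP j)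
  have j6 := integrable_mul_integral_test cψ hψc hη (h.data i).meas (h.isBdd i).abs_le
  have j4s := integrable_finsetSum Finset.univ fun j _ => j4 j
  have j5s := integrable_finsetSum Finset.univ fun j _ => j5 j
  rw [integral_add j1 (integrable_finsetSum _ fun j _ => j2 j), integral_finsetSum _ fun j _ => j2 j,
    integral_add (by exact (j3.add j4s).sub j5s) j6, integral_sub (by exact j3.add j4s) j5s,
    integral_add j3 j4s,
    integral_finsetSum _ fun j _ => j4 j, integral_finsetSum _ fun j _ => j5 j]
  have d1 := h.duhamel_muA i hψ hψc hη
  have d2 : ∑ j, _ = ∑ j, _ := Finset.sum_congr rfl fun j _ => h.duhamel_muB i j hψ hψc hη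
  rw [Finset.sum_add_distrib] at d2
  linarith

end Equations

/-! ### Mollification -/

/-- The mollification `ρ * u`. -/
noncomputable def mol (ρ u : E3 → ℝ) (x : E3) : ℝ := ∫ y, ρ (x - y) * u y

section Mol

variable {ρ u : E3 → ℝ}

lemma mol_eq_convolution (ρ u : E3 → ℝ) :
    mol ρ u = convolution ρ u (ContinuousLinearMap.lsmul ℝ ℝ) volume := by
  funext x
  rw [convolution_lsmul_swap]
  rfl

lemma contDiff_mol (hρ : IsTestFun ρ) (hu : LocallyIntegrable u volume) : ContDiff ℝ ∞ (mol ρ u) := by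
  rw [mol_eq_convolution]
  exact hρ.2.contDiff_convolution_left _ hρ.1 hu

lemma mol_congr {u' : E3 → ℝ} (h : u =ᵐ[volume] u') (ρ : E3 → ℝ) : mol ρ u = mol ρ u' := by
  funext x
  exact integral_congr_ae (h.mono fun y hy => by simp only [hy])

lemma partialD_mol (hρ : IsTestFun ρ) (hu : LocallyIntegrable u volume) (i : Fin 3) :
    partialD i (mol ρ u) = mol (partialD i ρ) u := by
  funext x
  have h := hρ.2.hasFDerivAt_convolution_left (ContinuousLinearMap.lsmul ℝ ℝ)
    (hρ.1.of_le (by simp)) hu x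
  have hex := (hρ.2.fderiv (𝕜 := ℝ)).convolutionExists_left
    ((ContinuousLinearMap.lsmul ℝ ℝ : ℝ →L[ℝ] ℝ →L[ℝ] ℝ).precompL E3)
    (hρ.1.continuous_fderiv (by simp)) hu x
  unfold partialD
  rw [mol_eq_convolution, mol_eq_convolution, h.fderiv, convolution_def, convolution_def,
    ContinuousLinearMap.integral_apply hex]
  rfl

lemma HasWeakPartial.partialD_mol {g : E3 → ℝ} {i : Fin 3} (h : HasWeakPartial i u g)
    (hρ : IsTestFun ρ) : partialD i (mol ρ u) = mol ρ g := by
  rw [_root_.partialD_mol hρ h.1]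
  funext x
  have := h.2.2 _ (hρ.comp_sub_left x)
  simp only [smul_eq_mul, partialD_comp_sub_left, neg_mul, integral_neg] at this
  exact neg_injective this

lemma IsTestFun.isTestFun_mol (hρ : IsTestFun ρ) (hu : IsTestFun u) : IsTestFun (mol ρ u) := by
  refine ⟨contDiff_mol hρ hu.continuous.locallyIntegrable, ?_⟩
  rw [mol_eq_convolution]
  exact hρ.2.convolution _ hu.2

end Mol

/-- The standard mollifiers `ρ_n`, supported in the ball of radius `1/(n+1)`. -/
noncomputable def stdBump (n : ℕ) : ContDiffBump (0 : E3) :=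
  ⟨(1 / (n + 1 : ℝ)) / 2, 1 / (n + 1 : ℝ), by positivity, by
    have : 0 < 1 / (n + 1 : ℝ) := by positivity
    linarith⟩

/-- The standard mollifiers, with integral one. -/
noncomputable def stdMol (n : ℕ) : E3 → ℝ := (stdBump n).normed volume

lemma isTestFun_stdMol (n : ℕ) : IsTestFun (stdMol n) :=
  ⟨(stdBump n).contDiff_normed, (stdBump n).hasCompactSupport_normed⟩

lemma ae_tendsto_mol {u : E3 → ℝ} (hu : LocallyIntegrable u volume) :
    ∀ᵐ x, Tendsto (fun n => mol (stdMol n) u x) atTop (𝓝 (u x)) := by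
  have h := ContDiffBump.ae_convolution_tendsto_right_of_locallyIntegrable (μ := (volume : Measure E3))
    (φ := stdBump) (l := atTop) (K := 2) (g := u) tendsto_one_div_add_atTop_nhds_zero_nat
    (Eventually.of_forall fun n => by simp only [stdBump]; linarith) hu
  filter_upwards [h] with x hx
  simp only [mol_eq_convolution]
  exact hx

lemma abs_mol_stdMol_le {u : E3 → ℝ} {K : ℝ} (hK : 0 ≤ K)
    (hu : ∀ x, |u x| ≤ K * ((1 + ‖x‖) ^ 2)⁻¹) (n : ℕ) (x : E3) :
    |mol (stdMol n) u x| ≤ 4 * K * ((1 + ‖x‖) ^ 2)⁻¹ := by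
  have h0 : ∀ y, 0 ≤ stdMol n y := (stdBump n).nonneg_normed
  have h1 : ∫ y, stdMol n (x - y) = 1 := by
    rw [integral_sub_left_eq_self (fun y => stdMol n y) volume x]
    exact (stdBump n).integral_normed
  have hi : Integrable (fun y => stdMol n (x - y)) := ((isTestFun_stdMol n).comp_sub_left x).integrable
  calc ‖∫ y, stdMol n (x - y) * u y‖ ≤ ∫ y, stdMol n (x - y) * (4 * K * ((1 + ‖x‖) ^ 2)⁻¹) := by
        refine norm_integral_le_of_norm_le (hi.mul_const _) (Eventually.of_forall fun y => ?_)
        rw [norm_mul, Real.norm_of_nonneg (h0 _), Real.norm_eq_abs]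
        by_cases hy : stdMol n (x - y) = 0
        · simp [hy]
        refine mul_le_mul_of_nonneg_left ((hu y).trans ?_) (h0 _)
        have hs : x - y ∈ Metric.ball (0 : E3) (1 / (n + 1 : ℝ)) := by
          have : x - y ∈ Function.support (stdMol n) := hy
          rwa [stdMol, (stdBump n).support_normed_eq] at this
        have h3 : ‖x - y‖ ≤ 1 := by
          rw [mem_ball_zero_iff] at hs
          refine hs.le.trans ?_
          rw [div_le_one (by positivity)]
          linarith [(Nat.cast_nonneg n : (0 : ℝ) ≤ n)]
        have h4 : 1 + ‖x‖ ≤ 2 * (1 + ‖y‖) := by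
          have := norm_add_le (x - y) y
          rw [sub_add_cancel] at this
          linarith [norm_nonneg y]
        calc K * ((1 + ‖y‖) ^ 2)⁻¹ = K * (4 * ((2 * (1 + ‖y‖)) ^ 2)⁻¹) := by
              have := norm_nonneg y
              field_simp; norm_num
          _ ≤ K * (4 * ((1 + ‖x‖) ^ 2)⁻¹) := by gcongr
          _ = _ := by ring
    _ = _ := by rw [integral_mul_const, h1, one_mul]

/-- Dominated convergence in `L^p`. -/
lemma tendsto_eLpNorm_sub_of_dominated {F : ℕ → E3 → ℝ} {u b : E3 → ℝ} {p : ℝ≥0∞} (hp0 : p ≠ 0)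
    (hp : p ≠ ⊤) (hF : ∀ n, AEStronglyMeasurable (F n) volume) (hu : MemLp u p volume)
    (hb : MemLp b p volume) (hbd : ∀ n x, |F n x| ≤ b x)
    (hlim : ∀ᵐ x, Tendsto (fun n => F n x) atTop (𝓝 (u x))) :
    Tendsto (fun n => eLpNorm (fun x => F n x - u x) p volume) atTop (𝓝 0) := by
  have hpp : 0 < p.toReal := ENNReal.toReal_pos hp0 hp
  have hd : MemLp (fun x => |b x| + |u x|) p volume := hb.norm.add hu.norm
  have key : Tendsto (fun n => ∫⁻ x, ‖F n x - u x‖ₑ ^ p.toReal) atTop (𝓝 (∫⁻ _ : E3, 0)) := by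
    refine tendsto_lintegral_of_dominated_convergence' (fun x => ‖|b x| + |u x|‖ₑ ^ p.toReal)
      (fun n => ((hF n).sub hu.1).enorm.pow_const _) (fun n => Eventually.of_forall fun x => ?_) ?_ ?_
    · refine ENNReal.rpow_le_rpow ?_ hpp.le
      rw [enorm_le_iff_norm_le, Real.norm_of_nonneg (by positivity : 0 ≤ |b x| + |u x|)]
      exact (norm_sub_le _ _).trans (add_le_add_left ((hbd n x).trans (le_abs_self _)) _)
    · exact ((eLpNorm_lt_top_iff_lintegral_rpow_enorm_lt_top hp0 hp).1 hd.2).ne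
    · filter_upwards [hlim] with x hx
      have h1 : Tendsto (fun n => ‖F n x - u x‖ₑ) atTop (𝓝 0) := by
        have := (hx.sub_const (u x)).enorm
        simpa using this
      have := (ENNReal.continuous_rpow_const (y := p.toReal)).tendsto 0 |>.comp h1
      simpa [Function.comp_def, ENNReal.zero_rpow_of_pos hpp] using this
  simp only [eLpNorm_eq_lintegral_rpow_enorm_toReal hp0 hp]
  rw [lintegral_zero] at key
  have := (ENNReal.continuous_rpow_const (y := 1 / p.toReal)).tendsto 0 |>.comp key
  rwa [ENNReal.zero_rpow_of_pos (by positivity)] at this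

/-- Cut-off functions that exhaust `ℝ³`. -/
lemma exists_exhausting_cutoff : ∃ (C : ℝ) (χ : ℕ → E3 → ℝ), 0 ≤ C ∧ (∀ n, IsTestFun (χ n)) ∧
    (∀ n x, |χ n x| ≤ C) ∧ (∀ n i x, |partialD i (χ n) x| ≤ C) ∧
    ∀ x, ∀ᶠ n in atTop, χ n x = 1 ∧ ∀ i, partialD i (χ n) x = 0 := by
  let θ : ContDiffBump (0 : E3) := ⟨1, 2, by norm_num, by norm_num⟩
  have hθ : IsTestFun θ := ⟨θ.contDiff, θ.hasCompactSupport⟩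
  obtain ⟨M, hM0, hM⟩ := hθ.exists_bound
  choose M' hM'0 hM' using fun i => (hθ.partialD i).exists_bound
  let r : ℕ → ℝ := fun n => (n + 1 : ℝ)⁻¹
  have hr : ∀ n, 0 < r n := fun n => by positivity
  have hr1 : ∀ n, r n ≤ 1 := fun n => inv_le_one_of_one_le₀ (by linarith [(Nat.cast_nonneg n : (0 : ℝ) ≤ n)])
  have hS : 0 ≤ ∑ i, M' i := Finset.sum_nonneg fun i _ => hM'0 i
  have hp : ∀ n i x, partialD i (fun x => θ (r n • x)) x = r n * partialD i θ (r n • x) := by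
    intro n i x
    unfold partialD
    have := fderiv_comp_smul (𝕜 := ℝ) (f := (θ : E3 → ℝ)) (x := x) (r n)
    rw [this]; simp
  refine ⟨M + ∑ i, M' i, fun n x => θ (r n • x), by positivity, fun n => ⟨?_, ?_⟩, fun n x => ?_,
    fun n i x => ?_, fun x => ?_⟩
  · exact hθ.1.comp (contDiff_const_smul (r n))
  · exact hθ.2.comp_homeomorph (Homeomorph.smulOfNeZero (r n) (hr n).ne')
  · exact (hM _).trans (le_add_of_nonneg_right hS)
  · rw [hp, abs_mul, abs_of_pos (hr n)]
    have h1 : |partialD i θ (r n • x)| ≤ M' i := hM' i _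
    have h2 : M' i ≤ ∑ i, M' i := Finset.single_le_sum (fun j _ => hM'0 j) (Finset.mem_univ i)
    have := mul_le_mul (hr1 n) h1 (abs_nonneg _) zero_le_one
    linarith
  · have hlim : Tendsto (fun n => r n • x) atTop (𝓝 0) := by
      have h1 : Tendsto r atTop (𝓝 0) := by
        have := tendsto_one_div_add_atTop_nhds_zero_nat (𝕜 := ℝ)
        simpa [r] using this
      simpa using h1.smul_const x
    have hev : (θ : E3 → ℝ) =ᶠ[𝓝 0] fun _ => 1 := θ.eventuallyEq_one
    filter_upwards [hlim.eventually hev.eventuallyEq_nhds] with n hn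
    refine ⟨hn.self_of_nhds, fun i => ?_⟩
    rw [hp]
    unfold partialD
    rw [hn.fderiv_eq]
    simp

/-- Functions that decay, together with their gradient, like `|x|^{-2}` belong to `D₀^{1,2}`. -/
theorem isD012_of_bound {q : E3 → ℝ} {g : Fin 3 → E3 → ℝ} {K : ℝ}
    (hq : ∀ x, |q x| ≤ K * ((1 + ‖x‖) ^ 2)⁻¹) (hg : ∀ i x, |g i x| ≤ K * ((1 + ‖x‖) ^ 2)⁻¹)
    (h : ∀ i, HasWeakPartial i q (g i)) : IsD012 q g := by
  have hK : 0 ≤ K := by simpa using (abs_nonneg _).trans (hq 0)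
  have hq6 : MemLp q 6 volume := (memLp_weight_six.const_mul K).mono' (h 0).1.aestronglyMeasurable
    (Eventually.of_forall hq)
  have hg2 : ∀ i, MemLp (g i) 2 volume := fun i => (memLp_weight.const_mul K).mono'
    (h i).2.1.aestronglyMeasurable (Eventually.of_forall (hg i))
  obtain ⟨C, χ, hC, hχ, hχb, hχd, hχl⟩ := exists_exhausting_cutoff
  have hmol := fun n => contDiff_mol (isTestFun_stdMol n) (h 0).1
  have ht : ∀ n, IsTestFun (fun x => mol (stdMol n) q x * χ n x) := fun n => (hχ n).mul_left (hmol n)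
  have hpd : ∀ n i x, partialD i (fun x => mol (stdMol n) q x * χ n x) x =
      mol (stdMol n) (g i) x * χ n x + mol (stdMol n) q x * partialD i (χ n) x := by
    intro n i x
    rw [partialD_mul i (hmol n) (hχ n).1, (h i).partialD_mol (isTestFun_stdMol n)]
  refine ⟨hq6, hg2, fun n x => mol (stdMol n) q x * χ n x, ht, ?_, fun i => ?_⟩
  · refine tendsto_eLpNorm_sub_of_dominated (by norm_num) (by norm_num)
      (fun n => (ht n).continuous.aestronglyMeasurable) hq6 (memLp_weight_six.const_mul (4 * K * C))
      (fun n x => ?_) ?_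
    · rw [abs_mul]
      have := mul_le_mul (abs_mol_stdMol_le hK hq n x) (hχb n x) (abs_nonneg _) (by positivity)
      linarith
    · filter_upwards [ae_tendsto_mol (h 0).1] with x hx
      refine hx.congr' ?_
      filter_upwards [hχl x] with n hn
      rw [hn.1, mul_one]
  · refine tendsto_eLpNorm_sub_of_dominated (by norm_num) (by norm_num)
      (fun n => ((ht n).partialD i).continuous.aestronglyMeasurable) (hg2 i)
      (memLp_weight.const_mul (8 * K * C)) (fun n x => ?_) ?_
    · rw [hpd]
      refine (abs_add_le _ _).trans ?_
      rw [abs_mul, abs_mul]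
      have h1 := mul_le_mul (abs_mol_stdMol_le hK (hg i) n x) (hχb n x) (abs_nonneg _) (by positivity)
      have h2 := mul_le_mul (abs_mol_stdMol_le hK hq n x) (hχd n i x) (abs_nonneg _) (by positivity)
      linarith
    · filter_upwards [ae_tendsto_mol (h i).2.1] with x hx
      refine hx.congr' ?_
      filter_upwards [hχl x] with n hn
      rw [hpd, hn.1, hn.2 i, mul_one, mul_zero, add_zero]

/-! ### Existence -/

/-- The decay of velocity, pressure and their derivatives. -/
structure StokesBounds (K : ℝ) (f : Fin 3 → ℝ → E3 → ℝ) (Df : Fin 3 → Fin 3 → ℝ → E3 → ℝ) : Prop where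
  vel : ∀ i t x, |vel [] i f t x| ≤ K * ((1 + ‖x‖) ^ 1)⁻¹
  grad_vel : ∀ k i t x, |_root_.vel [k] i f t x| ≤ K * ((1 + ‖x‖) ^ 2)⁻¹
  hess_vel : ∀ l k i t x, |_root_.vel [k] i (Df l) t x| ≤ K * ((1 + ‖x‖) ^ 3)⁻¹
  prs : ∀ t x, |prs f t x| ≤ K * ((1 + ‖x‖) ^ 2)⁻¹
  grad_prs : ∀ l t x, |_root_.prs (Df l) t x| ≤ K * ((1 + ‖x‖) ^ 3)⁻¹

theorem exists_stokesBounds : ∃ C : ℝ, 0 < C ∧ ∀ (B : ℝ) (f : Fin 3 → ℝ → E3 → ℝ)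
    (Df : Fin 3 → Fin 3 → ℝ → E3 → ℝ), StokesData B f Df → StokesBounds (C * B) f Df := by
  obtain ⟨C₁, p₁, h₁⟩ := exists_abs_vel_le 0 1 zero_le_one le_rfl
  obtain ⟨C₂, p₂, h₂⟩ := exists_abs_vel_le 1 1 le_rfl le_rfl
  obtain ⟨C₃, p₃, h₃⟩ := exists_abs_vel_le 1 2 le_rfl one_le_two
  obtain ⟨C₄, p₄, h₄⟩ := exists_abs_prs_le 1 le_rfl
  obtain ⟨C₅, p₅, h₅⟩ := exists_abs_prs_le 2 one_le_two
  refine ⟨C₁ + C₂ + C₃ + C₄ + C₅, by positivity, fun B f Df h => ?_⟩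
  have hB := h.nonneg
  have mono : ∀ {C' : ℝ} (k : ℕ) (x : E3), C' ≤ C₁ + C₂ + C₃ + C₄ + C₅ →
      C' * B * ((1 + ‖x‖) ^ k)⁻¹ ≤ (C₁ + C₂ + C₃ + C₄ + C₅) * B * ((1 + ‖x‖) ^ k)⁻¹ := by
    intro C' k x hC
    gcongr
  exact ⟨fun i t x => (h₁ [] rfl i B f hB h.data t x).trans (mono _ x (by linarith)),
    fun k i t x => (h₂ [k] rfl i B f hB h.data t x).trans (mono _ x (by linarith)),
    fun l k i t x => (h₃ [k] rfl i B (Df l) hB (h.grad l) t x).trans (mono _ x (by linarith)),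
    fun t x => (h₄ B f hB h.data t x).trans (mono _ x (by linarith)),
    fun l t x => (h₅ B (Df l) hB (h.grad l) t x).trans (mono _ x (by linarith))⟩

/-- A vector field with given components. -/
noncomputable def ofComp (u : Fin 3 → ℝ → E3 → ℝ) (t : ℝ) (x : E3) : E3 :=
  WithLp.toLp 2 fun i => u i t x

lemma measurable_ofComp {u : Fin 3 → ℝ → E3 → ℝ} (hu : ∀ i, Measurable (Function.uncurry (u i))) :
    Measurable (Function.uncurry (ofComp u)) :=
  (PiLp.continuous_toLp 2 (fun _ : Fin 3 => ℝ)).measurable.comp (measurable_pi_lambda _ hu)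

lemma norm_le_of_abs_apply_le {v : E3} {K : ℝ} (h : ∀ i, |v i| ≤ K) : ‖v‖ ≤ 2 * K := by
  have hK : 0 ≤ K := (abs_nonneg _).trans (h 0)
  rw [EuclideanSpace.norm_eq, Real.sqrt_le_left (by positivity)]
  calc ∑ i, ‖v i‖ ^ 2 ≤ ∑ _i : Fin 3, K ^ 2 := by
        gcongr with i
        exact h i
    _ ≤ (2 * K) ^ 2 := by simp; nlinarith

lemma inv_pow_one_add_norm_anti (x : E3) {k m : ℕ} (h : k ≤ m) :
    ((1 + ‖x‖) ^ m)⁻¹ ≤ ((1 + ‖x‖) ^ k)⁻¹ := by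
  have := norm_nonneg x
  gcongr
  linarith

lemma inv_pow_one_add_norm_le_one (x : E3) (k : ℕ) : ((1 + ‖x‖) ^ k)⁻¹ ≤ 1 :=
  inv_le_one_of_one_le₀ (one_le_pow₀ (by linarith [norm_nonneg x]))

section Existence

variable {B : ℝ} {f : Fin 3 → ℝ → E3 → ℝ} {Df : Fin 3 → Fin 3 → ℝ → E3 → ℝ}

lemma hasWeakGrad_ofComp (I : Set ℝ) {u : Fin 3 → ℝ → E3 → ℝ} {Du : Fin 3 → Fin 3 → ℝ → E3 → ℝ}
    (hm : ∀ k i, Measurable (Function.uncurry (Du k i)))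
    (h : ∀ k i t, HasWeakPartial k (u i t) (Du k i t)) :
    HasWeakGrad I (ofComp u) (fun k => ofComp (Du k)) :=
  ⟨fun k => (measurable_ofComp (hm k)).aestronglyMeasurable,
    Eventually.of_forall fun t k => HasWeakPartial.of_apply fun i => h k i t⟩

lemma memL2L2_ofComp {τ K : ℝ} {u : Fin 3 → ℝ → E3 → ℝ}
    (hm : ∀ i, Measurable (Function.uncurry (u i)))
    (h : ∀ i, ∀ t ∈ Ioo 0 τ, ∀ x, |u i t x| ≤ K * ((1 + ‖x‖) ^ 2)⁻¹) : MemL2L2 τ (ofComp u) := by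
  refine memL2L2_of_bound (K := 2 * K) (measurable_ofComp hm).aestronglyMeasurable fun t ht x => ?_
  rw [mul_assoc]
  exact norm_le_of_abs_apply_le fun i => h i t ht x

/-- The time derivative of the velocity. -/
noncomputable def velT (f : Fin 3 → ℝ → E3 → ℝ) (Df : Fin 3 → Fin 3 → ℝ → E3 → ℝ) (i : Fin 3) (t : ℝ)
    (x : E3) : ℝ :=
  (∑ k, vel [k] i (Df k) t x) - prs (Df i) t x + f i t x

/-- Velocity and pressure solve the Cauchy problem. -/
theorem StokesData.solvesStokes (h : StokesData B f Df) {F : ℝ → E3 → E3}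
    (hF : ∀ᵐ p ∂(stMeasure (Ioi 0)), ∀ i, F p.1 p.2 i = f i p.1 p.2) :
    SolvesStokes F (ofComp fun i => vel [] i f) (prs f) := by
  obtain ⟨C, hC, hb⟩ := exists_stokesBounds
  replace hb := hb B f Df h
  obtain ⟨C', hC', hb'⟩ := exists_abs_vel_le_sqrt
  have hB := h.nonneg
  set K := C * B with hKdef
  have hK : 0 ≤ K := by positivity
  have mf := fun j => (h.data j).meas
  have mD := fun l j => (h.grad l j).meas
  have mv := fun i => measurable_vel [] i mf
  have mDv := fun k i => measurable_vel [k] i mf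
  have mD2v := fun l k i => measurable_vel [k] i (mD l)
  have mp := measurable_prs mf
  have mDp := fun l => measurable_prs (mD l)
  have mT : ∀ i, Measurable (Function.uncurry (velT f Df i)) := fun i =>
    ((Finset.measurable_fun_sum _ fun k _ => mD2v k k i).sub (mDp i)).add (mf i)
  have bT : ∀ i t x, |velT f Df i t x| ≤ (4 * K + B) * ((1 + ‖x‖) ^ 3)⁻¹ := by
    intro i t x
    refine (abs_add_le _ _).trans ?_
    rw [add_mul]
    refine add_le_add ((abs_sub _ _).trans ?_) ((h.isBdd i).bound t x)
    have h1 := (Finset.abs_sum_le_sum_abs (fun k => vel [k] i (Df k) t x) Finset.univ).trans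
      (Finset.sum_le_sum fun k _ => hb.hess_vel k k i t x)
    have h2 := hb.grad_prs i t x
    simp only [Finset.sum_const, Finset.card_univ, Fintype.card_fin, nsmul_eq_mul, Nat.cast_ofNat] at h1
    linarith
  have hvt : ∀ I : Set ℝ, HasWeakTimeDeriv I (ofComp fun i => vel [] i f) (ofComp (velT f Df)) := by
    intro I
    refine HasWeakTimeDeriv.of_test (M := 4 * K + B) mv mT (fun i t x => ?_) (fun i t x => ?_)
      (fun i ψ η hψ hψc hη => h.momentum i hψ hψc hη) I
    · refine (hb.vel i t x).trans ((mul_le_of_le_one_right hK (inv_pow_one_add_norm_le_one x 1)).trans ?_)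
      linarith
    · exact (bT i t x).trans (mul_le_of_le_one_right (by positivity) (inv_pow_one_add_norm_le_one x 3))
  -- the bound `|v| ≤ C (1 + |x|)^{-1}` is not square integrable; the one for short times is
  have hv2 : ∀ τ : ℝ, 0 < τ → MemL2L2 τ (ofComp fun i => vel [] i f) := by
    intro τ hτ
    refine memL2L2_ofComp (K := C' * √τ * B) mv fun i t ht x => ?_
    refine (hb' i B f hB h.data t ht.1.le x).trans ?_
    have := ht.2.le
    gcongr
  have hgv : ∀ I : Set ℝ, HasWeakGrad I (ofComp fun i => vel [] i f) (fun k => ofComp fun i => vel [k] i f) :=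
    fun I => hasWeakGrad_ofComp I mDv fun k i t => h.hasWeakPartial_vel k i t
  have hgDv : ∀ (I : Set ℝ) (k : Fin 3), HasWeakGrad I (ofComp fun i => vel [k] i f)
      (fun l => ofComp fun i => vel [k] i (Df l)) :=
    fun I k => hasWeakGrad_ofComp I (fun l i => mD2v l k i)
      fun l i t => h.hasWeakPartial_vel_grad l k i t
  have h32 : ∀ {c : ℝ} (x : E3), 0 ≤ c → c * ((1 + ‖x‖) ^ 3)⁻¹ ≤ c * ((1 + ‖x‖) ^ 2)⁻¹ :=
    fun x hc => mul_le_mul_of_nonneg_left (inv_pow_one_add_norm_anti x (by norm_num)) hc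
  refine ⟨fun τ hτ => ⟨hv2 τ hτ, _, ?_, hvt _⟩, fun τ hτ => ⟨hv2 τ hτ, _, _, fun k => ?_, fun k l => ?_,
    hgv _, hgDv _⟩, fun τ _ => ⟨mp.aestronglyMeasurable, fun l => prs (Df l), fun l => ?_,
      Eventually.of_forall fun t => ?_⟩, ⟨_, _, _, fun l => prs (Df l), hvt _, hgv _, hgDv _,
      ⟨fun l => (mDp l).aestronglyMeasurable, Eventually.of_forall fun t l => h.hasWeakPartial_prs l t⟩, ?_, ?_⟩, ?_⟩
  · exact memL2L2_ofComp mT fun i t _ x => (bT i t x).trans (h32 x (by positivity))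
  · exact memL2L2_ofComp (mDv k) fun i t _ x => hb.grad_vel k i t x
  · exact memL2L2_ofComp (mD2v l k) fun i t _ x => (hb.hess_vel l k i t x).trans (h32 x hK)
  · exact memL2L2_of_bound (mDp l).aestronglyMeasurable
      fun t _ x => (hb.grad_prs l t x).trans (h32 x hK)
  · exact isD012_of_bound (hb.prs t) (fun l x => (hb.grad_prs l t x).trans (h32 x hK))
      fun l => h.hasWeakPartial_prs l t
  · filter_upwards [hF] with p hp i
    rw [hp i]
    rfl
  · have hm : Measurable (fun p : ℝ × E3 => ∑ i, vel [i] i f p.1 p.2) :=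
      Finset.measurable_fun_sum _ fun i _ => mDv i i
    refine (Measure.ae_prod_iff_ae_ae (measurableSet_eq_fun hm measurable_const)).2 ?_
    exact Eventually.of_forall fun t => h.divergence t
  · -- the short-time decay of the velocity gives the initial value
    have hlim : Tendsto (fun t : ℝ => eLpNorm (fun x : E3 => 2 * (C' * √t * B) * ((1 + ‖x‖) ^ 2)⁻¹) 2 volume)
        (𝓝 0) (𝓝 0) := by
      have e : ∀ t : ℝ, eLpNorm (fun x : E3 => 2 * (C' * √t * B) * ((1 + ‖x‖) ^ 2)⁻¹) 2 volume =
          ‖2 * (C' * √t * B)‖ₑ * eLpNorm (fun x : E3 => ((1 + ‖x‖) ^ 2)⁻¹) 2 volume := fun t =>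
        eLpNorm_const_smul (2 * (C' * √t * B)) (fun x : E3 => ((1 + ‖x‖) ^ 2)⁻¹) 2 volume
      simp only [e]
      have h1 : Tendsto (fun t : ℝ => ‖2 * (C' * √t * B)‖ₑ) (𝓝 0) (𝓝 0) := by
        have : Continuous (fun t : ℝ => ‖2 * (C' * √t * B)‖ₑ) := by fun_prop
        simpa using this.tendsto 0
      simpa using ENNReal.Tendsto.mul_const h1 (Or.inr memLp_weight.2.ne)
    refine tendsto_of_tendsto_of_tendsto_of_le_of_le' tendsto_const_nhds (hlim.mono_left inf_le_left)
      (Eventually.of_forall fun _ => zero_le) ?_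
    have : ∀ᵐ t ∂((volume : Measure ℝ).restrict (Ioi 0)), 0 < t := ae_restrict_mem measurableSet_Ioi
    filter_upwards [this.filter_mono inf_le_right] with t ht
    refine eLpNorm_mono_real fun x => ?_
    rw [mul_assoc]
    exact norm_le_of_abs_apply_le fun i => hb' i B f hB h.data t ht.le x

end Existence

/-! ### Mollification in `L²` and the spatial energy inequality -/

section Holder

variable {X : Type*} [MeasurableSpace X] {μ : Measure X}

lemma sq_lintegral_mul_le {f g : X → ℝ≥0∞} (hf : AEMeasurable f μ) (hg : AEMeasurable g μ) :
    (∫⁻ x, f x * g x ∂μ) ^ 2 ≤ (∫⁻ x, f x ∂μ) * ∫⁻ x, f x * g x ^ 2 ∂μ := by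
  have h2 : ∀ z : ℝ≥0∞, (z ^ (1 / 2 : ℝ)) ^ 2 = z := fun z => by
    rw [← ENNReal.rpow_natCast, ← ENNReal.rpow_mul]; norm_num
  have h := ENNReal.lintegral_mul_le_Lp_mul_Lq μ Real.HolderConjugate.two_two
    (hf.pow_const (1 / 2 : ℝ)) ((hf.pow_const (1 / 2 : ℝ)).mul hg)
  have e1 : ∀ x, ((fun x => f x ^ (1 / 2 : ℝ)) * fun x => f x ^ (1 / 2 : ℝ) * g x) x = f x * g x := by
    intro x
    simp only [Pi.mul_apply]
    rw [← mul_assoc, ← sq, h2]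
  simp only [Pi.mul_def] at h
  simp_rw [← mul_assoc, ← sq, h2, ENNReal.rpow_two, mul_pow, h2] at h
  calc (∫⁻ x, f x * g x ∂μ) ^ 2
      ≤ ((∫⁻ x, f x ∂μ) ^ (1 / 2 : ℝ) * (∫⁻ x, f x * g x ^ 2 ∂μ) ^ (1 / 2 : ℝ)) ^ 2 := by gcongr
    _ = _ := by rw [mul_pow, h2, h2]

lemma eLpNorm_two_sq {F : Type*} [NormedAddCommGroup F] (u : X → F) :
    eLpNorm u 2 μ ^ 2 = ∫⁻ x, ‖u x‖ₑ ^ 2 ∂μ := by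
  rw [eLpNorm_eq_lintegral_rpow_enorm_toReal (by norm_num) (by norm_num)]
  simp only [ENNReal.toReal_ofNat, ENNReal.rpow_two]
  rw [← ENNReal.rpow_natCast, ← ENNReal.rpow_mul]
  norm_num

lemma memLp_two_iff_lintegral {F : Type*} [NormedAddCommGroup F] {u : X → F}
    (hu : AEStronglyMeasurable u μ) : MemLp u 2 μ ↔ ∫⁻ x, ‖u x‖ₑ ^ 2 ∂μ < ⊤ := by
  rw [← eLpNorm_two_sq, MemLp, and_iff_right hu]
  simp [lt_top_iff_ne_top]

lemma enorm_integral_mul_le {p q : ℝ} (hpq : p.HolderConjugate q) {f g : X → ℝ}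
    (hf : AEStronglyMeasurable f μ) (hg : AEStronglyMeasurable g μ) :
    ‖∫ x, f x * g x ∂μ‖ₑ ≤ eLpNorm f (ENNReal.ofReal p) μ * eLpNorm g (ENNReal.ofReal q) μ := by
  refine (enorm_integral_le_lintegral_enorm _).trans ?_
  simp_rw [enorm_mul]
  have h := ENNReal.lintegral_mul_le_Lp_mul_Lq μ hpq hf.enorm hg.enorm
  rw [eLpNorm_eq_lintegral_rpow_enorm_toReal (by simpa using hpq.pos) ENNReal.ofReal_ne_top,
    eLpNorm_eq_lintegral_rpow_enorm_toReal (by simpa using hpq.symm.pos) ENNReal.ofReal_ne_top,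
    ENNReal.toReal_ofReal hpq.nonneg, ENNReal.toReal_ofReal hpq.symm.nonneg]
  exact h

/-- The pairing with a fixed function is continuous for strong convergence. -/
lemma tendsto_integral_mul {p q : ℝ} (hpq : p.HolderConjugate q) {a u : X → ℝ} {F : ℕ → X → ℝ}
    (ha : MemLp a (ENNReal.ofReal p) μ) (hu : AEStronglyMeasurable u μ)
    (hF : ∀ n, AEStronglyMeasurable (F n) μ)
    (hau : Integrable (fun x => a x * u x) μ) (haF : ∀ n, Integrable (fun x => a x * F n x) μ)
    (h : Tendsto (fun n => eLpNorm (fun x => F n x - u x) (ENNReal.ofReal q) μ) atTop (𝓝 0)) :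
    Tendsto (fun n => ∫ x, a x * F n x ∂μ) atTop (𝓝 (∫ x, a x * u x ∂μ)) := by
  rw [tendsto_iff_enorm_sub_tendsto_zero]
  have h1 := ENNReal.Tendsto.const_mul h (Or.inr ha.2.ne)
  rw [mul_zero] at h1
  refine tendsto_of_tendsto_of_tendsto_of_le_of_le tendsto_const_nhds h1 (fun _ => zero_le) fun n => ?_
  simp only
  rw [← integral_sub (haF n) hau]
  simp_rw [← mul_sub]
  exact enorm_integral_mul_le hpq ha.1 ((hF n).sub hu)

end Holder

lemma IsTestFun.memLp {η : E3 → ℝ} (hη : IsTestFun η) (p : ℝ≥0∞) : MemLp η p volume :=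
  hη.continuous.memLp_of_hasCompactSupport hη.2

/-- Elements of `D₀^{1,2}` are weakly differentiable. -/
lemma IsD012.hasWeakPartial {q : E3 → ℝ} {g : Fin 3 → E3 → ℝ} (h : IsD012 q g) (i : Fin 3) :
    HasWeakPartial i q (g i) := by
  obtain ⟨hq, hg, η, hη, hlim, hlim'⟩ := h
  have lq : LocallyIntegrable q volume := hq.locallyIntegrable (by norm_num)
  have lg : LocallyIntegrable (g i) volume := (hg i).locallyIntegrable (by norm_num)
  refine ⟨lq, lg, fun θ hθ => ?_⟩
  simp only [smul_eq_mul]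
  have h6 : (ENNReal.ofReal 6) = 6 := by norm_num
  have h2 : (ENNReal.ofReal 2) = 2 := by norm_num
  -- integration by parts passes to the limit, in `L⁶` against `L^{6/5}` and in `L²` against `L²`
  have t1 := tendsto_integral_mul (p := 6 / 5) (q := 6) (a := partialD i θ) (u := q) (F := η)
    (μ := volume) (Real.holderConjugate_iff.2 ⟨by norm_num, by norm_num⟩) ((hθ.partialD i).memLp _)
    hq.1 (fun n => (hη n).continuous.aestronglyMeasurable) ((hθ.partialD i).integrable_mul lq)
    (fun n => ((hθ.partialD i).integrable_mul (hη n).continuous.locallyIntegrable)) (by rw [h6]; exact hlim)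
  have t2 := tendsto_integral_mul (p := 2) (q := 2) (a := θ) (u := g i)
    (F := fun n => partialD i (η n)) (μ := volume) Real.HolderConjugate.two_two (hθ.memLp _)
    (hg i).1 (fun n => ((hη n).partialD i).continuous.aestronglyMeasurable) (hθ.integrable_mul lg)
    (fun n => (hθ.integrable_mul ((hη n).partialD i).continuous.locallyIntegrable))
    (by rw [h2]; exact hlim' i)
  have e : ∀ n, ∫ x, partialD i θ x * η n x = -∫ x, θ x * partialD i (η n) x :=
    fun n => integral_partialD_mul i hθ (hη n).1
  simp only [e] at t1
  exact tendsto_nhds_unique t1 t2.neg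

lemma IsD012.sub {q q' : E3 → ℝ} {g g' : Fin 3 → E3 → ℝ} (h : IsD012 q g) (h' : IsD012 q' g') :
    IsD012 (fun x => q x - q' x) (fun i x => g i x - g' i x) := by
  obtain ⟨hq, hg, η, hη, hlim, hlim'⟩ := h
  obtain ⟨kq, kg, θ, hθ, klim, klim'⟩ := h'
  refine ⟨hq.sub kq, fun i => (hg i).sub (kg i), fun n x => η n x - θ n x,
    fun n => (hη n).sub (hθ n), ?_, fun i => ?_⟩
  · have := hlim.add klim
    rw [add_zero] at this
    refine tendsto_of_tendsto_of_tendsto_of_le_of_le tendsto_const_nhds this (fun _ => zero_le) fun n => ?_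
    have e : (fun x => η n x - θ n x - (q x - q' x)) = (fun x => η n x - q x) - fun x => θ n x - q' x := by
      funext x; simp only [Pi.sub_apply]; ring
    simp only [e]
    exact eLpNorm_sub_le ((hη n).continuous.aestronglyMeasurable.sub hq.1)
      ((hθ n).continuous.aestronglyMeasurable.sub kq.1) (by norm_num)
  · have := (hlim' i).add (klim' i)
    rw [add_zero] at this
    refine tendsto_of_tendsto_of_tendsto_of_le_of_le tendsto_const_nhds this (fun _ => zero_le) fun n => ?_
    have e : (fun x => partialD i (fun x => η n x - θ n x) x - (g i x - g' i x)) =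
        (fun x => partialD i (η n) x - g i x) - fun x => partialD i (θ n) x - g' i x := by
      funext x; simp only [Pi.sub_apply, partialD_sub i (hη n).1 (hθ n).1]; ring
    simp only [e]
    exact eLpNorm_sub_le (((hη n).partialD i).continuous.aestronglyMeasurable.sub (hg i).1)
      (((hθ n).partialD i).continuous.aestronglyMeasurable.sub (kg i).1) (by norm_num)

lemma IsD012.congr {q q' : E3 → ℝ} {g g' : Fin 3 → E3 → ℝ} (h : IsD012 q g) (hq : q =ᵐ[volume] q')
    (hg : ∀ i, g i =ᵐ[volume] g' i) : IsD012 q' g' := by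
  obtain ⟨h1, h2, η, hη, hlim, hlim'⟩ := h
  refine ⟨h1.ae_eq hq, fun i => (h2 i).ae_eq (hg i), η, hη, hlim.congr fun n => ?_,
    fun i => (hlim' i).congr fun n => ?_⟩
  · exact eLpNorm_congr_ae (hq.mono fun x hx => by simp only [hx])
  · exact eLpNorm_congr_ae ((hg i).mono fun x hx => by simp only [hx])

/-- An element of `D₀^{1,2}` with zero gradient vanishes, by the Sobolev inequality. -/
lemma IsD012.ae_eq_zero {q : E3 → ℝ} {g : Fin 3 → E3 → ℝ} (h : IsD012 q g)
    (hg : ∀ i, g i =ᵐ[volume] 0) : q =ᵐ[volume] 0 := by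
  obtain ⟨hq, -, η, hη, hlim, hlim'⟩ := h.congr (ae_eq_refl q) hg
  have hsum : Tendsto (fun n => ∑ i, eLpNorm (partialD i (η n)) 2 volume) atTop (𝓝 0) := by
    have := tendsto_finsetSum Finset.univ fun i _ => hlim' i
    simpa using this
  have hb : ∀ n, eLpNorm (η n) 6 volume ≤ SNormLESNormFDerivOfEqConst ℝ (volume : Measure E3) 2 *
      ∑ i, eLpNorm (partialD i (η n)) 2 volume := by
    intro n
    have h1 := eLpNorm_le_eLpNorm_fderiv_of_eq (μ := (volume : Measure E3)) (F := ℝ)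
      ((hη n).1.of_le (by simp)) (hη n).2 (p := 2) (p' := 6) (by norm_num) (by simp) (by simp; norm_num)
    refine h1.trans ?_
    push_cast
    gcongr
    have h2 : ∀ x, ‖fderiv ℝ (η n) x‖ ≤ ‖∑ i, |partialD i (η n) x|‖ := by
      intro x
      rw [Real.norm_of_nonneg (Finset.sum_nonneg fun i _ => abs_nonneg _)]
      refine ContinuousLinearMap.opNorm_le_bound _ (Finset.sum_nonneg fun i _ => abs_nonneg _) fun v => ?_
      have hv : v = ∑ i, v i • stdVec i := by
        ext j
        simp [stdVec, Finset.sum_apply, Pi.single_apply]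
      calc ‖fderiv ℝ (η n) x v‖ = ‖∑ i, v i * partialD i (η n) x‖ := by
            conv_lhs => rw [hv]
            simp only [map_sum, map_smul, smul_eq_mul]
            rfl
        _ ≤ ∑ i, ‖v i * partialD i (η n) x‖ := norm_sum_le _ _
        _ ≤ ∑ i, |partialD i (η n) x| * ‖v‖ := by
            refine Finset.sum_le_sum fun i _ => ?_
            rw [norm_mul, mul_comm]
            exact mul_le_mul_of_nonneg_left (PiLp.norm_apply_le v i) (abs_nonneg _)
        _ = _ := by rw [Finset.sum_mul]
    have e : (fun x => ∑ i, |partialD i (η n) x|) = ∑ i, fun x => |partialD i (η n) x| := by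
      funext x; simp
    calc eLpNorm (fderiv ℝ (η n)) 2 volume ≤ eLpNorm (fun x => ∑ i, |partialD i (η n) x|) 2 volume :=
          eLpNorm_mono h2
      _ ≤ ∑ i, eLpNorm (fun x => |partialD i (η n) x|) 2 volume := by
          rw [e]
          exact eLpNorm_sum_le (fun i _ => ((hη n).partialD i).continuous.abs.aestronglyMeasurable) (by norm_num)
      _ = _ := by
          refine Finset.sum_congr rfl fun i _ => ?_
          exact eLpNorm_norm (partialD i (η n))
  have h0 : Tendsto (fun n => eLpNorm (η n) 6 volume) atTop (𝓝 0) := by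
    have := ENNReal.Tendsto.const_mul (a := (SNormLESNormFDerivOfEqConst ℝ (volume : Measure E3) 2 : ℝ≥0∞))
      hsum (Or.inr ENNReal.coe_ne_top)
    rw [mul_zero] at this
    exact tendsto_of_tendsto_of_tendsto_of_le_of_le tendsto_const_nhds this (fun _ => zero_le) hb
  have hz : eLpNorm q 6 volume ≤ 0 := by
    have := h0.add hlim
    rw [add_zero] at this
    refine ge_of_tendsto this (Eventually.of_forall fun n => ?_)
    have e : q = η n - fun x => η n x - q x := by funext x; simp
    conv_lhs => rw [e]
    exact eLpNorm_sub_le (hη n).continuous.aestronglyMeasurable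
      ((hη n).continuous.aestronglyMeasurable.sub hq.1) (by norm_num)
  exact (eLpNorm_eq_zero_iff hq.1 (by norm_num)).1 (le_antisymm hz zero_le)

section MolLTwo

variable {ρ u v : E3 → ℝ}

lemma IsTestFun.integrable_mol (hρ : IsTestFun ρ) (hu : LocallyIntegrable u volume) (x : E3) :
    Integrable (fun y => ρ (x - y) * u y) := (hρ.comp_sub_left x).integrable_mul hu

lemma mol_sub (hρ : IsTestFun ρ) (hu : LocallyIntegrable u volume) (hv : LocallyIntegrable v volume) :
    mol ρ (fun y => u y - v y) = fun x => mol ρ u x - mol ρ v x := by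
  funext x
  simp only [mol, mul_sub]
  exact integral_sub (hρ.integrable_mol hu x) (hρ.integrable_mol hv x)

lemma mol_sum {ι : Type*} (s : Finset ι) {u : ι → E3 → ℝ} (hρ : IsTestFun ρ)
    (hu : ∀ i, LocallyIntegrable (u i) volume) :
    mol ρ (fun y => ∑ i ∈ s, u i y) = fun x => ∑ i ∈ s, mol ρ (u i) x := by
  funext x
  simp only [mol, Finset.mul_sum]
  exact integral_finsetSum _ fun i _ => hρ.integrable_mol (hu i) x

lemma enorm_mol_sq_le (hρ : IsTestFun ρ) (hu : AEStronglyMeasurable u volume) (x : E3) :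
    ‖mol ρ u x‖ₑ ^ 2 ≤ (∫⁻ y, ‖ρ y‖ₑ) * ∫⁻ y, ‖ρ (x - y)‖ₑ * ‖u y‖ₑ ^ 2 := by
  have h := sq_lintegral_mul_le (μ := volume)
    (hρ.comp_sub_left x).continuous.aestronglyMeasurable.enorm hu.enorm
  rw [lintegral_sub_left_eq_self (fun y => ‖ρ y‖ₑ) x] at h
  refine le_trans ?_ h
  gcongr
  refine (enorm_integral_le_lintegral_enorm _).trans (le_of_eq ?_)
  simp_rw [enorm_mul]

lemma IsTestFun.exists_enorm_mol_le (hρ : IsTestFun ρ) : ∃ M : ℝ≥0∞, M ≠ ⊤ ∧ ∀ u : E3 → ℝ,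
    AEStronglyMeasurable u volume → ∀ x, ‖mol ρ u x‖ₑ ^ 2 ≤ M * eLpNorm u 2 volume ^ 2 := by
  obtain ⟨K, hK, hb⟩ := hρ.exists_bound
  refine ⟨(∫⁻ y, ‖ρ y‖ₑ) * ENNReal.ofReal K, ENNReal.mul_ne_top hρ.integrable.2.ne ENNReal.ofReal_ne_top,
    fun u hu x => (enorm_mol_sq_le hρ hu x).trans ?_⟩
  rw [mul_assoc, eLpNorm_two_sq, ← lintegral_const_mul' _ _ ENNReal.ofReal_ne_top]
  gcongr with y
  rw [← ofReal_norm]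
  exact ENNReal.ofReal_le_ofReal (hb _)

/-- Young's inequality for mollifications in `L²`. -/
lemma lintegral_mol_sq_le (hρ : IsTestFun ρ) (hu : AEStronglyMeasurable u volume) :
    ∫⁻ x, ‖mol ρ u x‖ₑ ^ 2 ≤ (∫⁻ y, ‖ρ y‖ₑ) ^ 2 * ∫⁻ y, ‖u y‖ₑ ^ 2 := by
  have hm : AEMeasurable (fun q : E3 × E3 => ‖ρ (q.1 - q.2)‖ₑ * ‖u q.2‖ₑ ^ 2)
      ((volume : Measure E3).prod volume) := by
    have h1 : Measurable (fun q : E3 × E3 => ‖ρ (q.1 - q.2)‖ₑ) :=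
      (hρ.continuous.measurable.comp (by fun_prop : Measurable fun q : E3 × E3 => q.1 - q.2)).enorm
    exact h1.aemeasurable.mul (hu.comp_snd.enorm.pow_const 2)
  calc ∫⁻ x, ‖mol ρ u x‖ₑ ^ 2
      ≤ ∫⁻ x, (∫⁻ y, ‖ρ y‖ₑ) * ∫⁻ y, ‖ρ (x - y)‖ₑ * ‖u y‖ₑ ^ 2 :=
        lintegral_mono fun x => enorm_mol_sq_le hρ hu x
    _ = (∫⁻ y, ‖ρ y‖ₑ) * ∫⁻ x, ∫⁻ y, ‖ρ (x - y)‖ₑ * ‖u y‖ₑ ^ 2 :=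
        lintegral_const_mul' _ _ hρ.integrable.2.ne
    _ = (∫⁻ y, ‖ρ y‖ₑ) * ∫⁻ y, ∫⁻ x, ‖ρ (x - y)‖ₑ * ‖u y‖ₑ ^ 2 := by
        rw [lintegral_lintegral_swap hm]
    _ = (∫⁻ y, ‖ρ y‖ₑ) * ∫⁻ y, (∫⁻ x, ‖ρ x‖ₑ) * ‖u y‖ₑ ^ 2 := by
        congr 1
        refine lintegral_congr fun y => ?_
        rw [lintegral_mul_const _ (by
          exact (hρ.continuous.measurable.comp (by fun_prop : Measurable fun x : E3 => x - y)).enorm),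
          lintegral_sub_right_eq_self (fun x => ‖ρ x‖ₑ) y]
    _ = _ := by rw [lintegral_const_mul' _ _ hρ.integrable.2.ne]; ring

lemma IsTestFun.eLpNorm_mol_le (hρ : IsTestFun ρ) (hu : AEStronglyMeasurable u volume) :
    eLpNorm (mol ρ u) 2 volume ≤ (∫⁻ y, ‖ρ y‖ₑ) * eLpNorm u 2 volume := by
  have h := lintegral_mol_sq_le hρ hu
  rw [← eLpNorm_two_sq, ← eLpNorm_two_sq, ← mul_pow] at h
  exact (ENNReal.pow_le_pow_left_iff two_ne_zero).1 h

lemma IsTestFun.memLp_mol (hρ : IsTestFun ρ) (hu : MemLp u 2 volume) : MemLp (mol ρ u) 2 volume :=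
  ⟨(contDiff_mol hρ (hu.locallyIntegrable (by norm_num))).continuous.aestronglyMeasurable,
    (hρ.eLpNorm_mol_le hu.1).trans_lt (ENNReal.mul_lt_top hρ.integrable.2 hu.2)⟩

/-- Integration by parts for mollified functions. -/
lemma integral_mol_mul_mol_hess_le {k : Fin 3} {Du D2u : E3 → ℝ} (hρ : IsTestFun ρ)
    (hu : MemLp u 2 volume) (hDu : MemLp Du 2 volume) (hD2u : MemLp D2u 2 volume)
    (h1 : HasWeakPartial k u Du) (h2 : HasWeakPartial k Du D2u) :
    ∫ x, mol ρ u x * mol ρ D2u x ≤ 0 := by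
  have e1 := h1.partialD_mol hρ
  have e2 := h2.partialD_mol hρ
  have m0 := hρ.memLp_mol hu
  have m1 := hρ.memLp_mol hDu
  have m2 := hρ.memLp_mol hD2u
  have d0 := (contDiff_mol hρ h1.1).differentiable (by simp)
  have d1 := (contDiff_mol hρ h1.2.1).differentiable (by simp)
  have f0 : ∀ x, fderiv ℝ (mol ρ u) x (stdVec k) = mol ρ Du x := fun x => congrFun e1 x
  have f1 : ∀ x, fderiv ℝ (mol ρ Du) x (stdVec k) = mol ρ D2u x := fun x => congrFun e2 x
  have := integral_mul_fderiv_eq_neg_fderiv_mul_of_integrable (𝕜 := ℝ) (μ := (volume : Measure E3))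
    (f := mol ρ u) (g := mol ρ Du) (v := stdVec k) (by simp only [f0]; exact m1.integrable_mul m1)
    (by simp only [f1]; exact m0.integrable_mul m2) (m0.integrable_mul m1) (fun x _ => d0 x) (fun x _ => d1 x)
  simp only [f0, f1] at this
  rw [this, neg_nonpos]
  exact integral_nonneg fun x => mul_self_nonneg _

/-- Gradients in `D₀^{1,2}` are orthogonal to divergence free fields. -/
lemma sum_integral_mol_mul_mol_grad_eq_zero {w : Fin 3 → E3 → ℝ} {Dw : Fin 3 → E3 → ℝ} {q : E3 → ℝ}
    {g : Fin 3 → E3 → ℝ} (hρ : IsTestFun ρ) (hw : ∀ h, MemLp (w h) 2 volume)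
    (hp : ∀ h, HasWeakPartial h (w h) (Dw h)) (hdiv : ∀ᵐ x, ∑ h, Dw h x = 0) (hq : IsD012 q g) :
    ∑ h, ∫ x, mol ρ (w h) x * mol ρ (g h) x = 0 := by
  obtain ⟨-, hg, η, hη, -, hlim⟩ := hq
  have ma := fun h => hρ.memLp_mol (hw h)
  have lg := fun h => (hg h).locallyIntegrable (by norm_num)
  have lη := fun n h => ((hη n).partialD h).continuous.locallyIntegrable (μ := (volume : Measure E3))
  have lw := fun h => (hw h).locallyIntegrable (by norm_num)
  have hlim2 : ∀ h, Tendsto (fun n => ∫ x, mol ρ (w h) x * mol ρ (partialD h (η n)) x) atTop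
      (𝓝 (∫ x, mol ρ (w h) x * mol ρ (g h) x)) := by
    intro h
    have h2 : (ENNReal.ofReal 2) = 2 := by norm_num
    refine tendsto_integral_mul (p := 2) (q := 2) Real.HolderConjugate.two_two (by rw [h2]; exact ma h)
      (hρ.memLp_mol (hg h)).1 (fun n => (hρ.memLp_mol (((hη n).partialD h).memLp 2)).1)
      ((ma h).integrable_mul (hρ.memLp_mol (hg h)))
      (fun n => (ma h).integrable_mul (hρ.memLp_mol (((hη n).partialD h).memLp 2))) ?_
    rw [h2]
    have h3 := ENNReal.Tendsto.const_mul (hlim h) (Or.inr hρ.integrable.2.ne) (a := ∫⁻ y, ‖ρ y‖ₑ)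
    rw [mul_zero] at h3
    refine tendsto_of_tendsto_of_tendsto_of_le_of_le tendsto_const_nhds h3 (fun _ => zero_le) fun n => ?_
    simp only
    rw [← mol_sub hρ (lη n h) (lg h)]
    exact hρ.eLpNorm_mol_le ((lη n h).aestronglyMeasurable.sub (hg h).1)
  have hz : ∀ n, ∑ h, ∫ x, mol ρ (w h) x * mol ρ (partialD h (η n)) x = 0 := by
    intro n
    have e : ∀ h, ∫ x, mol ρ (w h) x * mol ρ (partialD h (η n)) x =
        -∫ x, mol ρ (η n) x * mol ρ (Dw h) x := by
      intro h
      have hc : partialD h (mol ρ (η n)) = mol ρ (partialD h (η n)) :=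
        HasWeakPartial.partialD_mol ⟨(hη n).continuous.locallyIntegrable, lη n h, fun θ hθ => by
          simpa using integral_partialD_mul h hθ (hη n).1⟩ hρ
      have := integral_partialD_mul h (hρ.isTestFun_mol (hη n)) (contDiff_mol hρ (lw h))
      rw [hc, (hp h).partialD_mol hρ] at this
      rw [← this]
      simp_rw [mul_comm]
    simp only [e]
    rw [Finset.sum_neg_distrib, neg_eq_zero, ← integral_finsetSum _ fun h _ =>
      (hρ.isTestFun_mol (hη n)).integrable_mul (contDiff_mol hρ (hp h).2.1).continuous.locallyIntegrable]
    have hs := mol_sum Finset.univ hρ (fun h => (hp h).2.1)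
    have h0 : mol ρ (fun y => ∑ h, Dw h y) = fun _ => 0 := by
      rw [mol_congr (u' := fun _ => 0) hdiv]
      funext x; simp [mol]
    rw [h0] at hs
    simp_rw [← Finset.mul_sum, ← congrFun hs]
    simp
  have := tendsto_finsetSum Finset.univ fun h _ => hlim2 h
  simp only [hz] at this
  exact (tendsto_nhds_unique this tendsto_const_nhds)

/-- The spatial energy inequality for the mollified homogeneous Stokes system. -/
theorem sum_integral_mol_le_zero {w : Fin 3 → E3 → ℝ} {Dw D2w : Fin 3 → Fin 3 → E3 → ℝ} {q : E3 → ℝ}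
    {g : Fin 3 → E3 → ℝ} (hρ : IsTestFun ρ) (hw : ∀ h, MemLp (w h) 2 volume)
    (hDw : ∀ k h, MemLp (Dw k h) 2 volume) (hD2w : ∀ k h, MemLp (D2w k h) 2 volume)
    (h1 : ∀ k h, HasWeakPartial k (w h) (Dw k h)) (h2 : ∀ k h, HasWeakPartial k (Dw k h) (D2w k h))
    (hdiv : ∀ᵐ x, ∑ h, Dw h h x = 0) (hq : IsD012 q g) :
    ∑ h, ∫ x, mol ρ (w h) x * mol ρ (fun y => (∑ k, D2w k h y) - g h y) x ≤ 0 := by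
  have lD := fun k h => (h2 k h).2.1
  have lg := fun h => (hq.2.1 h).locallyIntegrable (by norm_num)
  have e : ∀ h, ∫ x, mol ρ (w h) x * mol ρ (fun y => (∑ k, D2w k h y) - g h y) x =
      (∑ k, ∫ x, mol ρ (w h) x * mol ρ (D2w k h) x) - ∫ x, mol ρ (w h) x * mol ρ (g h) x := by
    intro h
    have i1 : ∀ k, Integrable (fun x => mol ρ (w h) x * mol ρ (D2w k h) x) :=
      fun k => (hρ.memLp_mol (hw h)).integrable_mul (hρ.memLp_mol (hD2w k h))
    rw [mol_sub hρ (locallyIntegrable_finsetSum _ fun k _ => lD k h) (lg h),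
      mol_sum _ hρ fun k => lD k h, ← integral_finsetSum _ fun k _ => i1 k]
    simp only [mul_sub, Finset.mul_sum]
    exact integral_sub (integrable_finsetSum _ fun k _ => i1 k)
      ((hρ.memLp_mol (hw h)).integrable_mul (hρ.memLp_mol (hq.2.1 h)))
  simp only [e]
  rw [Finset.sum_sub_distrib, sum_integral_mol_mul_mol_grad_eq_zero hρ hw (fun h => h1 h h) hdiv hq,
    sub_zero]
  exact Finset.sum_nonpos fun h _ => Finset.sum_nonpos fun k _ =>
    integral_mol_mul_mol_hess_le hρ (hw h) (hDw k h) (hD2w k h) (h1 k h) (h2 k h)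

end MolLTwo

/-! ### Weak derivatives in time -/

section OneDim

variable {W Y : ℝ → ℝ}

lemma exists_tsupport_subset_Icc {χ : ℝ → ℝ} (hχ : HasCompactSupport χ) (hs : tsupport χ ⊆ Ioi 0) :
    ∃ α β : ℝ, 0 < α ∧ α < β ∧ tsupport χ ⊆ Icc α β := by
  rcases (tsupport χ).eq_empty_or_nonempty with h | h
  · exact ⟨1, 2, one_pos, one_lt_two, by simp [h]⟩
  · obtain ⟨a, ha, hal⟩ := hχ.isCompact.exists_isLeast h
    obtain ⟨b, hb, hbl⟩ := hχ.isCompact.exists_isGreatest h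
    exact ⟨a, b + 1, hs ha, by linarith [hal hb], fun x hx => ⟨hal hx, by linarith [hbl hx]⟩⟩

lemma integrable_mul_of_tsupport_subset {χ : ℝ → ℝ} (hχ : Continuous χ) (hχc : HasCompactSupport χ)
    (hs : tsupport χ ⊆ Ioi 0) (hW : ∀ τ, IntegrableOn W (Ioo 0 τ)) :
    Integrable (fun t => χ t * W t) := by
  obtain ⟨α, β, hα, -, hsub⟩ := exists_tsupport_subset_Icc hχc hs
  obtain ⟨M, hM⟩ := hχc.exists_bound_of_continuous hχ
  have h1 := (integrable_indicator_iff measurableSet_Ioo).2 (hW (β + 1))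
  refine (h1.bdd_mul (c := M) hχ.aestronglyMeasurable (Eventually.of_forall hM)).congr
    (Eventually.of_forall fun t => ?_)
  by_cases ht : t ∈ Ioo 0 (β + 1)
  · simp [ht]
  · have : χ t = 0 := by
      refine image_eq_zero_of_notMem_tsupport fun h => ht ⟨hs h, ?_⟩
      linarith [(hsub h).2]
    simp [this]

lemma intervalIntegrable_of_integrableOn (hY : ∀ τ, IntegrableOn Y (Ioo 0 τ)) {T : ℝ} (hT : 0 ≤ T) :
    IntervalIntegrable Y volume 0 T := by
  rw [intervalIntegrable_iff_integrableOn_Ioo_of_le hT]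
  exact hY T

lemma absolutelyContinuous_primitive (hY : ∀ τ, IntegrableOn Y (Ioo 0 τ)) {T : ℝ} (hT : 0 ≤ T) :
    AbsolutelyContinuousOnInterval (fun t => ∫ s in (0 : ℝ)..t, Y s) 0 T :=
  (intervalIntegrable_of_integrableOn hY hT).absolutelyContinuousOnInterval_intervalIntegral (by simp)

lemma deriv_primitive_ae (hY : ∀ τ, IntegrableOn Y (Ioo 0 τ)) {T : ℝ} (hT : 0 ≤ T) :
    ∀ᵐ t, t ∈ uIoc 0 T → deriv (fun t => ∫ s in (0 : ℝ)..t, Y s) t = Y t := by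
  filter_upwards [(intervalIntegrable_of_integrableOn hY hT).ae_hasDerivAt_integral] with t ht hmem
  exact (ht (uIoc_subset_uIcc hmem) 0 (by simp)).deriv

lemma integral_primitive_mul_self (hY : ∀ τ, IntegrableOn Y (Ioo 0 τ)) {T : ℝ} (hT : 0 ≤ T) :
    ∫ t in (0 : ℝ)..T, (∫ s in (0 : ℝ)..t, Y s) * Y t = (∫ s in (0 : ℝ)..T, Y s) ^ 2 / 2 := by
  have hac := absolutelyContinuous_primitive hY hT
  have h := hac.integral_mul_deriv_eq_deriv_mul hac
  have e1 : ∫ t in (0 : ℝ)..T, (∫ s in (0 : ℝ)..t, Y s) * deriv (fun t => ∫ s in (0 : ℝ)..t, Y s) t =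
      ∫ t in (0 : ℝ)..T, (∫ s in (0 : ℝ)..t, Y s) * Y t := by
    refine intervalIntegral.integral_congr_ae ?_
    filter_upwards [deriv_primitive_ae hY hT] with t ht hm
    rw [ht hm]
  have e2 : ∫ t in (0 : ℝ)..T, deriv (fun t => ∫ s in (0 : ℝ)..t, Y s) t * (∫ s in (0 : ℝ)..t, Y s) =
      ∫ t in (0 : ℝ)..T, (∫ s in (0 : ℝ)..t, Y s) * Y t := by
    refine intervalIntegral.integral_congr_ae ?_
    filter_upwards [deriv_primitive_ae hY hT] with t ht hm
    rw [ht hm, mul_comm]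
  rw [e1, e2] at h
  simp only [intervalIntegral.integral_same] at h
  linarith

lemma integral_deriv_mul_primitive (hY : ∀ τ, IntegrableOn Y (Ioo 0 τ)) {ψ : ℝ → ℝ}
    (hψ : ContDiff ℝ ∞ ψ) (hψc : HasCompactSupport ψ) (hs : tsupport ψ ⊆ Ioi 0) :
    ∫ t, deriv ψ t * ∫ s in (0 : ℝ)..t, Y s = -∫ t, ψ t * Y t := by
  obtain ⟨α, β, hα, hαβ, hsub⟩ := exists_tsupport_subset_Icc hψc hs
  have hT : 0 ≤ β + 1 := by linarith
  have hz : ∀ t, t ∉ Ioc 0 (β + 1) → ψ t = 0 ∧ deriv ψ t = 0 := by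
    intro t ht
    have h1 : t ∉ tsupport ψ := fun h => ht ⟨hs h, by linarith [(hsub h).2]⟩
    exact ⟨image_eq_zero_of_notMem_tsupport h1,
      image_eq_zero_of_notMem_tsupport fun h => h1 (tsupport_deriv_subset h)⟩
  have hac := absolutelyContinuous_primitive hY hT
  have hψac : AbsolutelyContinuousOnInterval ψ 0 (β + 1) :=
    ContDiffOn.absolutelyContinuousOnInterval ((hψ.of_le (by simp)).contDiffOn)
  have h := hψac.integral_mul_deriv_eq_deriv_mul hac
  have e1 : ∫ t in (0 : ℝ)..(β + 1), ψ t * deriv (fun t => ∫ s in (0 : ℝ)..t, Y s) t =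
      ∫ t in (0 : ℝ)..(β + 1), ψ t * Y t := by
    refine intervalIntegral.integral_congr_ae ?_
    filter_upwards [deriv_primitive_ae hY hT] with t ht hm
    rw [ht hm]
  have h0 : ψ 0 = 0 := (hz 0 (by simp)).1
  have h1 : ψ (β + 1) = 0 := by
    refine image_eq_zero_of_notMem_tsupport fun h => ?_
    linarith [(hsub h).2]
  rw [e1, h0, h1, zero_mul, zero_mul, sub_zero, zero_sub, intervalIntegral.integral_of_le hT,
    intervalIntegral.integral_of_le hT,
    setIntegral_eq_integral_of_forall_compl_eq_zero (fun t ht => by rw [(hz t ht).1, zero_mul]),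
    setIntegral_eq_integral_of_forall_compl_eq_zero (fun t ht => by rw [(hz t ht).2, zero_mul])] at h
  rw [h, neg_neg]

lemma integrableOn_primitive (hY : ∀ τ, IntegrableOn Y (Ioo 0 τ)) (τ : ℝ) :
    IntegrableOn (fun t => ∫ s in (0 : ℝ)..t, Y s) (Ioo 0 τ) := by
  rcases le_total τ 0 with h | h
  · simp [Ioo_eq_empty (not_lt.2 h)]
  · have := (absolutelyContinuous_primitive hY h).continuousOn
    rw [uIcc_of_le h] at this
    exact this.integrableOn_Icc.mono_set Ioo_subset_Icc_self

/-- A test function on `(0,∞)` with integral zero is the derivative of a test function. -/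
lemma exists_primitive_test {m : ℝ → ℝ} (hm : ContDiff ℝ ∞ m) (hmc : HasCompactSupport m)
    (hs : tsupport m ⊆ Ioi 0) (hi : ∫ t, m t = 0) :
    ∃ ψ : ℝ → ℝ, ContDiff ℝ ∞ ψ ∧ HasCompactSupport ψ ∧ tsupport ψ ⊆ Ioi 0 ∧ deriv ψ = m := by
  obtain ⟨α, β, hα, hαβ, hsub⟩ := exists_tsupport_subset_Icc hmc hs
  have hc := hm.continuous
  have hmz : ∀ t, t ∉ Icc α β → m t = 0 := fun t ht =>
    image_eq_zero_of_notMem_tsupport fun h => ht (hsub h)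
  have hd : ∀ t, HasDerivAt (fun t => ∫ s in (0 : ℝ)..t, m s) (m t) t := fun t =>
    (hc.integral_hasStrictDerivAt 0 t).hasDerivAt
  have hderiv : deriv (fun t => ∫ s in (0 : ℝ)..t, m s) = m := funext fun t => (hd t).deriv
  have hz : ∀ t, t ∉ Icc α β → ∫ s in (0 : ℝ)..t, m s = 0 := by
    intro t ht
    rcases lt_or_ge t α with h | h
    · refine intervalIntegral.integral_zero_ae (Eventually.of_forall fun s hs => hmz s fun hs' => ?_)
      rw [mem_uIoc] at hs
      rcases hs with hs | hs
      · linarith [hs'.1, hs.2]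
      · linarith [hs'.1, hs.2]
    · have hβ : β < t := by
        by_contra hcon
        exact ht ⟨h, not_lt.1 hcon⟩
      rw [intervalIntegral.integral_of_le (by linarith),
        setIntegral_eq_integral_of_forall_compl_eq_zero, hi]
      intro s hs
      refine hmz s fun hs' => hs ⟨by linarith [hs'.1], by linarith [hs'.2]⟩
  refine ⟨fun t => ∫ s in (0 : ℝ)..t, m s, ?_, HasCompactSupport.intro isCompact_Icc hz, ?_, hderiv⟩
  · rw [contDiff_infty_iff_deriv, hderiv]
    exact ⟨fun t => (hd t).differentiableAt, hm⟩
  · have : tsupport (fun t => ∫ s in (0 : ℝ)..t, m s) ⊆ Icc α β := by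
      refine closure_minimal (fun t ht => ?_) isClosed_Icc
      by_contra hcon
      exact ht (hz t hcon)
    exact this.trans fun t ht => hα.trans_le ht.1

instance neBot_nhds_inf_ae : (𝓝 (0 : ℝ) ⊓ ae ((volume : Measure ℝ).restrict (Ioi 0))).NeBot := by
  rw [inf_neBot_iff]
  intro s hs s' hs'
  obtain ⟨ε, hε, hsub⟩ := Metric.mem_nhds_iff.1 hs
  by_contra hcon
  rw [not_nonempty_iff_eq_empty] at hcon
  have h1 : Ioo 0 ε ⊆ s'ᶜ := by
    intro t ht hts
    have : t ∈ s ∩ s' := ⟨hsub (by simp [abs_of_pos ht.1, ht.2]), hts⟩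
    rw [hcon] at this
    exact this
  have h2 : ((volume : Measure ℝ).restrict (Ioi 0)) (Ioo 0 ε) = 0 :=
    measure_mono_null h1 (mem_ae_iff.1 hs')
  rw [Measure.restrict_apply measurableSet_Ioo, inter_eq_left.2 Ioo_subset_Ioi_self,
    Real.volume_Ioo, sub_zero, ENNReal.ofReal_eq_zero] at h2
  linarith

/-- The lemma of du Bois-Reymond with zero initial value: a function on `(0,∞)` with weak
derivative `Y` that tends to zero at `t = 0` is the primitive of `Y`. -/
theorem ae_eq_primitive_of_weak_deriv (hW : ∀ τ, IntegrableOn W (Ioo 0 τ))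
    (hY : ∀ τ, IntegrableOn Y (Ioo 0 τ))
    (h : ∀ ψ : ℝ → ℝ, ContDiff ℝ ∞ ψ → HasCompactSupport ψ → tsupport ψ ⊆ Ioi 0 →
      ∫ t, deriv ψ t * W t = -∫ t, ψ t * Y t)
    (h0 : Tendsto W (𝓝 0 ⊓ ae ((volume : Measure ℝ).restrict (Ioi 0))) (𝓝 0)) :
    ∀ᵐ t ∂((volume : Measure ℝ).restrict (Ioi 0)), W t = ∫ s in (0 : ℝ)..t, Y s := by
  set F : ℝ → ℝ := fun t => ∫ s in (0 : ℝ)..t, Y s with hF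
  have hFi := integrableOn_primitive hY
  set Z : ℝ → ℝ := fun t => W t - F t with hZ
  have hZi : ∀ τ, IntegrableOn Z (Ioo 0 τ) := fun τ => (hW τ).sub (hFi τ)
  have hZ0 : ∀ ψ : ℝ → ℝ, ContDiff ℝ ∞ ψ → HasCompactSupport ψ → tsupport ψ ⊆ Ioi 0 →
      ∫ t, deriv ψ t * Z t = 0 := by
    intro ψ hψ hψc hs
    have hs' : tsupport (deriv ψ) ⊆ Ioi 0 := tsupport_deriv_subset.trans hs
    have hc' := hψ.continuous_deriv (by simp)
    simp only [hZ, mul_sub]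
    rw [integral_sub (integrable_mul_of_tsupport_subset hc' hψc.deriv hs' hW)
      (integrable_mul_of_tsupport_subset hc' hψc.deriv hs' hFi), h ψ hψ hψc hs,
      integral_deriv_mul_primitive hY hψ hψc hs, sub_self]
  -- a reference test function with integral one
  let b : ContDiffBump (1 : ℝ) := ⟨1 / 4, 1 / 2, by norm_num, by norm_num⟩
  set θ : ℝ → ℝ := b.normed volume with hθ
  have hθd : ContDiff ℝ ∞ θ := b.contDiff_normed
  have hθc : HasCompactSupport θ := b.hasCompactSupport_normed
  have hθi : ∫ t, θ t = 1 := b.integral_normed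
  have hθs : tsupport θ ⊆ Ioi 0 := by
    rw [hθ, b.tsupport_normed_eq]
    intro t ht
    rw [Metric.mem_closedBall, Real.dist_eq, abs_le] at ht
    have hr : -(1 / 2) ≤ t - 1 := ht.1
    simp only [mem_Ioi]
    linarith
  set c : ℝ := ∫ t, θ t * Z t with hc
  have hθZ := integrable_mul_of_tsupport_subset hθd.continuous hθc hθs hZi
  -- `χ - (∫ χ) θ` has integral zero, hence is an admissible derivative `deriv ψ`; so `W - F` is the constant
  -- `c`, which the initial value shows to be zero
  have hae : ∀ᵐ t, t ∈ Ioi (0 : ℝ) → Z t - c = 0 := by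
    refine isOpen_Ioi.ae_eq_zero_of_integral_contDiff_smul_eq_zero ?_ fun χ hχ hχc hχs => ?_
    · refine LocallyIntegrableOn.sub ?_ (locallyIntegrableOn_const c)
      rw [locallyIntegrableOn_iff isOpen_Ioi.isLocallyClosed]
      intro K hK hKc
      obtain ⟨R, hR⟩ := hKc.isBounded.subset_closedBall 0
      refine (hZi (R + 1)).mono_set fun t ht => ⟨hK ht, ?_⟩
      have := hR ht
      rw [Metric.mem_closedBall, Real.dist_eq, sub_zero] at this
      linarith [le_abs_self t]
    · have hχi := hχ.continuous.integrable_of_hasCompactSupport hχc (μ := volume)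
      have hθi' := hθd.continuous.integrable_of_hasCompactSupport hθc (μ := volume)
      set J : ℝ := ∫ t, χ t with hJ
      have hms : tsupport (fun t => χ t - J * θ t) ⊆ Ioi 0 := by
        refine (tsupport_sub χ fun t => J * θ t).trans (union_subset hχs ?_)
        exact (tsupport_mul_subset_right (f := fun _ => J) (g := θ)).trans hθs
      obtain ⟨ψ, p1, p2, p3, p4⟩ := exists_primitive_test (m := fun t => χ t - J * θ t)
        (hχ.sub (contDiff_const.mul hθd)) (hχc.sub hθc.mul_left) hms (by
          rw [integral_sub hχi (hθi'.const_mul J), integral_const_mul, hθi, hJ]; ring)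
      have h1 := hZ0 ψ p1 p2 p3
      have hχZ := integrable_mul_of_tsupport_subset hχ.continuous hχc hχs hZi
      rw [p4] at h1
      simp only [sub_mul, mul_assoc] at h1
      rw [integral_sub hχZ (hθZ.const_mul J), integral_const_mul] at h1
      simp only [smul_eq_mul, mul_sub]
      rw [integral_sub hχZ (hχi.mul_const c), integral_mul_const]
      exact h1
  have hae' : ∀ᵐ t ∂((volume : Measure ℝ).restrict (Ioi 0)), Z t = c := by
    rw [ae_restrict_iff' measurableSet_Ioi]
    filter_upwards [hae] with t ht hm using sub_eq_zero.1 (ht hm)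
  have hF0 : Tendsto F (𝓝 0 ⊓ ae ((volume : Measure ℝ).restrict (Ioi 0))) (𝓝 0) := by
    have h1 := (absolutelyContinuous_primitive hY zero_le_one).continuousOn
    rw [uIcc_of_le zero_le_one] at h1
    have h2 := h1 0 (by simp)
    have h3 : F 0 = 0 := by simp [hF]
    rw [ContinuousWithinAt] at h2
    change Tendsto F _ (𝓝 (F 0)) at h2
    rw [h3] at h2
    refine h2.mono_left (le_inf inf_le_left ?_)
    rw [le_principal_iff]
    have e1 : Iio (1 : ℝ) ∈ 𝓝 (0 : ℝ) := Iio_mem_nhds one_pos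
    have e2 : Ioi (0 : ℝ) ∈ ae ((volume : Measure ℝ).restrict (Ioi 0)) := ae_restrict_mem measurableSet_Ioi
    filter_upwards [mem_inf_of_left e1, mem_inf_of_right e2] with t h1 h2 using ⟨h2.le, h1.le⟩
  have hc0 : c = 0 := by
    have h1 := h0.sub hF0
    rw [sub_zero] at h1
    have h2 : Tendsto (fun _ : ℝ => c) (𝓝 0 ⊓ ae ((volume : Measure ℝ).restrict (Ioi 0))) (𝓝 0) :=
      h1.congr' (hae'.filter_mono inf_le_right)
    exact tendsto_nhds_unique tendsto_const_nhds h2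
  filter_upwards [hae'] with t ht
  rw [hc0] at ht
  exact sub_eq_zero.1 ht

end OneDim

/-! ### Uniqueness -/

section Slices

lemma ae_Ioi_of_forall_Ioo {P : ℝ → Prop}
    (h : ∀ n : ℕ, ∀ᵐ t ∂((volume : Measure ℝ).restrict (Ioo 0 (n : ℝ))), P t) :
    ∀ᵐ t ∂((volume : Measure ℝ).restrict (Ioi 0)), P t := by
  rw [ae_restrict_iff' measurableSet_Ioi]
  have h' := fun n => (ae_restrict_iff' measurableSet_Ioo).1 (h n)
  filter_upwards [ae_all_iff.2 h'] with t ht ht0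
  obtain ⟨n, hn⟩ := exists_nat_gt t
  exact ht n ⟨ht0, hn⟩

variable {u : ℝ → E3 → ℝ}

lemma ae_memLp_slice (hu : ∀ τ, MemLp (Function.uncurry u) 2 (stMeasure (Ioo 0 τ))) :
    ∀ᵐ t ∂((volume : Measure ℝ).restrict (Ioi 0)), MemLp (u t) 2 volume := by
  refine ae_Ioi_of_forall_Ioo fun n => ?_
  have h1 := (hu n).integrable_sq
  unfold stMeasure at h1
  have hm : ∀ᵐ t ∂((volume : Measure ℝ).restrict (Ioo 0 (n : ℝ))),
      AEStronglyMeasurable (u t) volume := (hu n).1.prodMk_left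
  filter_upwards [h1.prod_right_ae, hm] with t ht hmt
  exact (memLp_two_iff_integrable_sq hmt).2 ht

lemma ae_integrableOn_slice (hm : Measurable (Function.uncurry u))
    (hu : ∀ τ, MemLp (Function.uncurry u) 2 (stMeasure (Ioo 0 τ))) :
    ∀ᵐ x, ∀ τ, IntegrableOn (fun t => u t x) (Ioo 0 τ) := by
  have h : ∀ n : ℕ, ∀ᵐ x, IntegrableOn (fun t => u t x) (Ioo 0 (n : ℝ)) := by
    intro n
    have h1 := (hu n).integrable_sq
    unfold stMeasure at h1
    filter_upwards [h1.prod_left_ae] with x hx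
    have hms : Measurable (fun t => u t x) := hm.comp (by fun_prop : Measurable fun t : ℝ => (t, x))
    have := (memLp_two_iff_integrable_sq hms.aestronglyMeasurable).2 hx
    exact this.integrable (by norm_num)
  filter_upwards [ae_all_iff.2 h] with x hx τ
  obtain ⟨n, hn⟩ := exists_nat_gt τ
  exact (hx n).mono_set (Ioo_subset_Ioo_right hn.le)

lemma measurable_mol_slice {ρ : E3 → ℝ} (hρ : IsTestFun ρ) (hm : Measurable (Function.uncurry u)) :
    Measurable (Function.uncurry fun t => mol ρ (u t)) := by
  have h : Measurable (fun q : (ℝ × E3) × E3 => ρ (q.1.2 - q.2) * u q.1.1 q.2) :=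
    (hρ.continuous.measurable.comp (by fun_prop : Measurable fun q : (ℝ × E3) × E3 => q.1.2 - q.2)).mul
      (hm.comp (by fun_prop : Measurable fun q : (ℝ × E3) × E3 => (q.1.1, q.2)))
  exact (h.stronglyMeasurable.integral_prod_right (ν := (volume : Measure E3))).measurable

lemma memLp_mol_slice {ρ : E3 → ℝ} (hρ : IsTestFun ρ) (hm : Measurable (Function.uncurry u)) {τ : ℝ}
    (hu : MemLp (Function.uncurry u) 2 (stMeasure (Ioo 0 τ))) :
    MemLp (Function.uncurry fun t => mol ρ (u t)) 2 (stMeasure (Ioo 0 τ)) := by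
  have hmm := measurable_mol_slice hρ hm
  rw [memLp_two_iff_lintegral hmm.aestronglyMeasurable]
  have h1 := (memLp_two_iff_lintegral hu.1).1 hu
  unfold stMeasure at h1 ⊢
  rw [lintegral_prod _ (hm.enorm.pow_const 2).aemeasurable] at h1
  rw [lintegral_prod _ (hmm.enorm.pow_const 2).aemeasurable]
  calc _ ≤ ∫⁻ t in Ioo 0 τ, (∫⁻ y, ‖ρ y‖ₑ) ^ 2 * ∫⁻ y, ‖u t y‖ₑ ^ 2 :=
        lintegral_mono fun t => lintegral_mol_sq_le hρ
          (hm.comp (by fun_prop : Measurable fun y : E3 => (t, y))).aestronglyMeasurable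
    _ = (∫⁻ y, ‖ρ y‖ₑ) ^ 2 * ∫⁻ t in Ioo 0 τ, ∫⁻ y, ‖u t y‖ₑ ^ 2 :=
        lintegral_const_mul' _ _ (ENNReal.pow_ne_top hρ.integrable.2.ne)
    _ < ⊤ := ENNReal.mul_lt_top (ENNReal.pow_lt_top hρ.integrable.2) h1

lemma integrable_test_mul_slice {χ : ℝ → ℝ} (hχ : Continuous χ) (hχc : HasCompactSupport χ)
    (hs : tsupport χ ⊆ Ioi 0) {η : E3 → ℝ} (hη : IsTestFun η)
    (hu : ∀ τ, MemLp (Function.uncurry u) 2 (stMeasure (Ioo 0 τ))) :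
    Integrable (fun p : ℝ × E3 => χ p.1 * (η p.2 * u p.1 p.2))
      ((volume : Measure ℝ).prod (volume : Measure E3)) := by
  obtain ⟨α, β, hα, -, hsub⟩ := exists_tsupport_subset_Icc hχc hs
  have hT : MemLp (fun p : ℝ × E3 => χ p.1 * η p.2) 2 (stMeasure (Ioo 0 (β + 1))) := by
    have hm : Measurable (fun p : ℝ × E3 => χ p.1 * η p.2) :=
      (hχ.measurable.comp measurable_fst).mul (hη.continuous.measurable.comp measurable_snd)
    rw [memLp_two_iff_integrable_sq hm.aestronglyMeasurable]
    have h1 : Integrable (fun t => χ t ^ 2) (volume.restrict (Ioo 0 (β + 1))) :=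
      ((hχ.memLp_of_hasCompactSupport hχc (p := 2)).integrable_sq).restrict
    have h2 := (hη.memLp 2).integrable_sq
    refine (h1.mul_prod h2).congr (Eventually.of_forall fun p => ?_)
    simp only; ring
  have hi : Integrable (fun p : ℝ × E3 => χ p.1 * (η p.2 * u p.1 p.2)) (stMeasure (Ioo 0 (β + 1))) := by
    refine (hT.integrable_mul (hu (β + 1))).congr (Eventually.of_forall fun p => ?_)
    simp only [Pi.mul_apply, Function.uncurry]; ring
  have e : stMeasure (Ioo 0 (β + 1)) =
      ((volume : Measure ℝ).prod (volume : Measure E3)).restrict (Ioo 0 (β + 1) ×ˢ univ) := by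
    unfold stMeasure
    conv_lhs => rw [← Measure.restrict_univ (μ := (volume : Measure E3))]
    exact Measure.prod_restrict _ _
  rw [e] at hi
  refine (integrableOn_iff_integrable_of_support_subset ?_).1 hi
  intro p hp
  refine ⟨?_, mem_univ _⟩
  by_contra hcon
  refine hp ?_
  have : χ p.1 = 0 := image_eq_zero_of_notMem_tsupport fun h => hcon ⟨hs h, by linarith [(hsub h).2]⟩
  simp [this]

/-- A weak time derivative may be tested in space. -/
lemma integral_deriv_mul_integral_test {u' : ℝ → E3 → ℝ}
    (hu : ∀ τ, MemLp (Function.uncurry u) 2 (stMeasure (Ioo 0 τ)))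
    (hu' : ∀ τ, MemLp (Function.uncurry u') 2 (stMeasure (Ioo 0 τ))) {ψ : ℝ → ℝ}
    (hψ : ContDiff ℝ ∞ ψ) (hψc : HasCompactSupport ψ) (hs : tsupport ψ ⊆ Ioi 0)
    (h : ∀ᵐ x : E3, ∫ t, deriv ψ t * u t x = -∫ t, ψ t * u' t x) {η : E3 → ℝ} (hη : IsTestFun η) :
    ∫ t, deriv ψ t * ∫ x, η x * u t x = -∫ t, ψ t * ∫ x, η x * u' t x := by
  have key : ∀ {χ : ℝ → ℝ} {w : ℝ → E3 → ℝ}, Continuous χ → HasCompactSupport χ → tsupport χ ⊆ Ioi 0 →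
      (∀ τ, MemLp (Function.uncurry w) 2 (stMeasure (Ioo 0 τ))) →
      ∫ t, χ t * ∫ x, η x * w t x = ∫ x, η x * ∫ t, χ t * w t x := by
    intro χ w hχ hχc hs hw
    simp_rw [← integral_const_mul]
    rw [integral_integral_swap (integrable_test_mul_slice hχ hχc hs hη hw)]
    congr 1; funext x; congr 1; funext t; ring
  rw [key (hψ.continuous_deriv (by simp)) hψc.deriv (tsupport_deriv_subset.trans hs) hu,
    key hψ.continuous hψc hs hu', ← integral_neg]
  refine integral_congr_ae ?_
  filter_upwards [h] with x hx
  rw [hx]; ring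

end Slices

/-- The homogeneous Cauchy problem for the Stokes system, componentwise: `w` is the velocity with
derivatives `Dw k h = ∂_k w_h` and `D2w k h = ∂_k ∂_k w_h`, and `q` the pressure with gradient `g`. -/
structure HomStokes (w : Fin 3 → ℝ → E3 → ℝ) (Dw D2w : Fin 3 → Fin 3 → ℝ → E3 → ℝ) (q : ℝ → E3 → ℝ)
    (g : Fin 3 → ℝ → E3 → ℝ) : Prop where
  meas : ∀ h, Measurable (Function.uncurry (w h))
  meas_hess : ∀ k h, Measurable (Function.uncurry (D2w k h))
  meas_grad : ∀ h, Measurable (Function.uncurry (g h))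
  memLp : ∀ h τ, MemLp (Function.uncurry (w h)) 2 (stMeasure (Ioo 0 τ))
  memLp_deriv : ∀ k h τ, MemLp (Function.uncurry (Dw k h)) 2 (stMeasure (Ioo 0 τ))
  memLp_hess : ∀ k h τ, MemLp (Function.uncurry (D2w k h)) 2 (stMeasure (Ioo 0 τ))
  memLp_grad : ∀ h τ, MemLp (Function.uncurry (g h)) 2 (stMeasure (Ioo 0 τ))
  weak : ∀ᵐ t ∂((volume : Measure ℝ).restrict (Ioi 0)),
    (∀ k h, HasWeakPartial k (w h t) (Dw k h t)) ∧ (∀ k h, HasWeakPartial k (Dw k h t) (D2w k h t)) ∧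
    IsD012 (q t) (fun h => g h t) ∧ ∀ᵐ x, ∑ h, Dw h h t x = 0
  time : ∀ h (ψ : ℝ → ℝ), ContDiff ℝ ∞ ψ → HasCompactSupport ψ → tsupport ψ ⊆ Ioi 0 →
    ∀ᵐ x, ∫ t, deriv ψ t * w h t x = -∫ t, ψ t * ((∑ k, D2w k h t x) - g h t x)
  initial : ∀ h, Tendsto (fun t => eLpNorm (w h t) 2 volume)
    (𝓝 (0 : ℝ) ⊓ ae ((volume : Measure ℝ).restrict (Ioi 0))) (𝓝 0)

namespace HomStokes

variable {w : Fin 3 → ℝ → E3 → ℝ} {Dw D2w : Fin 3 → Fin 3 → ℝ → E3 → ℝ} {q : ℝ → E3 → ℝ}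
  {g : Fin 3 → ℝ → E3 → ℝ}

lemma measurable_rhs (H : HomStokes w Dw D2w q g) (h : Fin 3) :
    Measurable (Function.uncurry fun t x => (∑ k, D2w k h t x) - g h t x) :=
  (Finset.measurable_fun_sum _ fun k _ => H.meas_hess k h).sub (H.meas_grad h)

lemma memLp_rhs (H : HomStokes w Dw D2w q g) (h : Fin 3) (τ : ℝ) :
    MemLp (Function.uncurry fun t x => (∑ k, D2w k h t x) - g h t x) 2 (stMeasure (Ioo 0 τ)) :=
  (memLp_finsetSum _ fun k _ => H.memLp_hess k h τ).sub (H.memLp_grad h τ)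

/-- The mollified velocity is the time integral of the mollified right-hand side. -/
lemma mol_eq_primitive (H : HomStokes w Dw D2w q g) {ρ : E3 → ℝ} (hρ : IsTestFun ρ) (h : Fin 3) :
    ∀ᵐ x, (∀ τ, IntegrableOn (fun t => mol ρ (fun y => (∑ k, D2w k h t y) - g h t y) x) (Ioo 0 τ)) ∧
      ∀ᵐ t ∂((volume : Measure ℝ).restrict (Ioi 0)), mol ρ (w h t) x =
        ∫ s in (0 : ℝ)..t, mol ρ (fun y => (∑ k, D2w k h s y) - g h s y) x := by
  have i1 := ae_integrableOn_slice (measurable_mol_slice hρ (H.meas h))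
    fun τ => memLp_mol_slice hρ (H.meas h) (H.memLp h τ)
  have i2 := ae_integrableOn_slice (measurable_mol_slice hρ (H.measurable_rhs h))
    fun τ => memLp_mol_slice hρ (H.measurable_rhs h) (H.memLp_rhs h τ)
  obtain ⟨M, hM, hb⟩ := hρ.exists_enorm_mol_le
  filter_upwards [i1, i2] with x h1 h2
  refine ⟨h2, ae_eq_primitive_of_weak_deriv h1 h2 (fun ψ hψ hψc hs => ?_) ?_⟩
  · exact integral_deriv_mul_integral_test (H.memLp h) (H.memLp_rhs h) hψ hψc hs
      (H.time h ψ hψ hψc hs) (hρ.comp_sub_left x)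
  · rw [tendsto_zero_iff_enorm_tendsto_zero]
    have hsq : Tendsto (fun t => ‖mol ρ (w h t) x‖ₑ ^ 2)
        (𝓝 (0 : ℝ) ⊓ ae ((volume : Measure ℝ).restrict (Ioi 0))) (𝓝 0) := by
      have h3 : Tendsto (fun t => M * eLpNorm (w h t) 2 volume ^ 2)
          (𝓝 (0 : ℝ) ⊓ ae ((volume : Measure ℝ).restrict (Ioi 0))) (𝓝 0) := by
        have := ENNReal.Tendsto.const_mul (a := M) (ENNReal.Tendsto.pow (n := 2) (H.initial h)) (Or.inr hM)
        simpa using this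
      exact tendsto_of_tendsto_of_tendsto_of_le_of_le tendsto_const_nhds h3 (fun _ => zero_le)
        fun t => hb (w h t) ((H.meas h).comp
          (by fun_prop : Measurable fun y : E3 => (t, y))).aestronglyMeasurable x
    have h4 := (ENNReal.continuous_rpow_const (y := (1 / 2 : ℝ))).tendsto 0 |>.comp hsq
    simp only [Function.comp_def] at h4
    rw [ENNReal.zero_rpow_of_pos (by norm_num)] at h4
    refine h4.congr fun t => ?_
    rw [← ENNReal.rpow_natCast, ← ENNReal.rpow_mul]
    norm_num

/-- Energy estimate: the time integrals of the mollified right-hand side vanish. -/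
lemma primitive_eq_zero (H : HomStokes w Dw D2w q g) {ρ : E3 → ℝ} (hρ : IsTestFun ρ) {T : ℝ}
    (hT : 0 < T) : ∀ᵐ x, ∀ h, ∫ s in (0 : ℝ)..T, mol ρ (fun y => (∑ k, D2w k h s y) - g h s y) x = 0 := by
  set a : Fin 3 → ℝ → E3 → ℝ := fun h t => mol ρ (w h t) with ha
  set b : Fin 3 → ℝ → E3 → ℝ := fun h t => mol ρ (fun y => (∑ k, D2w k h t y) - g h t y) with hb
  have hprim := fun h => H.mol_eq_primitive hρ h
  have hab : ∀ h, Integrable (fun p : ℝ × E3 => a h p.1 p.2 * b h p.1 p.2)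
      (((volume : Measure ℝ).restrict (Ioo 0 T)).prod (volume : Measure E3)) := fun h =>
    (memLp_mol_slice hρ (H.meas h) (H.memLp h T)).integrable_mul
      (memLp_mol_slice hρ (H.measurable_rhs h) (H.memLp_rhs h T))
  -- for almost every `x`, `a` is the primitive of `b`, so that `∫₀ᵀ a b dt = a(T)² / 2`
  have hx : ∀ h, (fun x => ∫ t in Ioo 0 T, a h t x * b h t x) =ᵐ[volume]
      fun x => (∫ s in (0 : ℝ)..T, b h s x) ^ 2 / 2 := by
    intro h
    filter_upwards [hprim h] with x hx
    rw [← integral_primitive_mul_self hx.1 hT.le, intervalIntegral.integral_of_le hT.le,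
      integral_Ioc_eq_integral_Ioo]
    refine integral_congr_ae ?_
    have := ae_restrict_of_ae_restrict_of_subset Ioo_subset_Ioi_self hx.2 (s := Ioo 0 T)
    filter_upwards [this] with t ht
    rw [← ht]
  have hi : ∀ h, Integrable (fun x => (∫ s in (0 : ℝ)..T, b h s x) ^ 2 / 2) volume := fun h =>
    (hab h).integral_prod_right.congr (hx h)
  -- Fubini turns the integral over `x` of these squares into the time integral of the spatial energy
  -- inequality
  have hsum : ∫ x, ∑ h, (∫ s in (0 : ℝ)..T, b h s x) ^ 2 / 2 ≤ 0 := by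
    rw [integral_finsetSum _ fun h _ => hi h]
    have e : ∀ h, ∫ x, (∫ s in (0 : ℝ)..T, b h s x) ^ 2 / 2 =
        ∫ t in Ioo 0 T, ∫ x, a h t x * b h t x := by
      intro h
      rw [← integral_congr_ae (hx h), ← integral_prod _ (hab h), integral_prod_symm _ (hab h)]
    simp only [e]
    rw [← integral_finsetSum _ fun h _ => (hab h).integral_prod_left]
    refine integral_nonpos_of_ae ?_
    have s0 := fun h => ae_memLp_slice (H.memLp h)
    have s1 := fun k h => ae_memLp_slice (H.memLp_deriv k h)
    have s2 := fun k h => ae_memLp_slice (H.memLp_hess k h)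
    have : ∀ᵐ t ∂((volume : Measure ℝ).restrict (Ioi 0)), ∑ h, ∫ x, a h t x * b h t x ≤ 0 := by
      filter_upwards [H.weak, ae_all_iff.2 s0, ae_all_iff.2 fun k => ae_all_iff.2 (s1 k),
        ae_all_iff.2 fun k => ae_all_iff.2 (s2 k)] with t ht h0 h1 h2
      exact sum_integral_mol_le_zero hρ h0 h1 h2 ht.1 ht.2.1 ht.2.2.2 ht.2.2.1
    exact ae_restrict_of_ae_restrict_of_subset Ioo_subset_Ioi_self this
  have hpos : ∀ x, 0 ≤ ∑ h, (∫ s in (0 : ℝ)..T, b h s x) ^ 2 / 2 := fun x =>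
    Finset.sum_nonneg fun h _ => by positivity
  have hzero := (integral_eq_zero_iff_of_nonneg hpos (integrable_finsetSum _ fun h _ => hi h)).1
    (le_antisymm hsum (integral_nonneg hpos))
  filter_upwards [hzero] with x hx h
  have h1 := (Finset.sum_eq_zero_iff_of_nonneg (fun h _ => by positivity)).1 hx h (Finset.mem_univ h)
  have h2 : (∫ s in (0 : ℝ)..T, b h s x) ^ 2 = 0 := by linarith
  exact pow_eq_zero_iff two_ne_zero |>.1 h2

/-- The mollifications of the velocity and of the right-hand side vanish. -/
lemma mol_eq_zero (H : HomStokes w Dw D2w q g) {ρ : E3 → ℝ} (hρ : IsTestFun ρ) :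
    ∀ᵐ t ∂((volume : Measure ℝ).restrict (Ioi 0)), ∀ᵐ x, ∀ h, mol ρ (w h t) x = 0 ∧
      mol ρ (fun y => (∑ k, D2w k h t y) - g h t y) x = 0 := by
  have hms : MeasurableSet {p : ℝ × E3 | ∀ h, mol ρ (w h p.1) p.2 = 0 ∧
      mol ρ (fun y => (∑ k, D2w k h p.1 y) - g h p.1 y) p.2 = 0} := by
    simp only [ofPred_forall]
    exact MeasurableSet.iInter fun h => (measurableSet_eq_fun (measurable_mol_slice hρ (H.meas h))
      measurable_const).inter (measurableSet_eq_fun (measurable_mol_slice hρ (H.measurable_rhs h))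
      measurable_const)
  rw [← Measure.ae_prod_iff_ae_ae hms]
  -- the primitives are known for almost every `x`, so the order of `t` and `x` is exchanged
  refine ((Measure.ae_prod_iff_ae_ae (measurable_swap hms)).2 ?_ : ∀ᵐ p ∂((volume : Measure E3).prod
    ((volume : Measure ℝ).restrict (Ioi 0))), p.swap ∈ {p : ℝ × E3 | ∀ h, mol ρ (w h p.1) p.2 = 0 ∧
      mol ρ (fun y => (∑ k, D2w k h p.1 y) - g h p.1 y) p.2 = 0}) |> fun h =>
      (Measure.measurePreserving_swap (μ := (volume : Measure ℝ).restrict (Ioi 0))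
        (ν := (volume : Measure E3))).quasiMeasurePreserving.ae h
  have hq : ∀ᵐ x, ∀ r : ℚ, 0 < r → ∀ h, ∫ s in (0 : ℝ)..r,
      mol ρ (fun y => (∑ k, D2w k h s y) - g h s y) x = 0 := by
    refine ae_all_iff.2 fun r => ?_
    by_cases hr : 0 < r
    · filter_upwards [H.primitive_eq_zero hρ (Rat.cast_pos.2 hr : (0 : ℝ) < r)] with x hx _ using hx
    · exact Eventually.of_forall fun x h => absurd h hr
  filter_upwards [ae_all_iff.2 fun h => H.mol_eq_primitive hρ h, hq] with x h1 h2
  -- the primitive vanishes at positive rational times, hence, by continuity, at all times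
  have hz : ∀ h T, 0 < T → ∫ s in (0 : ℝ)..T, mol ρ (fun y => (∑ k, D2w k h s y) - g h s y) x = 0 := by
    intro h T hT
    have hc := (absolutelyContinuous_primitive (h1 h).1 (by linarith : (0 : ℝ) ≤ T + 1)).continuousOn
    rw [uIcc_of_le (by linarith)] at hc
    have hcT := hc.continuousAt (Icc_mem_nhds hT (lt_add_one T))
    by_contra hne
    have hev := hcT.eventually_ne hne
    obtain ⟨ε, hε, hball⟩ := Metric.eventually_nhds_iff.1 hev
    obtain ⟨r, hr1, hr2⟩ := exists_rat_btwn (lt_add_of_pos_right T hε)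
    refine hball ?_ (h2 r (by exact_mod_cast hT.trans hr1) h)
    rw [Real.dist_eq, abs_of_pos (by linarith)]
    linarith
  have h3 : ∀ h, ∀ᵐ t ∂((volume : Measure ℝ).restrict (Ioi 0)),
      mol ρ (fun y => (∑ k, D2w k h t y) - g h t y) x = 0 := by
    intro h
    refine ae_Ioi_of_forall_Ioo fun n => ?_
    rw [ae_restrict_iff' measurableSet_Ioo]
    filter_upwards [deriv_primitive_ae (h1 h).1 (Nat.cast_nonneg n)] with t ht htm
    rw [← ht (by rw [uIoc_of_le (Nat.cast_nonneg n)]; exact ⟨htm.1, htm.2.le⟩)]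
    have : (fun t => ∫ s in (0 : ℝ)..t, mol ρ (fun y => (∑ k, D2w k h s y) - g h s y) x) =ᶠ[𝓝 t]
        fun _ => 0 := by
      filter_upwards [Ioi_mem_nhds htm.1] with s hs using hz h s hs
    rw [this.deriv_eq, deriv_const]
  filter_upwards [ae_all_iff.2 fun h => (h1 h).2, ae_all_iff.2 h3, ae_restrict_mem measurableSet_Ioi]
    with t h4 h5 ht h
  exact ⟨(h4 h).trans (hz h t ht), h5 h⟩

/-- The homogeneous problem has only the trivial solution. -/
theorem eq_zero (H : HomStokes w Dw D2w q g) :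
    ∀ᵐ t ∂((volume : Measure ℝ).restrict (Ioi 0)), (∀ h, w h t =ᵐ[volume] 0) ∧ q t =ᵐ[volume] 0 := by
  have hall := ae_all_iff.2 fun n => H.mol_eq_zero (isTestFun_stdMol n)
  filter_upwards [H.weak, hall] with t hweak ht
  obtain ⟨hw1, hw2, hq, -⟩ := hweak
  have ht' := ae_all_iff.2 ht
  have lr : ∀ h, LocallyIntegrable (fun y => (∑ k, D2w k h t y) - g h t y) volume := fun h =>
    (locallyIntegrable_finsetSum _ fun k _ => (hw2 k h).2.1).sub ((hq.2.1 h).locallyIntegrable (by norm_num))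
  have hw : ∀ h, w h t =ᵐ[volume] 0 := by
    intro h
    filter_upwards [ht', ae_tendsto_mol (hw1 0 h).1] with x h1 h2
    refine tendsto_nhds_unique h2 ?_
    simp only [(h1 _ h).1]
    exact tendsto_const_nhds
  -- with `w = 0` the right-hand side `Δw - ∇q` is zero and so is `Δw`; hence `∇q = 0`
  have hr : ∀ h, (fun y => (∑ k, D2w k h t y) - g h t y) =ᵐ[volume] 0 := by
    intro h
    filter_upwards [ht', ae_tendsto_mol (lr h)] with x h1 h2
    refine tendsto_nhds_unique h2 ?_
    simp only [(h1 _ h).2]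
    exact tendsto_const_nhds
  have hD : ∀ k h, Dw k h t =ᵐ[volume] 0 := fun k h =>
    ((hw1 k h).congr (hw h) (ae_eq_refl _)).ae_unique (HasWeakPartial.zero k)
  have hD2 : ∀ k h, D2w k h t =ᵐ[volume] 0 := fun k h =>
    ((hw2 k h).congr (hD k h) (ae_eq_refl _)).ae_unique (HasWeakPartial.zero k)
  refine ⟨hw, hq.ae_eq_zero fun h => ?_⟩
  filter_upwards [hr h, ae_all_iff.2 fun k => hD2 k h] with x h1 h2
  simp only [h2, Pi.zero_apply, Finset.sum_const_zero, zero_sub, neg_eq_zero] at h1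
  exact h1

end HomStokes

section Representatives

variable {F : Type*}

lemma ae_ae_of_uncurry_ae_eq {I : Set ℝ} {u u' : ℝ → E3 → F}
    (h : Function.uncurry u =ᵐ[stMeasure I] Function.uncurry u') :
    ∀ᵐ t ∂((volume : Measure ℝ).restrict I), u t =ᵐ[volume] u' t :=
  Measure.ae_ae_of_ae_prod h

variable [NormedAddCommGroup F]

lemma uncurry_ae_eq_of_ae_ae {I : Set ℝ} {u u' : ℝ → E3 → F}
    (hu : AEStronglyMeasurable (Function.uncurry u) (stMeasure I))
    (hu' : AEStronglyMeasurable (Function.uncurry u') (stMeasure I))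
    (h : ∀ᵐ t ∂((volume : Measure ℝ).restrict I), u t =ᵐ[volume] u' t) :
    Function.uncurry u =ᵐ[stMeasure I] Function.uncurry u' := by
  have h1 : ∀ᵐ t ∂((volume : Measure ℝ).restrict I), ∀ᵐ x ∂(volume : Measure E3),
      u t x = hu.mk _ (t, x) := Measure.ae_ae_of_ae_prod hu.ae_eq_mk
  have h2 : ∀ᵐ t ∂((volume : Measure ℝ).restrict I), ∀ᵐ x ∂(volume : Measure E3),
      u' t x = hu'.mk _ (t, x) := Measure.ae_ae_of_ae_prod hu'.ae_eq_mk
  have hms : MeasurableSet {p : ℝ × E3 | hu.mk _ p = hu'.mk _ p} :=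
    hu.stronglyMeasurable_mk.measurableSet_eq_fun hu'.stronglyMeasurable_mk
  have h3 : ∀ᵐ p ∂(stMeasure I), hu.mk _ p = hu'.mk _ p := by
    refine (Measure.ae_prod_iff_ae_ae hms).2 ?_
    filter_upwards [h, h1, h2] with t a1 a2 a3
    filter_upwards [a1, a2, a3] with x b1 b2 b3
    rw [← b2, ← b3, b1]
  filter_upwards [h3, hu.ae_eq_mk, hu'.ae_eq_mk] with p a1 a2 a3
  rw [a2, a3, a1]

lemma exists_measurable_rep {I : Set ℝ} {u : ℝ → E3 → ℝ}
    (hu : AEStronglyMeasurable (Function.uncurry u) (stMeasure I)) :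
    ∃ u' : ℝ → E3 → ℝ, Measurable (Function.uncurry u') ∧
      Function.uncurry u =ᵐ[stMeasure I] Function.uncurry u' :=
  ⟨fun t x => hu.mk _ (t, x), hu.stronglyMeasurable_mk.measurable, hu.ae_eq_mk⟩

lemma stMeasure_eq_restrict (I : Set ℝ) :
    stMeasure I = ((volume : Measure ℝ).prod (volume : Measure E3)).restrict (I ×ˢ univ) := by
  unfold stMeasure
  conv_lhs => rw [← Measure.restrict_univ (μ := (volume : Measure E3))]
  exact Measure.prod_restrict _ _

lemma stMeasure_mono {I J : Set ℝ} (h : I ⊆ J) : stMeasure I ≤ stMeasure J := by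
  rw [stMeasure_eq_restrict, stMeasure_eq_restrict]
  exact Measure.restrict_mono (prod_mono h subset_rfl) le_rfl

lemma aestronglyMeasurable_Ioi {u : ℝ × E3 → F}
    (h : ∀ τ : ℝ, 0 < τ → AEStronglyMeasurable u (stMeasure (Ioo 0 τ))) :
    AEStronglyMeasurable u (stMeasure (Ioi 0)) := by
  have e : (Ioi (0 : ℝ)) ×ˢ (univ : Set E3) = ⋃ n : ℕ, Ioo (0 : ℝ) (n + 1) ×ˢ univ := by
    ext p
    simp only [mem_prod, mem_Ioi, mem_univ, and_true, mem_iUnion, mem_Ioo]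
    refine ⟨fun hp => ?_, fun ⟨_, hp⟩ => hp.1⟩
    obtain ⟨n, hn⟩ := exists_nat_gt p.1
    exact ⟨n, hp, by linarith⟩
  rw [stMeasure_eq_restrict, e, aestronglyMeasurable_iUnion_iff]
  intro n
  have := h (n + 1) (by positivity)
  rwa [stMeasure_eq_restrict] at this

end Representatives

section WeakGrad

variable {F : Type*} [NormedAddCommGroup F] [NormedSpace ℝ F]

lemma HasWeakGrad.mono {I J : Set ℝ} {u : ℝ → E3 → F} {Du : Fin 3 → ℝ → E3 → F} (hIJ : I ⊆ J)
    (h : HasWeakGrad J u Du) : HasWeakGrad I u Du :=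
  ⟨fun i => (h.1 i).mono_measure (stMeasure_mono hIJ), ae_restrict_of_ae_restrict_of_subset hIJ h.2⟩

lemma HasWeakGrad.ae_unique [CompleteSpace F] {I : Set ℝ} {u u' : ℝ → E3 → F}
    {Du Du' : Fin 3 → ℝ → E3 → F} (h : HasWeakGrad I u Du) (h' : HasWeakGrad I u' Du')
    (huu' : ∀ᵐ t ∂((volume : Measure ℝ).restrict I), u t =ᵐ[volume] u' t) (i : Fin 3) :
    Function.uncurry (Du i) =ᵐ[stMeasure I] Function.uncurry (Du' i) := by
  refine uncurry_ae_eq_of_ae_ae (h.1 i) (h'.1 i) ?_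
  filter_upwards [h.2, h'.2, huu'] with t h1 h2 h3
  exact ((h1 i).congr h3 (ae_eq_refl _)).ae_unique (h2 i)

lemma HasWeakPartial.sub {i : Fin 3} {u g u' g' : E3 → F} (h : HasWeakPartial i u g)
    (h' : HasWeakPartial i u' g') :
    HasWeakPartial i (fun x => u x - u' x) (fun x => g x - g' x) := by
  simpa only [sub_eq_add_neg] using h.add h'.neg

end WeakGrad

lemma MemL2L2.of_Ioi {F : Type*} [NormedAddCommGroup F] [NormedSpace ℝ F] {u : ℝ → E3 → F}
    (h : ∀ τ : ℝ, 0 < τ → MemL2L2 τ u) (τ : ℝ) : MemLp (Function.uncurry u) 2 (stMeasure (Ioo 0 τ)) :=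
  (h (max τ 1) (lt_max_of_lt_right one_pos)).mono_measure
    (stMeasure_mono (Ioo_subset_Ioo_right (le_max_left _ _)))

lemma integrable_smul_of_locallyIntegrableOn {u : ℝ → E3} (hu : LocallyIntegrableOn u (Ioi 0) volume)
    {χ : ℝ → ℝ} (hχ : Continuous χ) (hχc : HasCompactSupport χ) (hs : tsupport χ ⊆ Ioi 0) (i : Fin 3) :
    Integrable (fun t => χ t * u t i) := by
  obtain ⟨M, hM⟩ := hχc.exists_bound_of_continuous hχ
  have h1 : IntegrableOn (fun t => u t i) (tsupport χ) :=
    Integrable.eval_piLp (hu.integrableOn_compact_subset hs hχc.isCompact) i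
  have h2 := (integrable_indicator_iff (isClosed_tsupport χ).measurableSet).2 h1
  refine (h2.bdd_mul (c := M) hχ.aestronglyMeasurable (Eventually.of_forall hM)).congr
    (Eventually.of_forall fun t => ?_)
  by_cases ht : t ∈ tsupport χ
  · simp [ht]
  · simp [image_eq_zero_of_notMem_tsupport ht]

/-- A solution together with its derivatives, which are square integrable. -/
structure StokesDerivs (f : ℝ → E3 → E3) (v : ℝ → E3 → E3) (φ : ℝ → E3 → ℝ) (vt : ℝ → E3 → E3)
    (Dv : Fin 3 → ℝ → E3 → E3) (D2v : Fin 3 → Fin 3 → ℝ → E3 → E3) (Dφ : Fin 3 → ℝ → E3 → ℝ) : Prop where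
  time : HasWeakTimeDeriv (Ioi 0) v vt
  grad : HasWeakGrad (Ioi 0) v Dv
  hess : ∀ i, HasWeakGrad (Ioi 0) (Dv i) (D2v i)
  grad_prs : HasWeakGrad (Ioi 0) φ Dφ
  momentum : ∀ᵐ p ∂(stMeasure (Ioi 0)), ∀ h : Fin 3,
      vt p.1 p.2 h = (∑ i, D2v i i p.1 p.2 h) - Dφ h p.1 p.2 + f p.1 p.2 h
  div : ∀ᵐ p ∂(stMeasure (Ioi 0)), ∑ i, Dv i p.1 p.2 i = 0
  memLp : ∀ τ, MemLp (Function.uncurry v) 2 (stMeasure (Ioo 0 τ))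
  memLp_grad : ∀ i τ, MemLp (Function.uncurry (Dv i)) 2 (stMeasure (Ioo 0 τ))
  memLp_hess : ∀ i j τ, MemLp (Function.uncurry (D2v i j)) 2 (stMeasure (Ioo 0 τ))
  memLp_prs : ∀ i τ, MemLp (Function.uncurry (Dφ i)) 2 (stMeasure (Ioo 0 τ))
  isD012 : ∀ᵐ t ∂((volume : Measure ℝ).restrict (Ioi 0)), IsD012 (φ t) (fun i => Dφ i t)
  initial : Tendsto (fun t => eLpNorm (v t) 2 volume)
    (𝓝 (0 : ℝ) ⊓ ae ((volume : Measure ℝ).restrict (Ioi 0))) (𝓝 0)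

lemma SolvesStokes.exists_derivs {f v : ℝ → E3 → E3} {φ : ℝ → E3 → ℝ} (h : SolvesStokes f v φ) :
    ∃ vt Dv D2v Dφ, StokesDerivs f v φ vt Dv D2v Dφ := by
  obtain ⟨vt, Dv, D2v, Dφ, h1, h2, h3, h4, h5, h6⟩ := h.equations
  have hsub : ∀ τ : ℝ, Ioo 0 τ ⊆ Ioi 0 := fun τ => Ioo_subset_Ioi_self
  have key : ∀ τ : ℝ, 0 < τ → (∀ i, MemL2L2 τ (Dv i)) ∧ ∀ i j, MemL2L2 τ (D2v i j) := by
    intro τ hτ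
    obtain ⟨-, Du, D2u, a1, a2, a3, a4⟩ := h.mem_space τ hτ
    have e1 := fun i => a3.ae_unique (h2.mono (hsub τ)) (Eventually.of_forall fun t => ae_eq_refl _) i
    have e2 := fun i j => (a4 i).ae_unique ((h3 i).mono (hsub τ)) (ae_ae_of_uncurry_ae_eq (e1 i)) j
    exact ⟨fun i => MemLp.ae_eq (e1 i) (a1 i), fun i j => MemLp.ae_eq (e2 i j) (a2 i j)⟩
  have keyφ : ∀ τ : ℝ, 0 < τ → (∀ i, MemL2L2 τ (Dφ i)) ∧
      ∀ᵐ t ∂((volume : Measure ℝ).restrict (Ioo 0 τ)), IsD012 (φ t) (fun i => Dφ i t) := by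
    intro τ hτ
    obtain ⟨-, Dφ', a1, a2⟩ := h.mem_pressure τ hτ
    have hg : HasWeakGrad (Ioo 0 τ) φ Dφ' :=
      ⟨fun i => (a1 i).1, a2.mono fun t ht i => ht.hasWeakPartial i⟩
    have e1 := fun i => hg.ae_unique (h4.mono (hsub τ)) (Eventually.of_forall fun t => ae_eq_refl _) i
    refine ⟨fun i => MemLp.ae_eq (e1 i) (a1 i), ?_⟩
    filter_upwards [a2, ae_all_iff.2 fun i => ae_ae_of_uncurry_ae_eq (e1 i)] with t ht ht'
    exact ht.congr (ae_eq_refl _) ht'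
  refine ⟨vt, Dv, D2v, Dφ, h1, h2, h3, h4, h5, h6, MemL2L2.of_Ioi fun τ hτ => (h.mem_space τ hτ).1,
    fun i => MemL2L2.of_Ioi fun τ hτ => (key τ hτ).1 i,
    fun i j => MemL2L2.of_Ioi fun τ hτ => (key τ hτ).2 i j,
    fun i => MemL2L2.of_Ioi fun τ hτ => (keyφ τ hτ).1 i, ?_, h.initial⟩
  refine ae_Ioi_of_forall_Ioo fun n => ?_
  exact ae_restrict_of_ae_restrict_of_subset (Ioo_subset_Ioo_right (by linarith : (n : ℝ) ≤ n + 1))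
    (keyφ (n + 1) (by positivity)).2

/-- Two solutions differ by a solution of the homogeneous problem. -/
lemma StokesDerivs.exists_homStokes {f v v' vt vt' : ℝ → E3 → E3} {φ φ' : ℝ → E3 → ℝ}
    {Dv Dv' : Fin 3 → ℝ → E3 → E3} {D2v D2v' : Fin 3 → Fin 3 → ℝ → E3 → E3}
    {Dφ Dφ' : Fin 3 → ℝ → E3 → ℝ} (S : StokesDerivs f v φ vt Dv D2v Dφ)
    (S' : StokesDerivs f v' φ' vt' Dv' D2v' Dφ') :
    ∃ w Dw D2w g, HomStokes w Dw D2w (fun t x => φ t x - φ' t x) g ∧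
      ∀ h, ∀ᵐ t ∂((volume : Measure ℝ).restrict (Ioi 0)), (fun x => v t x h - v' t x h) =ᵐ[volume] w h t := by
  have m1 : ∀ h τ, MemLp (Function.uncurry fun t x => v t x h - v' t x h) 2 (stMeasure (Ioo 0 τ)) :=
    fun h τ => ((S.memLp τ).eval_piLp h).sub ((S'.memLp τ).eval_piLp h)
  have m2 : ∀ k h τ, MemLp (Function.uncurry fun t x => Dv k t x h - Dv' k t x h) 2 (stMeasure (Ioo 0 τ)) :=
    fun k h τ => ((S.memLp_grad k τ).eval_piLp h).sub ((S'.memLp_grad k τ).eval_piLp h)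
  have m3 : ∀ k h τ, MemLp (Function.uncurry fun t x => D2v k k t x h - D2v' k k t x h) 2
      (stMeasure (Ioo 0 τ)) :=
    fun k h τ => ((S.memLp_hess k k τ).eval_piLp h).sub ((S'.memLp_hess k k τ).eval_piLp h)
  have m4 : ∀ h τ, MemLp (Function.uncurry fun t x => Dφ h t x - Dφ' h t x) 2 (stMeasure (Ioo 0 τ)) :=
    fun h τ => (S.memLp_prs h τ).sub (S'.memLp_prs h τ)
  choose w hw ew using fun h => exists_measurable_rep (aestronglyMeasurable_Ioi fun τ _ => (m1 h τ).1)
  choose D2w hD2w eD2w using fun k h =>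
    exists_measurable_rep (aestronglyMeasurable_Ioi fun τ _ => (m3 k h τ).1)
  choose g hg eg using fun h => exists_measurable_rep (aestronglyMeasurable_Ioi fun τ _ => (m4 h τ).1)
  have hac : ∀ τ : ℝ, stMeasure (Ioo 0 τ) ≪ stMeasure (Ioi 0) := fun τ =>
    Measure.absolutelyContinuous_of_le (stMeasure_mono Ioo_subset_Ioi_self)
  have sw := fun h => ae_ae_of_uncurry_ae_eq (ew h)
  have sD2w := fun k h => ae_ae_of_uncurry_ae_eq (eD2w k h)
  have sg := fun h => ae_ae_of_uncurry_ae_eq (eg h)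
  refine ⟨w, fun k h t x => Dv k t x h - Dv' k t x h, D2w, g, ⟨hw, hD2w, hg,
    fun h τ => (m1 h τ).ae_eq ((hac τ).ae_le (ew h)), m2, fun k h τ => (m3 k h τ).ae_eq ((hac τ).ae_le (eD2w k h)),
    fun h τ => (m4 h τ).ae_eq ((hac τ).ae_le (eg h)), ?_, ?_, ?_⟩, sw⟩
  · have d1 : ∀ᵐ t ∂((volume : Measure ℝ).restrict (Ioi 0)), ∀ᵐ x ∂(volume : Measure E3),
        ∑ i, Dv i t x i = 0 := Measure.ae_ae_of_ae_prod S.div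
    have d2 : ∀ᵐ t ∂((volume : Measure ℝ).restrict (Ioi 0)), ∀ᵐ x ∂(volume : Measure E3),
        ∑ i, Dv' i t x i = 0 := Measure.ae_ae_of_ae_prod S'.div
    filter_upwards [S.grad.2, S'.grad.2, ae_all_iff.2 fun i => (S.hess i).2,
      ae_all_iff.2 fun i => (S'.hess i).2, S.isD012, S'.isD012, ae_all_iff.2 sw,
      ae_all_iff.2 fun k => ae_all_iff.2 (sD2w k), ae_all_iff.2 sg, d1, d2]
      with t a1 a2 a3 a4 a5 a6 a7 a8 a9 a10 a11
    refine ⟨fun k h => (((a1 k).apply h).sub ((a2 k).apply h)).congr (a7 h) (ae_eq_refl _),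
      fun k h => (((a3 k k).apply h).sub ((a4 k k).apply h)).congr (ae_eq_refl _) (a8 k h),
      (a5.sub a6).congr (ae_eq_refl _) a9, ?_⟩
    filter_upwards [a10, a11] with x b1 b2
    rw [Finset.sum_sub_distrib, b1, b2, sub_zero]
  · intro h ψ hψ hψc hs
    have hs' : tsupport (deriv ψ) ⊆ Ioi 0 := tsupport_deriv_subset.trans hs
    have hc' := hψ.continuous_deriv (by simp)
    -- the equations and the representatives, for almost every `x`
    have hall : ∀ᵐ p ∂(stMeasure (Ioi 0)), v p.1 p.2 h - v' p.1 p.2 h = w h p.1 p.2 ∧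
        vt p.1 p.2 h - vt' p.1 p.2 h = (∑ k, D2w k h p.1 p.2) - g h p.1 p.2 := by
      filter_upwards [ew h, ae_all_iff.2 fun k => eD2w k h, eg h, S.momentum, S'.momentum]
        with p b1 b2 b3 b4 b5
      refine ⟨b1, ?_⟩
      have b2' : ∀ k, D2v k k p.1 p.2 h - D2v' k k p.1 p.2 h = D2w k h p.1 p.2 := b2
      have b3' : Dφ h p.1 p.2 - Dφ' h p.1 p.2 = g h p.1 p.2 := b3
      rw [b4 h, b5 h, ← b3', Finset.sum_congr rfl fun k _ => (b2' k).symm, Finset.sum_sub_distrib]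
      ring
    have hall' : ∀ᵐ x ∂(volume : Measure E3), ∀ᵐ t ∂((volume : Measure ℝ).restrict (Ioi 0)),
        v t x h - v' t x h = w h t x ∧ vt t x h - vt' t x h = (∑ k, D2w k h t x) - g h t x :=
      Measure.ae_ae_of_ae_prod (Measure.measurePreserving_swap.quasiMeasurePreserving.ae hall)
    filter_upwards [S.time.1, S'.time.1, S.time.2 ψ hψ hψc hs, S'.time.2 ψ hψ hψc hs, hall']
      with x c1 c2 c3 c4 c5
    have comp : ∀ {u ut : ℝ → E3 → E3}, LocallyIntegrableOn (fun t => u t x) (Ioi 0) volume →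
        LocallyIntegrableOn (fun t => ut t x) (Ioi 0) volume →
        ∫ t, deriv ψ t • u t x = -∫ t, ψ t • ut t x →
        ∫ t, deriv ψ t * u t x h = -∫ t, ψ t * ut t x h := by
      intro u ut e1 e2 e3
      have := congrArg (fun z : E3 => z h) e3
      simp only at this
      rw [PiLp.neg_apply, eval_integral_piLp, eval_integral_piLp] at this
      · exact this
      · exact fun i => integrable_smul_of_locallyIntegrableOn e2 hψ.continuous hψc hs i
      · exact fun i => integrable_smul_of_locallyIntegrableOn e1 hc' hψc.deriv hs' i
    have r1 : ∫ t, deriv ψ t * w h t x = ∫ t, (deriv ψ t * v t x h - deriv ψ t * v' t x h) := by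
      refine integral_congr_ae ?_
      filter_upwards [(ae_restrict_iff' measurableSet_Ioi).1 c5] with t ht
      by_cases h0 : t ∈ Ioi (0 : ℝ)
      · rw [← (ht h0).1, mul_sub]
      · simp [image_eq_zero_of_notMem_tsupport fun hh => h0 (hs' hh)]
    have r2 : ∫ t, ψ t * ((∑ k, D2w k h t x) - g h t x) = ∫ t, (ψ t * vt t x h - ψ t * vt' t x h) := by
      refine integral_congr_ae ?_
      filter_upwards [(ae_restrict_iff' measurableSet_Ioi).1 c5] with t ht
      by_cases h0 : t ∈ Ioi (0 : ℝ)
      · rw [← (ht h0).2, mul_sub]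
      · simp [image_eq_zero_of_notMem_tsupport fun hh => h0 (hs hh)]
    rw [r1, r2, integral_sub (integrable_smul_of_locallyIntegrableOn c1.1 hc' hψc.deriv hs' h)
      (integrable_smul_of_locallyIntegrableOn c2.1 hc' hψc.deriv hs' h),
      integral_sub (integrable_smul_of_locallyIntegrableOn c1.2 hψ.continuous hψc hs h)
      (integrable_smul_of_locallyIntegrableOn c2.2 hψ.continuous hψc hs h), comp c1.1 c1.2 c3,
      comp c2.1 c2.2 c4]
    ring
  · intro h
    have hlim := S.initial.add S'.initial
    rw [add_zero] at hlim
    refine tendsto_of_tendsto_of_tendsto_of_le_of_le' tendsto_const_nhds hlim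
      (Eventually.of_forall fun _ => zero_le) ?_
    have : ∀ᵐ t ∂((volume : Measure ℝ).restrict (Ioi 0)),
        eLpNorm (w h t) 2 volume ≤ eLpNorm (v t) 2 volume + eLpNorm (v' t) 2 volume := by
      filter_upwards [sw h, S.grad.2, S'.grad.2] with t a1 a2 a3
      rw [← eLpNorm_congr_ae a1]
      refine le_trans (eLpNorm_mono fun x => ?_) (eLpNorm_sub_le (a2 0).1.aestronglyMeasurable
        (a3 0).1.aestronglyMeasurable (by norm_num))
      exact PiLp.norm_apply_le (v t x - v' t x) h
    exact this.filter_mono inf_le_right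

/-- Uniqueness for the Cauchy problem. -/
theorem SolvesStokes.ae_unique {f v w : ℝ → E3 → E3} {φ q : ℝ → E3 → ℝ} (h : SolvesStokes f v φ)
    (h' : SolvesStokes f w q) :
    Function.uncurry v =ᵐ[stMeasure (Ioi 0)] Function.uncurry w ∧
    Function.uncurry φ =ᵐ[stMeasure (Ioi 0)] Function.uncurry q := by
  obtain ⟨vt, Dv, D2v, Dφ, S⟩ := h.exists_derivs
  obtain ⟨wt, Dw, D2w, Dq, S'⟩ := h'.exists_derivs
  obtain ⟨z, Dz, D2z, g, H, hz⟩ := S.exists_homStokes S'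
  have hφ := aestronglyMeasurable_Ioi fun τ hτ => (h.mem_pressure τ hτ).1
  have hq := aestronglyMeasurable_Ioi fun τ hτ => (h'.mem_pressure τ hτ).1
  refine ⟨uncurry_ae_eq_of_ae_ae (aestronglyMeasurable_Ioi fun τ _ => (S.memLp τ).1)
    (aestronglyMeasurable_Ioi fun τ _ => (S'.memLp τ).1) ?_, uncurry_ae_eq_of_ae_ae hφ hq ?_⟩
  · filter_upwards [H.eq_zero, ae_all_iff.2 hz] with t h1 h2
    filter_upwards [ae_all_iff.2 h1.1, ae_all_iff.2 h2] with x b1 b2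
    ext i
    have := (b2 i).trans (b1 i)
    exact sub_eq_zero.1 this
  · filter_upwards [H.eq_zero] with t h1
    filter_upwards [h1.2] with x hx
    exact sub_eq_zero.1 hx

/-! ### Weighted norms and pointwise representatives of the data -/

section Weights

variable {F : Type*} [NormedAddCommGroup F] {m : ℕ} {u : ℝ → E3 → F}

lemma ae_norm_le_of_wNorm_le {M : ℝ} (hM : 0 ≤ M) (h : wNorm m u ≤ ENNReal.ofReal M) :
    ∀ᵐ p ∂(stMeasure (Ioi 0)), ‖u p.1 p.2‖ ≤ 2 ^ (m - 1) * M * ((1 + ‖p.2‖) ^ m)⁻¹ := by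
  filter_upwards [ENNReal.ae_le_essSup (μ := stMeasure (Ioi 0))
    fun p : ℝ × E3 => ENNReal.ofReal ((1 + ‖p.2‖ ^ m) * ‖u p.1 p.2‖)] with p hp
  have h1 := (ENNReal.ofReal_le_ofReal_iff hM).1 (hp.trans h)
  have h2 := add_pow_le zero_le_one (norm_nonneg p.2) m
  rw [one_pow] at h2
  rw [← div_eq_mul_inv, le_div_iff₀ (by positivity)]
  calc ‖u p.1 p.2‖ * (1 + ‖p.2‖) ^ m ≤ ‖u p.1 p.2‖ * (2 ^ (m - 1) * (1 + ‖p.2‖ ^ m)) := by gcongr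
    _ = 2 ^ (m - 1) * ((1 + ‖p.2‖ ^ m) * ‖u p.1 p.2‖) := by ring
    _ ≤ _ := by gcongr

lemma wNorm_le_of_ae_norm_le {K : ℝ} (hm : m ≠ 0)
    (h : ∀ᵐ p ∂(stMeasure (Ioi 0)), ‖u p.1 p.2‖ ≤ K * ((1 + ‖p.2‖) ^ m)⁻¹) :
    wNorm m u ≤ ENNReal.ofReal K := by
  refine essSup_le_of_ae_le _ ?_
  filter_upwards [h] with p hp
  refine ENNReal.ofReal_le_ofReal ?_
  have h2 := pow_add_pow_le zero_le_one (norm_nonneg p.2) hm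
  rw [one_pow] at h2
  rw [← div_eq_mul_inv, le_div_iff₀ (by positivity)] at hp
  calc (1 + ‖p.2‖ ^ m) * ‖u p.1 p.2‖ ≤ (1 + ‖p.2‖) ^ m * ‖u p.1 p.2‖ := by gcongr
    _ ≤ K := by rwa [mul_comm]

end Weights

/-- The field `u`, cut off to the size `K (1 + |x|)^{-m}` and set to zero at the times outside
of `S`. -/
noncomputable def truncate (S : Set ℝ) (K : ℝ) (m : ℕ) (u : ℝ → E3 → ℝ) (t : ℝ) (x : E3) : ℝ :=
  S.indicator (fun t => max (-(K * ((1 + ‖x‖) ^ m)⁻¹)) (min (u t x) (K * ((1 + ‖x‖) ^ m)⁻¹))) t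

section Truncate

variable {S : Set ℝ} {K : ℝ} {m : ℕ} {u : ℝ → E3 → ℝ}

lemma measurable_truncate (hS : MeasurableSet S) (hu : Measurable (Function.uncurry u)) :
    Measurable (Function.uncurry (truncate S K m u)) := by
  have h : Measurable fun p : ℝ × E3 =>
      max (-(K * ((1 + ‖p.2‖) ^ m)⁻¹)) (min (u p.1 p.2) (K * ((1 + ‖p.2‖) ^ m)⁻¹)) := by
    have hw : Measurable fun p : ℝ × E3 => K * ((1 + ‖p.2‖) ^ m)⁻¹ := by fun_prop
    exact hw.neg.max (Measurable.min hu hw)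
  exact h.indicator (hS.preimage measurable_fst)

lemma abs_truncate_le (hK : 0 ≤ K) (t : ℝ) (x : E3) :
    |truncate S K m u t x| ≤ K * ((1 + ‖x‖) ^ m)⁻¹ := by
  have h : 0 ≤ K * ((1 + ‖x‖) ^ m)⁻¹ := by positivity
  unfold truncate
  by_cases ht : t ∈ S
  · rw [indicator_of_mem ht, abs_le]
    exact ⟨le_max_left _ _, max_le (by linarith) (min_le_right _ _)⟩
  · rwa [indicator_of_notMem ht, abs_zero]

lemma truncate_of_notMem {t : ℝ} (ht : t ∉ S) : truncate S K m u t = 0 := by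
  funext x
  exact indicator_of_notMem ht _

lemma truncate_of_mem {t : ℝ} (ht : t ∈ S) {x : E3} (h : |u t x| ≤ K * ((1 + ‖x‖) ^ m)⁻¹) :
    truncate S K m u t x = u t x := by
  obtain ⟨h1, h2⟩ := abs_le.1 h
  unfold truncate
  rw [indicator_of_mem ht, min_eq_left h2, max_eq_right h1]

end Truncate

/-- Integrals of the components of a tensor of size `(1 + |y|)^{-2}` against derivatives of order
`n` of a test function. -/
lemma enorm_sum_integral_mul_le {n : ℕ} {η : E3 → ℝ} {θ : Fin 3 → E3 → ℝ} {T : E3 → T3} {K : ℝ}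
    (hK : 0 ≤ K) (hθ : ∀ j y, ‖θ j y‖ ≤ ‖iteratedFDeriv ℝ n η y‖)
    (hT : ∀ᵐ y, ‖T y‖ ≤ K * ((1 + ‖y‖) ^ 2)⁻¹) (h : Fin 3) :
    ‖∑ j, ∫ y, θ j y * T y (j, h)‖ₑ ≤
      ENNReal.ofReal (3 * K) * ∫⁻ y, ‖iteratedFDeriv ℝ n η y‖ₑ * ENNReal.ofReal (((1 + ‖y‖) ^ 2)⁻¹) := by
  set I := ∫⁻ y, ‖iteratedFDeriv ℝ n η y‖ₑ * ENNReal.ofReal (((1 + ‖y‖) ^ 2)⁻¹)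
  have key : ∀ j, ‖∫ y, θ j y * T y (j, h)‖ₑ ≤ ENNReal.ofReal K * I := fun j => by
    refine (enorm_integral_le_lintegral_enorm _).trans ?_
    rw [← lintegral_const_mul' _ _ ENNReal.ofReal_ne_top]
    refine lintegral_mono_ae ?_
    filter_upwards [hT] with y hy
    rw [enorm_mul]
    calc ‖θ j y‖ₑ * ‖T y (j, h)‖ₑ
        ≤ ‖iteratedFDeriv ℝ n η y‖ₑ * ENNReal.ofReal (K * ((1 + ‖y‖) ^ 2)⁻¹) := by
          gcongr
          · exact enorm_le_iff_norm_le.2 (hθ j y)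
          · rw [← ofReal_norm]
            exact ENNReal.ofReal_le_ofReal ((PiLp.norm_apply_le _ _).trans hy)
      _ = _ := by rw [ENNReal.ofReal_mul hK]; ring
  calc ‖∑ j, ∫ y, θ j y * T y (j, h)‖ₑ ≤ ∑ j, ‖∫ y, θ j y * T y (j, h)‖ₑ := enorm_sum_le _ _
    _ ≤ ∑ _j : Fin 3, ENNReal.ofReal K * I := Finset.sum_le_sum fun j _ => key j
    _ = ENNReal.ofReal (3 * K) * I := by
        rw [Finset.sum_const, Finset.card_fin, nsmul_eq_mul, ENNReal.ofReal_mul (by norm_num), mul_assoc]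
        simp

section WeakEstimates

variable {T : E3 → T3} {f : E3 → E3} {K : ℝ} {η : E3 → ℝ}

lemma HasWeakDiv.enorm_integral_mul_le (hf : HasWeakDiv T f) (hK : 0 ≤ K)
    (hT : ∀ᵐ y, ‖T y‖ ≤ K * ((1 + ‖y‖) ^ 2)⁻¹) (hη : IsTestFun η) (h : Fin 3) :
    ‖∫ y, η y * f y h‖ₑ ≤ ENNReal.ofReal (3 * K) *
      ∫⁻ y, ‖iteratedFDeriv ℝ 1 η y‖ₑ * ENNReal.ofReal (((1 + ‖y‖) ^ 2)⁻¹) := by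
  rw [← enorm_neg, ← hf.2.2 η hη h]
  exact enorm_sum_integral_mul_le hK (fun j y => norm_dpart_le hη.1 [j] y) hT h

lemma HasWeakDiv.enorm_integral_mul_partial_le (hf : HasWeakDiv T f) (hK : 0 ≤ K)
    (hT : ∀ᵐ y, ‖T y‖ ≤ K * ((1 + ‖y‖) ^ 2)⁻¹) (hη : IsTestFun η) {l : Fin 3} {g : E3 → E3}
    (hg : HasWeakPartial l f g) (h : Fin 3) :
    ‖∫ y, η y * g y h‖ₑ ≤ ENNReal.ofReal (3 * K) *
      ∫⁻ y, ‖iteratedFDeriv ℝ 2 η y‖ₑ * ENNReal.ofReal (((1 + ‖y‖) ^ 2)⁻¹) := by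
  have h1 : ∫ y, partialD l η y * f y h = -∫ y, η y * g y h := (hg.apply h).2.2 η hη
  rw [← enorm_neg, ← h1, ← enorm_neg, ← hf.2.2 _ (hη.partialD l) h]
  exact enorm_sum_integral_mul_le hK (fun j y => norm_dpart_le hη.1 [j, l] y) hT h

end WeakEstimates

lemma ae_eq_components {I : Set ℝ} {u : ℝ → E3 → E3}
    (hu : AEStronglyMeasurable (Function.uncurry u) (stMeasure I)) :
    ∃ u' : Fin 3 → ℝ → E3 → ℝ, (∀ h, Measurable (Function.uncurry (u' h))) ∧
      ∀ᵐ p ∂(stMeasure I), ∀ h, u p.1 p.2 h = u' h p.1 p.2 := by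
  have hc : ∀ h, AEStronglyMeasurable (Function.uncurry fun t x => u t x h) (stMeasure I) := fun h =>
    (PiLp.continuous_apply 2 (fun _ : Fin 3 => ℝ) h).comp_aestronglyMeasurable hu
  choose u' h1 h2 using fun h => exists_measurable_rep (hc h)
  exact ⟨u', h1, ae_all_iff.2 h2⟩

/-- Data of finite weighted norm agree almost everywhere with data to which the pointwise theory
applies. -/
theorem exists_stokesData {G : ℝ → E3 → T3} {f : ℝ → E3 → E3} {Df : Fin 3 → ℝ → E3 → E3} {M : ℝ}
    (hM : 0 ≤ M) (hf : AEStronglyMeasurable (Function.uncurry f) (stMeasure (Ioi 0)))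
    (hdiv : ∀ᵐ t ∂((volume : Measure ℝ).restrict (Ioi 0)), HasWeakDiv (G t) (f t))
    (hgrad : HasWeakGrad (Ioi 0) f Df) (h2 : wNorm 2 G ≤ ENNReal.ofReal M)
    (h3 : wNorm 3 f ≤ ENNReal.ofReal M) (h4 : ∀ i, wNorm 4 (Df i) ≤ ENNReal.ofReal M) :
    ∃ f' Df', StokesData (8 * M) f' Df' ∧
      ∀ᵐ p ∂(stMeasure (Ioi 0)), ∀ h, f p.1 p.2 h = f' h p.1 p.2 := by
  obtain ⟨r, hr, hfr⟩ := ae_eq_components hf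
  choose d hd hDd using fun l => ae_eq_components (hgrad.1 l)
  have bG := ae_norm_le_of_wNorm_le hM h2
  have bf := ae_norm_le_of_wNorm_le hM h3
  have bD := ae_all_iff.2 fun l => ae_norm_le_of_wNorm_le hM (h4 l)
  have hw : ∀ (x : E3) (m : ℕ), 0 ≤ M * ((1 + ‖x‖) ^ m)⁻¹ := fun x m => by positivity
  have cf : ∀ᵐ p ∂(stMeasure (Ioi 0)), ∀ h,
      f p.1 p.2 h = r h p.1 p.2 ∧ |r h p.1 p.2| ≤ 8 * M * ((1 + ‖p.2‖) ^ 3)⁻¹ := by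
    filter_upwards [hfr, bf] with p a1 a2 h
    refine ⟨a1 h, ?_⟩
    rw [← a1 h, ← Real.norm_eq_abs]
    refine (PiLp.norm_apply_le _ _).trans (a2.trans ?_)
    have := hw p.2 3
    norm_num
    linarith
  have cD : ∀ᵐ p ∂(stMeasure (Ioi 0)), ∀ l h,
      Df l p.1 p.2 h = d l h p.1 p.2 ∧ |d l h p.1 p.2| ≤ 8 * M * ((1 + ‖p.2‖) ^ 4)⁻¹ := by
    filter_upwards [ae_all_iff.2 hDd, bD] with p a1 a2 l h
    refine ⟨a1 l h, ?_⟩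
    rw [← a1 l h, ← Real.norm_eq_abs]
    refine (PiLp.norm_apply_le _ _).trans ((a2 l).trans ?_)
    norm_num
  have sG : ∀ᵐ t ∂((volume : Measure ℝ).restrict (Ioi 0)), ∀ᵐ x ∂(volume : Measure E3),
      ‖G t x‖ ≤ 2 ^ (2 - 1) * M * ((1 + ‖x‖) ^ 2)⁻¹ := Measure.ae_ae_of_ae_prod bG
  have sf : ∀ᵐ t ∂((volume : Measure ℝ).restrict (Ioi 0)), ∀ᵐ x ∂(volume : Measure E3), ∀ h,
      f t x h = r h t x ∧ |r h t x| ≤ 8 * M * ((1 + ‖x‖) ^ 3)⁻¹ := Measure.ae_ae_of_ae_prod cf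
  have sD : ∀ᵐ t ∂((volume : Measure ℝ).restrict (Ioi 0)), ∀ᵐ x ∂(volume : Measure E3), ∀ l h,
      Df l t x h = d l h t x ∧ |d l h t x| ≤ 8 * M * ((1 + ‖x‖) ^ 4)⁻¹ := Measure.ae_ae_of_ae_prod cD
  -- the times at which all hypotheses hold for almost every `x` contain a measurable set of full measure
  obtain ⟨S, hSae, hS, hgood⟩ := (hdiv.and (hgrad.2.and (sG.and (sf.and (sD.and
    (ae_restrict_mem measurableSet_Ioi)))))).exists_measurable_mem
  have hB : 0 ≤ 8 * M := by positivity
  have ef : ∀ t ∈ S, ∀ h, (fun x => f t x h) =ᵐ[volume] truncate S (8 * M) 3 (r h) t := by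
    intro t ht h
    obtain ⟨-, -, -, a, -⟩ := hgood t ht
    filter_upwards [a] with x hx
    rw [truncate_of_mem ht (hx h).2, (hx h).1]
  have eD : ∀ t ∈ S, ∀ l h, (fun x => Df l t x h) =ᵐ[volume] truncate S (8 * M) 4 (d l h) t := by
    intro t ht l h
    obtain ⟨-, -, -, -, a, -⟩ := hgood t ht
    filter_upwards [a] with x hx
    rw [truncate_of_mem ht (hx l h).2, (hx l h).1]
  have hpast : ∀ s ≤ (0 : ℝ), s ∉ S := fun s hs h => by
    obtain ⟨-, -, -, -, -, a⟩ := hgood s h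
    exact absurd a (not_lt.2 hs)
  -- `G` is of size `2 M (1 + |y|)^{-2}`, and each weak derivative is a sum of three terms
  have hle : ENNReal.ofReal (3 * (2 ^ (2 - 1) * M)) ≤ ENNReal.ofReal (8 * M) :=
    ENNReal.ofReal_le_ofReal (by norm_num; linarith)
  refine ⟨fun h => truncate S (8 * M) 3 (r h), fun l h => truncate S (8 * M) 4 (d l h),
    ⟨hB, fun h => ⟨measurable_truncate hS (hr h), abs_truncate_le hB, fun s η hη => ?_,
      fun s hs => truncate_of_notMem (hpast s hs)⟩,
    fun l h => ⟨measurable_truncate hS (hd l h), abs_truncate_le hB, fun s η hη => ?_,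
      fun s hs => truncate_of_notMem (hpast s hs)⟩, fun l h s => ?_⟩, ?_⟩
  · by_cases hs : s ∈ S
    · obtain ⟨a1, -, a3, -⟩ := hgood s hs
      rw [← integral_congr_ae ((ef s hs h).mono fun x hx => congrArg (η x * ·) hx)]
      exact (a1.enorm_integral_mul_le (by positivity) a3 hη h).trans (by gcongr)
    · simp [truncate_of_notMem hs]
  · by_cases hs : s ∈ S
    · obtain ⟨a1, a2, a3, -⟩ := hgood s hs
      rw [← integral_congr_ae ((eD s hs l h).mono fun x hx => congrArg (η x * ·) hx)]
      exact (a1.enorm_integral_mul_partial_le (by positivity) a3 hη (a2 l) h).trans (by gcongr)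
    · simp [truncate_of_notMem hs]
  · by_cases hs : s ∈ S
    · exact ((hgood s hs).2.1 l).apply h |>.congr (ef s hs h) (eD s hs l h)
    · simp only [truncate_of_notMem hs]
      exact HasWeakPartial.zero l
  · have hSp : ∀ᵐ p ∂(stMeasure (Ioi 0)), p.1 ∈ S := by
      unfold stMeasure
      exact Measure.quasiMeasurePreserving_fst.ae hSae
    filter_upwards [hSp, cf] with p hp hx h
    rw [truncate_of_mem hp (hx h).2, (hx h).1]

/-- Every solution, with its derivatives, obeys the bounds of the explicit one. -/
theorem SolvesStokes.wNorm_le {B K : ℝ} {F : ℝ → E3 → E3} {f : Fin 3 → ℝ → E3 → ℝ}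
    {Df : Fin 3 → Fin 3 → ℝ → E3 → ℝ} (hd : StokesData B f Df) (hb : StokesBounds K f Df)
    (hF : ∀ᵐ p ∂(stMeasure (Ioi 0)), ∀ i, F p.1 p.2 i = f i p.1 p.2)
    {v : ℝ → E3 → E3} {φ : ℝ → E3 → ℝ} (h : SolvesStokes F v φ)
    {Dv : Fin 3 → ℝ → E3 → E3} {D2v : Fin 3 → Fin 3 → ℝ → E3 → E3} {Dφ : Fin 3 → ℝ → E3 → ℝ}
    (hDv : HasWeakGrad (Ioi 0) v Dv) (hD2v : ∀ i, HasWeakGrad (Ioi 0) (Dv i) (D2v i))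
    (hDφ : HasWeakGrad (Ioi 0) φ Dφ) :
    wNorm 1 v ≤ ENNReal.ofReal (2 * K) ∧ (∀ i, wNorm 2 (Dv i) ≤ ENNReal.ofReal (2 * K)) ∧
    (∀ i j, wNorm 3 (D2v i j) ≤ ENNReal.ofReal (2 * K)) ∧ wNorm 2 φ ≤ ENNReal.ofReal (2 * K) ∧
    ∀ i, wNorm 3 (Dφ i) ≤ ENNReal.ofReal (2 * K) := by
  have mf := fun j => (hd.data j).meas
  have mD := fun l j => (hd.grad l j).meas
  obtain ⟨e1, e2⟩ := h.ae_unique (hd.solvesStokes hF)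
  have e3 := hDv.ae_unique (hasWeakGrad_ofComp (Ioi 0) (fun k i => measurable_vel [k] i mf)
    fun k i t => hd.hasWeakPartial_vel k i t) (ae_ae_of_uncurry_ae_eq e1)
  have e4 := fun k => (hD2v k).ae_unique (hasWeakGrad_ofComp (Ioi 0)
    (fun l i => measurable_vel [k] i (mD l)) fun l i t => hd.hasWeakPartial_vel_grad l k i t)
    (ae_ae_of_uncurry_ae_eq (e3 k))
  have e5 := hDφ.ae_unique (u' := prs f) (Du' := fun l => prs (Df l))
    ⟨fun l => (measurable_prs (mD l)).aestronglyMeasurable,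
      Eventually.of_forall fun t l => hd.hasWeakPartial_prs l t⟩ (ae_ae_of_uncurry_ae_eq e2)
  have vec : ∀ {m : ℕ} {u : ℝ → E3 → E3} {w : Fin 3 → ℝ → E3 → ℝ}, m ≠ 0 →
      Function.uncurry u =ᵐ[stMeasure (Ioi 0)] Function.uncurry (ofComp w) →
      (∀ i t x, |w i t x| ≤ K * ((1 + ‖x‖) ^ m)⁻¹) → wNorm m u ≤ ENNReal.ofReal (2 * K) := by
    intro m u w hm hu hw
    refine wNorm_le_of_ae_norm_le hm ?_
    filter_upwards [hu] with p hp
    have hp' : u p.1 p.2 = ofComp w p.1 p.2 := hp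
    rw [hp', mul_assoc]
    exact norm_le_of_abs_apply_le fun i => hw i p.1 p.2
  have sca : ∀ {m : ℕ} {u w : ℝ → E3 → ℝ}, m ≠ 0 →
      Function.uncurry u =ᵐ[stMeasure (Ioi 0)] Function.uncurry w →
      (∀ t x, |w t x| ≤ K * ((1 + ‖x‖) ^ m)⁻¹) → wNorm m u ≤ ENNReal.ofReal (2 * K) := by
    intro m u w hm hu hw
    refine wNorm_le_of_ae_norm_le hm ?_
    filter_upwards [hu] with p hp
    have hp' : u p.1 p.2 = w p.1 p.2 := hp
    have h0 := hw p.1 p.2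
    rw [hp', mul_assoc, Real.norm_eq_abs]
    linarith [abs_nonneg (w p.1 p.2)]
  exact ⟨vec one_ne_zero e1 hb.vel, fun i => vec two_ne_zero (e3 i) (hb.grad_vel i),
    fun i j => vec three_ne_zero (e4 i j) (hb.hess_vel j i), sca two_ne_zero e2 hb.prs,
    fun i => sca three_ne_zero (e5 i) (hb.grad_prs i)⟩
theorem lemma2p3 :
    ∃ C : ℝ≥0, 0 < C ∧
      ∀ (G : ℝ → E3 → T3) (f : ℝ → E3 → E3) (Df : Fin 3 → ℝ → E3 → E3),
        AEStronglyMeasurable (Function.uncurry G) (stMeasure (Ioi 0)) →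
        AEStronglyMeasurable (Function.uncurry f) (stMeasure (Ioi 0)) →
        (∀ᵐ t ∂((volume : Measure ℝ).restrict (Ioi 0)), HasWeakDiv (G t) (f t)) →
        HasWeakGrad (Ioi 0) f Df →
        wNorm 2 G + (wNorm 3 f + ∑ i, wNorm 4 (Df i)) < ⊤ →
        (∃ (v : ℝ → E3 → E3) (φ : ℝ → E3 → ℝ), SolvesStokes f v φ) ∧
        (∀ (v w : ℝ → E3 → E3) (φ q : ℝ → E3 → ℝ),
          SolvesStokes f v φ → SolvesStokes f w q →
          Function.uncurry v =ᵐ[stMeasure (Ioi 0)] Function.uncurry w ∧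
          Function.uncurry φ =ᵐ[stMeasure (Ioi 0)] Function.uncurry q) ∧
        (∀ (v : ℝ → E3 → E3) (φ : ℝ → E3 → ℝ), SolvesStokes f v φ →
          ∀ (Dv : Fin 3 → ℝ → E3 → E3) (D2v : Fin 3 → Fin 3 → ℝ → E3 → E3)
            (Dφ : Fin 3 → ℝ → E3 → ℝ),
            HasWeakGrad (Ioi 0) v Dv → (∀ i, HasWeakGrad (Ioi 0) (Dv i) (D2v i)) →
            HasWeakGrad (Ioi 0) φ Dφ →
            (wNorm 1 v + ∑ i, wNorm 2 (Dv i) + ∑ i, ∑ j, wNorm 3 (D2v i j))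
                + (wNorm 2 φ + ∑ i, wNorm 3 (Dφ i)) < ⊤ ∧
            (wNorm 1 v + ∑ i, wNorm 2 (Dv i) + ∑ i, ∑ j, wNorm 3 (D2v i j))
                + (wNorm 2 φ + ∑ i, wNorm 3 (Dφ i))
              ≤ C * (wNorm 2 G + (wNorm 3 f + ∑ i, wNorm 4 (Df i)))) := by
  obtain ⟨C₀, hC₀, hbounds⟩ := exists_stokesBounds
  -- there are seventeen norms on the left, each at most `2 * (C₀ * (8 * N))`
  refine ⟨(272 * C₀).toNNReal, by simpa using hC₀, fun G f Df _ hf hdiv hgrad hN => ?_⟩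
  set N := wNorm 2 G + (wNorm 3 f + ∑ i, wNorm 4 (Df i)) with hNdef
  have hNM : ENNReal.ofReal N.toReal = N := ENNReal.ofReal_toReal hN.ne
  obtain ⟨f', Df', hd, hF⟩ := exists_stokesData (M := N.toReal) ENNReal.toReal_nonneg hf hdiv hgrad
    (by rw [hNM]; exact le_self_add)
    (by rw [hNM]; exact le_self_add.trans le_add_self)
    (fun i => by
      rw [hNM]
      exact (Finset.single_le_sum (f := fun i => wNorm 4 (Df i)) (fun _ _ => zero_le)
        (Finset.mem_univ i)).trans (le_add_self.trans le_add_self))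
  refine ⟨⟨_, _, hd.solvesStokes hF⟩, fun v w φ q h h' => h.ae_unique h', ?_⟩
  intro v φ h Dv D2v Dφ hDv hD2v hDφ
  obtain ⟨b1, b2, b3, b4, b5⟩ := h.wNorm_le hd (hbounds _ _ _ hd) hF hDv hD2v hDφ
  set c := ENNReal.ofReal (2 * (C₀ * (8 * N.toReal))) with hc
  have hle : (wNorm 1 v + ∑ i, wNorm 2 (Dv i) + ∑ i, ∑ j, wNorm 3 (D2v i j))
      + (wNorm 2 φ + ∑ i, wNorm 3 (Dφ i)) ≤ ((272 * C₀).toNNReal : ℝ≥0∞) * N := by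
    calc _ ≤ (c + ∑ _i : Fin 3, c + ∑ _i : Fin 3, ∑ _j : Fin 3, c) + (c + ∑ _i : Fin 3, c) := by
          gcongr with i _ i _ j _ i _
          · exact b2 i
          · exact b3 i j
          · exact b5 i
      _ = 17 * c := by
          simp only [Finset.sum_const, Finset.card_fin, nsmul_eq_mul]
          push_cast
          ring
      _ = ENNReal.ofReal (272 * C₀) * N := by
          rw [hc, ← ENNReal.ofReal_ofNat 17, ← ENNReal.ofReal_mul (by norm_num),
            show (17 : ℝ) * (2 * (C₀ * (8 * N.toReal))) = 272 * C₀ * N.toReal by ring,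
            ENNReal.ofReal_mul (by positivity), hNM]
      _ = _ := rfl
  exact ⟨hle.trans_lt (ENNReal.mul_lt_top ENNReal.coe_lt_top hN), hle⟩
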